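/- Let $M$ be an oriented Riemannian 4-dimensional orbifold (a Hausdorff space with an atlas of charts onto open subsets of $\mathbb{R}^4/\Gamma$, $\Gamma\subset SO(4)$ finite, whose transition functions lift to smooth orientation-preserving local diffeomorphisms, with a Riemannian metric on the local smooth coverings that is invariant under these lifts), and let $SO(M)$ be its bundle of oriented orthonormal frames, i.e. locally the quotient by $\Gamma$ of the frame bundle of the smooth covering. A spin structure on an open set $U\subset M$ is a two-fold covering $P\to SO(M)|_U$ with a continuous right action of $\mathrm{Spin}(4)$ lifting the action of $SO(4)$, such that $-1\in \mathrm{Spin}(4)$ has no fixed point in $P$. A (positive, negative Weyl) spinor field is a smooth $\mathrm{Spin}(4)$-equivariant function from $P$ to the spinor space $\Sigma=\Sigma^+\oplus\Sigma^-$ (to $\Sigma^+$, to $\Sigma^-$); equivalently, a section of the spinor bundle which is locally given by a smooth equivariant spinor field on the smooth covering. Let $x\in M$ be a singular point, i.e. its singularity group $\Gamma_x\subset SO(\widetilde T_xM)$ (the isotropy group of a preimage of $x$ in a local smooth covering, acting on the tangent space $\widetilde T_xM$ there) is non-trivial. Suppose that $M$ is spin, with a fixed spin structure. (1) If $\phi^+$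 is a positive and $\phi^-$ a negative Weyl spinor field on $M$, then $\phi^+$ or $\phi^-$ vanishes at $x$. (2) Both $\phi^+$ and $\phi^-$ vanish at $x$ unless there is a complex structure on $\widetilde T_xM$, compatible with the metric (and with no condition on its orientation), such that $\Gamma_x\subset SU(\widetilde T_xM)\simeq SU(2)$. (3) Suppose that there is such a complex structure and that $\Gamma_x\neq\{\pm1\}$. Then there is a spin structure $\sigma_0$ on a neighbourhood of $x$ for which some non-zero spinor at $x$ is invariant under $\Gamma_x$, acting through its lift to $\mathrm{Spin}(4)$ (the stabilizer of a point of $P$ over $x$). For every such $\sigma_0$, and every other local spin structure $\sigma$ around $x$, i.e. one which is not isomorphic to $\sigma_0$ over any neighbourhood of $x$, every spinor field of $\sigma$ vanishes at $x$. -/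

import Mathlib

open scoped ContDiff Topology
open TopologicalSpace

universe u

/-- The Euclidean space `ℝⁿ`. -/
abbrev EucSpace (n : ℕ) : Type := EuclideanSpace ℝ (Fin n)

/-! # Oriented orbifolds -/

/-- The special orthogonal group `SO(n)`. -/
def SpecialOrthogonal (n : ℕ) : Subgroup (EucSpace n ≃ₗᵢ[ℝ] EucSpace n) where
  carrier := {h | LinearMap.det (h.toLinearEquiv : EucSpace n →ₗ[ℝ] EucSpace n) = 1}
  one_mem' := by
    change LinearMap.det (LinearMap.id : EucSpace n →ₗ[ℝ] EucSpace n) = 1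
    exact LinearMap.det_id
  mul_mem' := by
    intro a b ha hb
    change LinearMap.det ((a.toLinearEquiv : EucSpace n →ₗ[ℝ] EucSpace n) ∘ₗ
      (b.toLinearEquiv : EucSpace n →ₗ[ℝ] EucSpace n)) = 1
    rw [LinearMap.det_comp, ha, hb, one_mul]
  inv_mem' := by
    intro a ha
    have h : LinearMap.det ((a.toLinearEquiv : EucSpace n →ₗ[ℝ] EucSpace n) ∘ₗ
        ((a⁻¹).toLinearEquiv : EucSpace n →ₗ[ℝ] EucSpace n)) = 1 := by
      have e : (a.toLinearEquiv : EucSpace n →ₗ[ℝ] EucSpace n) ∘ₗ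
          ((a⁻¹).toLinearEquiv : EucSpace n →ₗ[ℝ] EucSpace n) = LinearMap.id := by
        ext1 v
        exact a.apply_symm_apply v
      rw [e, LinearMap.det_id]
    rw [LinearMap.det_comp, ha, one_mul] at h
    exact h

/-- The relation "same orbit" of a group `Γ` of linear isometries of `ℝⁿ`. -/
def orbitSetoid {n : ℕ} (Γ : Subgroup (EucSpace n ≃ₗᵢ[ℝ] EucSpace n)) : Setoid (EucSpace n) where
  r y z := ∃ γ ∈ Γ, γ y = z
  iseqv :=
    { refl := fun _ => ⟨1, Γ.one_mem, rfl⟩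
      symm := by
        rintro y z ⟨γ, hγ, rfl⟩
        exact ⟨γ⁻¹, Γ.inv_mem hγ, γ.symm_apply_apply y⟩
      trans := by
        rintro y z w ⟨γ, hγ, rfl⟩ ⟨δ, hδ, rfl⟩
        exact ⟨δ * γ, Γ.mul_mem hδ hγ, rfl⟩ }

/-- An oriented orbifold chart: a homeomorphism of an open subset of `M` onto an open subset of
`ℝⁿ / Γ`, where `Γ` is a finite subgroup of `SO(n)`. -/
structure OrbifoldChart (n : ℕ) (M : Type u) [TopologicalSpace M] where
  /-- the group of the chart -/
  group : Subgroup (EucSpace n ≃ₗᵢ[ℝ] EucSpace n)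
  finite_group : Finite group
  group_le : group ≤ SpecialOrthogonal n
  /-- the chart itself -/
  toHomeo : OpenPartialHomeomorph M (Quotient (orbitSetoid group))

namespace OrbifoldChart

variable {n : ℕ} {M : Type u} [TopologicalSpace M]

/-- The local smooth covering: the preimage in `ℝⁿ` of the image of the chart. -/
def dom (c : OrbifoldChart n M) : Set (EucSpace n) :=
  {y | (Quotient.mk (orbitSetoid c.group) y) ∈ c.toHomeo.target}

/-- The ramified covering map from `c.dom` to `M`. -/
def proj (c : OrbifoldChart n M) (y : EucSpace n) : M :=
  c.toHomeo.symm (Quotient.mk (orbitSetoid c.group) y)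

/-- The isotropy group of a point `y` of the local smooth covering. It is a subgroup of `SO(n)`
which represents the singularity group `Γ_x` of the point `x = c.proj y`, and acts on
the tangent space at `y` (each of its elements is its own differential). -/
def isotropy (c : OrbifoldChart n M) (y : EucSpace n) :
    Subgroup (EucSpace n ≃ₗᵢ[ℝ] EucSpace n) where
  carrier := {γ | γ ∈ c.group ∧ γ y = y}
  one_mem' := ⟨c.group.one_mem, rfl⟩
  mul_mem' := by
    rintro a b ⟨ha, ha'⟩ ⟨hb, hb'⟩
    refine ⟨c.group.mul_mem ha hb, ?_⟩
    change a (b y) = y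
    rw [hb', ha']
  inv_mem' := by
    rintro a ⟨ha, ha'⟩
    refine ⟨c.group.inv_mem ha, ?_⟩
    change a.symm y = y
    rw [LinearIsometryEquiv.symm_apply_eq, ha']

/-- `F` is a local lift, to the local smooth coverings, of the transition function from the
chart `c` to the chart `d`: a diffeomorphism between open sets, over the identity of `M`. -/
structure IsTransitionLift (c d : OrbifoldChart n M)
    (F : OpenPartialHomeomorph (EucSpace n) (EucSpace n)) : Prop where
  source_subset : F.source ⊆ c.dom
  target_subset : F.target ⊆ d.dom
  smooth : ContDiffOn ℝ ∞ F F.source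
  smooth_symm : ContDiffOn ℝ ∞ F.symm F.target
  proj_eq : ∀ y ∈ F.source, d.proj (F y) = c.proj y

end OrbifoldChart

/-- The structure of an oriented smooth `n`-dimensional orbifold on a topological space `M`,
given by an atlas. -/
structure OrientedOrbifold (n : ℕ) (M : Type u) [TopologicalSpace M] where
  ι : Type u
  chart : ι → OrbifoldChart n M
  cover : ∀ x : M, ∃ i, x ∈ (chart i).toHomeo.source
  /-- the transition functions lift smoothly, near any pair of points over the same point -/
  compat : ∀ i j, ∀ y ∈ (chart i).dom, ∀ z ∈ (chart j).dom, (chart i).proj y = (chart j).proj z →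
    ∃ F, (chart i).IsTransitionLift (chart j) F ∧ y ∈ F.source ∧ F y = z
  /-- the lifts of the transition functions have positive Jacobian -/
  oriented : ∀ i j F, (chart i).IsTransitionLift (chart j) F → ∀ y ∈ F.source,
    0 < (fderiv ℝ F y).det

/-- A Riemannian metric on an orbifold: a family of Riemannian metrics on the local smooth
coverings which is invariant under the lifts of all transition functions (in particular under
the groups of the charts, whose elements are lifts of the identity). -/
structure OrbifoldMetric {n : ℕ} {M : Type u} [TopologicalSpace M]
    (O : OrientedOrbifold n M) where
  metric : O.ι → EucSpace n → EucSpace n →L[ℝ] EucSpace n →L[ℝ] ℝ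
  smooth : ∀ i, ContDiffOn ℝ ∞ (metric i) (O.chart i).dom
  symm : ∀ i, ∀ y ∈ (O.chart i).dom, ∀ v w, metric i y v w = metric i y w v
  pos : ∀ i, ∀ y ∈ (O.chart i).dom, ∀ v, v ≠ 0 → 0 < metric i y v v
  invariant : ∀ i j F, (O.chart i).IsTransitionLift (O.chart j) F → ∀ y ∈ F.source, ∀ v w,
    metric j (F y) (fderiv ℝ F y v) (fderiv ℝ F y w) = metric i y v w

/-! # The orthonormal frame bundle -/

namespace OrbifoldMetric

variable {n : ℕ} {M : Type u} [TopologicalSpace M] {O : OrientedOrbifold n M}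

/-- The oriented orthonormal frames of the local smooth covering of the `i`-th chart: pairs
`(y, e)` of a point `y` and an oriented isometry `e` of `ℝⁿ` onto the tangent space at `y`. -/
def frames (g : OrbifoldMetric O) (i : O.ι) : Set (EucSpace n × (EucSpace n →L[ℝ] EucSpace n)) :=
  {f | f.1 ∈ (O.chart i).dom ∧ (∀ v w, g.metric i f.1 (f.2 v) (f.2 w) = inner ℝ v w) ∧
    0 < f.2.det}

/-- Two frames of local smooth coverings are identified if the differential of a lift of a
transition function sends one to the other (for a single chart this divides by its group). -/
def FrameRel (g : OrbifoldMetric O) (a b : Σ i : O.ι, g.frames i) : Prop :=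
  ∃ F, (O.chart a.1).IsTransitionLift (O.chart b.1) F ∧ a.2.1.1 ∈ F.source ∧
    F a.2.1.1 = b.2.1.1 ∧ (fderiv ℝ F a.2.1.1).comp a.2.1.2 = b.2.1.2

/-- The bundle `SO(M)` of oriented orthonormal frames of the orbifold, with the quotient
topology. -/
def FrameBundle (g : OrbifoldMetric O) : Type u := Quot g.FrameRel

instance (g : OrbifoldMetric O) : TopologicalSpace g.FrameBundle :=
  inferInstanceAs (TopologicalSpace (Quot g.FrameRel))

/-- The frame of the orbifold given by a frame of a local smooth covering. -/
def frameMk (g : OrbifoldMetric O) (i : O.ι) (f : g.frames i) : g.FrameBundle :=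
  Quot.mk g.FrameRel ⟨i, f⟩

/-- The projection of the frame bundle to the orbifold. -/
def base (g : OrbifoldMetric O) : g.FrameBundle → M :=
  Quot.lift (fun a => (O.chart a.1).proj a.2.1.1) (by
    rintro a b ⟨F, hF, ha, hb, -⟩
    rw [← hb, hF.proj_eq _ ha])

/-- The right action of `h ∈ SO(n)` on the frames of a local smooth covering. -/
noncomputable def rotateFrame (g : OrbifoldMetric O) (i : O.ι) (f : g.frames i) (h : SpecialOrthogonal n) :
    g.frames i :=
  ⟨(f.1.1, f.1.2.comp (h.1.toContinuousLinearEquiv : EucSpace n →L[ℝ] EucSpace n)), f.2.1, by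
    intro v w
    change g.metric i f.1.1 (f.1.2 (h.1 v)) (f.1.2 (h.1 w)) = inner ℝ v w
    rw [f.2.2.1, LinearIsometryEquiv.inner_map_map], by
    have h1 : (f.1.2.comp (h.1.toContinuousLinearEquiv : EucSpace n →L[ℝ] EucSpace n)).det
        = f.1.2.det * LinearMap.det (h.1.toLinearEquiv : EucSpace n →ₗ[ℝ] EucSpace n) :=
      LinearMap.det_comp _ _
    have h2 : LinearMap.det (h.1.toLinearEquiv : EucSpace n →ₗ[ℝ] EucSpace n) = 1 := h.2
    change 0 < (f.1.2.comp (h.1.toContinuousLinearEquiv : EucSpace n →L[ℝ] EucSpace n)).det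
    rw [h1, h2, mul_one]
    exact f.2.2.2⟩

/-- The right action of `SO(n)` on the frame bundle. -/
noncomputable def rotate (g : OrbifoldMetric O) (f : g.FrameBundle) (h : SpecialOrthogonal n) : g.FrameBundle :=
  Quot.map (fun a : Σ i : O.ι, g.frames i => ⟨a.1, g.rotateFrame a.1 a.2 h⟩) (by
    rintro a b ⟨F, hF, ha, hb, hab⟩
    refine ⟨F, hF, ha, hb, ?_⟩
    change (fderiv ℝ F a.2.1.1).comp (a.2.1.2.comp _) = b.2.1.2.comp _
    rw [← hab]
    rfl) f

end OrbifoldMetric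

/-! # The group `Spin(4)` and its spin representation -/

/-- The quadratic form `v ↦ -|v|²` on `ℝ⁴`. -/
noncomputable def cliffordForm : QuadraticForm ℝ (EucSpace 4) :=
  -LinearMap.BilinMap.toQuadraticMap (innerₗ (EucSpace 4))

/-- The Clifford algebra of `ℝ⁴`, with the relation `v * v = -|v|²`. -/
abbrev Cl4 : Type := CliffordAlgebra cliffordForm

/-- The group `Spin(4)`. -/
abbrev Spin4 : Type := spinGroup cliffordForm

/-- The spin element `a` lies over the rotation `h`, that is, `h v = a * v * a⁻¹` for all
vectors `v`. This is the canonical projection from `Spin(4)` to `SO(4)`. -/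
def SpinCovers (a : Spin4) (h : SpecialOrthogonal 4) : Prop :=
  ∀ v : EucSpace 4, CliffordAlgebra.ι cliffordForm (h.1 v) =
    (a : Cl4) * CliffordAlgebra.ι cliffordForm v * ((a⁻¹ : Spin4) : Cl4)

/-- The space `Σ` of (Dirac) spinors in dimension 4. -/
abbrev Spinor : Type := Fin 2 ⊕ Fin 2 → ℂ

/-- Vectors of `ℝ⁴` as quaternions, written as complex `2 × 2` matrices. -/
def quatMatrix (v : EucSpace 4) : Matrix (Fin 2) (Fin 2) ℂ :=
  !![(v 0 : ℂ) + v 1 * Complex.I, (v 2 : ℂ) + v 3 * Complex.I;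
     -(v 2 : ℂ) + v 3 * Complex.I, (v 0 : ℂ) - v 1 * Complex.I]

/-- Clifford multiplication of spinors by vectors. -/
def gammaMatrix : EucSpace 4 →ₗ[ℝ] Matrix (Fin 2 ⊕ Fin 2) (Fin 2 ⊕ Fin 2) ℂ where
  toFun v := Matrix.fromBlocks 0 (-(quatMatrix v).conjTranspose) (quatMatrix v) 0
  map_add' v w := by
    ext i j
    rcases i with i | i <;> rcases j with j | j <;> fin_cases i <;> fin_cases j <;>
      simp [quatMatrix] <;> ring
  map_smul' r v := by
    ext i j
    rcases i with i | i <;> rcases j with j | j <;> fin_cases i <;> fin_cases j <;>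
      simp [quatMatrix] <;> ring

theorem gammaMatrix_sq (v : EucSpace 4) :
    gammaMatrix v * gammaMatrix v =
      algebraMap ℝ (Matrix (Fin 2 ⊕ Fin 2) (Fin 2 ⊕ Fin 2) ℂ) (cliffordForm v) := by
  have h : cliffordForm v = -(v 0 ^ 2 + v 1 ^ 2 + v 2 ^ 2 + v 3 ^ 2) := by
    simp [cliffordForm, innerₗ_apply_apply, Fin.sum_univ_four, EuclideanSpace.norm_sq_eq]
  rw [h]
  have hI : Complex.I * Complex.I = -1 := Complex.I_mul_I
  ext i j
  rcases i with i | i <;> rcases j with j | j <;> fin_cases i <;> fin_cases j <;>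
    simp [gammaMatrix, quatMatrix, Matrix.mul_apply,
      Fin.sum_univ_two, Matrix.algebraMap_matrix_apply] <;>
    first
    | linear_combination ((v 1 : ℂ) ^ 2 + (v 3 : ℂ) ^ 2) * hI
    | ring

/-- The (complex, irreducible) representation of the Clifford algebra on spinors. -/
noncomputable def cliffordRep : Cl4 →ₐ[ℝ] Matrix (Fin 2 ⊕ Fin 2) (Fin 2 ⊕ Fin 2) ℂ :=
  CliffordAlgebra.lift cliffordForm ⟨gammaMatrix, gammaMatrix_sq⟩

/-- The action of an element of the Clifford algebra (in particular of `Spin(4)`) on spinors. -/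
noncomputable def cliffordAct (a : Cl4) (v : Spinor) : Spinor :=
  (cliffordRep a).mulVec v

/-- The usual topology of `Spin(4)`, induced by its faithful spin representation. -/
noncomputable instance : TopologicalSpace Spin4 :=
  TopologicalSpace.induced (fun a : Spin4 => cliffordRep (a : Cl4)) inferInstance

/-- The `k`-th vector of the standard basis of `ℝ⁴`, in the Clifford algebra. -/
noncomputable def cliffordBasis (k : Fin 4) : Cl4 :=
  CliffordAlgebra.ι cliffordForm (EuclideanSpace.single k (1 : ℝ))

/-- The complex volume element of the Clifford algebra of `ℝ⁴`. -/
noncomputable def volumeElement : Cl4 :=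
  -(cliffordBasis 0 * cliffordBasis 1 * cliffordBasis 2 * cliffordBasis 3)

/-- Positive Weyl spinors, the space `Σ⁺`. -/
def IsPositiveWeyl (v : Spinor) : Prop := cliffordAct volumeElement v = v

/-- Negative Weyl spinors, the space `Σ⁻`. -/
def IsNegativeWeyl (v : Spinor) : Prop := cliffordAct volumeElement v = -v

/-! # Spin structures and spinor fields -/

/-- A spin structure on the open subset `U` of an oriented Riemannian 4-dimensional orbifold:
a two-fold covering `π` of the frame bundle over `U`, with a right action of `Spin(4)` which
lifts the action of `SO(4)` on frames. The covering is non-trivial over each fibre, in the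
sense that the element `-1` of `Spin(4)` has no fixed point. -/
structure SpinStructure {M : Type u} [TopologicalSpace M] {O : OrientedOrbifold 4 M}
    (g : OrbifoldMetric O) (U : Opens M) where
  P : Type u
  [topP : TopologicalSpace P]
  π : P → {f : g.FrameBundle // g.base f ∈ U}
  isCoveringMap : IsCoveringMap π
  two_sheets : ∀ f, (π ⁻¹' {f}).ncard = 2
  act : P → Spin4 → P
  act_one : ∀ p, act p 1 = p
  act_mul : ∀ p a b, act p (a * b) = act (act p a) b
  continuous_act : Continuous fun q : P × Spin4 => act q.1 q.2
  equivariant : ∀ p a h, SpinCovers a h → (π (act p a)).1 = g.rotate (π p).1 h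
  neg_one_free : ∀ p (a : Spin4), (a : Cl4) = -1 → act p a ≠ p

attribute [instance] SpinStructure.topP

namespace SpinStructure

variable {M : Type u} [TopologicalSpace M] {O : OrientedOrbifold 4 M} {g : OrbifoldMetric O}
  {U U' : Opens M}

/-- The point of the orbifold under a point of the spin bundle. -/
def base (σ : SpinStructure g U) (p : σ.P) : M := g.base (σ.π p).1

/-- Two spin structures on open subsets of the orbifold agree near `x`: they are isomorphic over
some neighbourhood of `x`. -/
def IsoNear (σ : SpinStructure g U) (σ' : SpinStructure g U') (x : M) : Prop :=
  ∃ V : Opens M, x ∈ V ∧ V ≤ U ∧ V ≤ U' ∧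
    ∃ Φ : {p : σ.P // σ.base p ∈ V} ≃ₜ {p : σ'.P // σ'.base p ∈ V},
      (∀ p, (σ'.π (Φ p).1).1 = (σ.π p.1).1) ∧
      ∀ p q a, q.1 = σ.act p.1 a → (Φ q).1 = σ'.act (Φ p).1 a

/-- There is a non-zero spinor at `x` which is invariant under the singularity group of `x`, the
latter acting on spinors through its lift to `Spin(4)`. For a point `p` of the spin bundle
over `x`, this lift is the stabilizer of `p`. -/
def HasInvariantSpinor (σ : SpinStructure g U) (x : M) : Prop :=
  ∃ p, σ.base p = x ∧ ∃ v : Spinor, v ≠ 0 ∧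
    ∀ a : Spin4, σ.act p a = p → cliffordAct (a : Cl4) v = v

end SpinStructure

/-- A (smooth) spinor field on `U`: a section of the spinor bundle, written as a
`Spin(4)`-equivariant function on the spin bundle. It is smooth if, in every smooth orthonormal
frame `e` of a local smooth covering, lifted to the spin bundle by `s`, its components are
smooth. -/
structure SpinorField {M : Type u} [TopologicalSpace M] {O : OrientedOrbifold 4 M}
    {g : OrbifoldMetric O} {U : Opens M} (σ : SpinStructure g U) where
  toFun : σ.P → Spinor
  equivariant : ∀ p (a : Spin4), toFun (σ.act p a) = cliffordAct ((a⁻¹ : Spin4) : Cl4) (toFun p)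
  smooth : ∀ (i : O.ι) (V : Set (EucSpace 4)) (e : EucSpace 4 → EucSpace 4 →L[ℝ] EucSpace 4)
    (s : EucSpace 4 → σ.P), IsOpen V → ContDiffOn ℝ ∞ e V → ContinuousOn s V →
    ∀ he : ∀ y ∈ V, (y, e y) ∈ g.frames i,
    (∀ y (hy : y ∈ V), (σ.π (s y)).1 = g.frameMk i ⟨(y, e y), he y hy⟩) →
    ContDiffOn ℝ ∞ (fun y => toFun (s y)) V

namespace SpinorField

variable {M : Type u} [TopologicalSpace M] {O : OrientedOrbifold 4 M} {g : OrbifoldMetric O}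
  {U : Opens M} {σ : SpinStructure g U}

/-- The spinor field is a positive Weyl spinor field. -/
def IsPositive (ψ : SpinorField σ) : Prop := ∀ p, IsPositiveWeyl (ψ.toFun p)

/-- The spinor field is a negative Weyl spinor field. -/
def IsNegative (ψ : SpinorField σ) : Prop := ∀ p, IsNegativeWeyl (ψ.toFun p)

/-- The spinor field vanishes at the point `x` of the orbifold. -/
def VanishesAt (ψ : SpinorField σ) (x : M) : Prop := ∀ p, σ.base p = x → ψ.toFun p = 0

end SpinorField

/-! # Complex structures and special unitary groups -/

/-- The complex vector space structure on a real vector space `V` given by a real endomorphism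
`J` with `J² = -1`. -/
@[reducible] noncomputable def complexModule {V : Type*} [AddCommGroup V] [Module ℝ V]
    (J : Module.End ℝ V) (hJ : J * J = -1) : Module ℂ V :=
  Module.compHom V (Complex.lift ⟨J, hJ⟩ : ℂ →ₐ[ℝ] Module.End ℝ V).toRingHom

/-- The determinant over `ℂ` of a real endomorphism which commutes with `J`. -/
noncomputable def complexDet {V : Type*} [AddCommGroup V] [Module ℝ V]
    (J : Module.End ℝ V) (hJ : J * J = -1) (T : Module.End ℝ V) (hT : T * J = J * T) : ℂ :=
  letI := complexModule J hJ
  LinearMap.det (M := V) (A := ℂ)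
    { toFun := T
      map_add' := T.map_add
      map_smul' := by
        intro z v
        have h : ∀ w, T (J w) = J (T w) := fun w => LinearMap.congr_fun hT w
        change T ((Complex.lift ⟨J, hJ⟩ : ℂ →ₐ[ℝ] Module.End ℝ V) z v) =
          (Complex.lift ⟨J, hJ⟩ : ℂ →ₐ[ℝ] Module.End ℝ V) z (T v)
        simp [Complex.liftAux_apply, h] }

/-- The group `Γ` of linear maps is contained in the special unitary group `SU(V)` of the real
vector space `V` with the scalar product `b` and the complex structure `J`, where `J` is
compatible with `b`. -/
def IsContainedInSU {V : Type*} [AddCommGroup V] [Module ℝ V] (b : V → V → ℝ)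
    (J : Module.End ℝ V) (Γ : Set (Module.End ℝ V)) : Prop :=
  (∀ v w, b (J v) (J w) = b v w) ∧
  ∃ hJ : J * J = -1, ∀ T ∈ Γ, (∀ v w, b (T v) (T w) = b v w) ∧
    ∃ hT : T * J = J * T, complexDet J hJ T hT = 1

/-- There is a complex structure on the tangent space at the point `y` of the local smooth
covering of the `i`-th chart for which the isotropy group of `y` is contained in `SU(2)`. -/
def IsotropyInSU {M : Type u} [TopologicalSpace M] {O : OrientedOrbifold 4 M}
    (g : OrbifoldMetric O) (i : O.ι) (y : EucSpace 4) : Prop :=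
  ∃ J : Module.End ℝ (EucSpace 4), IsContainedInSU (fun v w => g.metric i y v w) J
    {T | ∃ γ ∈ (O.chart i).isotropy y, T = (γ.toLinearEquiv : EucSpace 4 →ₗ[ℝ] EucSpace 4)}

/-! An element `a` of Spin(4) acts on spinors by two blocks `a.fst` and `a.snd`, both unit
quaternions written as complex 2 × 2 matrices, and the rotation under `a` is `v ↦ a.snd * v *
a.fst*` on quaternions (`Spin4.quatMatrix_rotation`). The decisive fact is
`IsQuaternionic.eq_one_of_fixed`: a quaternion with a non-zero fixed vector is 1, since `m - 1` is
again a quaternion and its determinant is its squared norm. So a spin element which fixes a spinor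
with a non-zero component in one half-spin space has trivial block there.

Let `p` lie in the spin bundle over a frame at `x`. As -1 acts freely on the two-point fibres, every
element of the isotropy group has a lift to Spin(4) which fixes `p`
(`SpinStructure.exists_stabilizer_lift`), and the value at `p` of any spinor field is fixed by the
stabilizer (`SpinorField.toFun_fixed`). If a positive and a negative field were both non-zero at
`p`, both blocks of every stabilizing element would be 1 and the isotropy group would be trivial.
This is (1).

If one value is non-zero, all lifts have the same block trivial, so the isotropy group acts by left
(or right) multiplication by unit quaternions, which is special unitary for the complex structure
given by right (or left) multiplication by `i`. Conversely, an orthogonal complex structure is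
conjugate under SO(4) to one of these two multiplications. Commuting with it makes one block
diagonal, with entries `z` and its conjugate, and complex determinant 1 forces `z ^ 2 = 1`, so one
of the two lifts has that block equal to 1. This equivalence, `isotropyInSU_iff`, gives (2).

For (3), the spin elements over the isotropy group which fix a chosen spinor form a group lifting
it; dividing slice × Spin(4) by this group gives `σ₀` (`IsotropyLift.spinStructure`). Conversely,
every spin bundle over a slice is such a quotient by the stabilizer of a point
(`SpinStructure.exists_uniformization`), so equal stabilizers give isomorphic structures. Two lifts
which both fix a spinor agree if the trivial block is the same; otherwise both blocks of every
element are ±1, so that the isotropy group is contained in {±1} (`Spin4.lift_subset`).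

All this rests on a description of the frame bundle over a chart. The inverse square root of the
metric is a frame equivariant under the chart group, and it parametrizes the frame bundle by an open
continuous map from `dom` × Spin(4) (`OrbifoldMetric.spinFrame`), with fibres the orbits of the
chart group up to sign (`OrbifoldMetric.spinFrame_eq_iff`). -/

/-! ### Monomials in the Clifford algebra and injectivity of the spin representation -/

theorem cliffordForm_apply (v : EucSpace 4) : cliffordForm v = -(inner ℝ v v) := by
  simp [cliffordForm, innerₗ_apply_apply]

theorem clifford_ι_sq (v : EucSpace 4) :
    CliffordAlgebra.ι cliffordForm v * CliffordAlgebra.ι cliffordForm v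
      = algebraMap ℝ Cl4 (-(inner ℝ v v)) := by
  rw [CliffordAlgebra.ι_sq_scalar, cliffordForm_apply]

theorem clifford_ι_swap (v w : EucSpace 4) :
    CliffordAlgebra.ι cliffordForm v * CliffordAlgebra.ι cliffordForm w
      = -(CliffordAlgebra.ι cliffordForm w * CliffordAlgebra.ι cliffordForm v)
        + algebraMap ℝ Cl4 (-2 * inner ℝ v w) := by
  have h := CliffordAlgebra.ι_mul_ι_add_swap (Q := cliffordForm) v w
  have h2 : QuadraticMap.polar cliffordForm v w = -2 * inner ℝ v w := by
    simp only [QuadraticMap.polar, cliffordForm_apply, inner_add_left, inner_add_right,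
      real_inner_comm v w]
    ring
  rw [h2] at h
  rw [← h]
  abel

theorem cliffordBasis_sq (k : Fin 4) : cliffordBasis k * cliffordBasis k = -1 := by
  rw [cliffordBasis, clifford_ι_sq]
  simp

theorem cliffordBasis_swap {j k : Fin 4} (h : j ≠ k) :
    cliffordBasis j * cliffordBasis k = -(cliffordBasis k * cliffordBasis j) := by
  rw [cliffordBasis, cliffordBasis, clifford_ι_swap, EuclideanSpace.inner_single_left]
  simp [h]

theorem clifford_ι_eq_sum (v : EucSpace 4) :
    CliffordAlgebra.ι cliffordForm v = ∑ k, v k • cliffordBasis k := by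
  have h : v = ∑ k, v k • EuclideanSpace.single k (1 : ℝ) := by
    ext j
    simp [Pi.single_apply]
  conv_lhs => rw [h]
  simp [cliffordBasis]

/-- The span of the products of an even number of distinct standard basis vectors. -/
noncomputable def evenMonomialSpan : Submodule ℝ Cl4 :=
  Submodule.span ℝ {1, cliffordBasis 0 * cliffordBasis 1, cliffordBasis 0 * cliffordBasis 2,
    cliffordBasis 0 * cliffordBasis 3, cliffordBasis 1 * cliffordBasis 2,
    cliffordBasis 1 * cliffordBasis 3, cliffordBasis 2 * cliffordBasis 3,
    cliffordBasis 0 * cliffordBasis 1 * cliffordBasis 2 * cliffordBasis 3}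

/-- The span of the products of an odd number of distinct standard basis vectors. -/
noncomputable def oddMonomialSpan : Submodule ℝ Cl4 :=
  Submodule.span ℝ {cliffordBasis 0, cliffordBasis 1, cliffordBasis 2, cliffordBasis 3,
    cliffordBasis 0 * cliffordBasis 1 * cliffordBasis 2,
    cliffordBasis 0 * cliffordBasis 1 * cliffordBasis 3,
    cliffordBasis 0 * cliffordBasis 2 * cliffordBasis 3,
    cliffordBasis 1 * cliffordBasis 2 * cliffordBasis 3}

theorem cliffordBasis_sq_mul (k : Fin 4) (x : Cl4) :
    cliffordBasis k * (cliffordBasis k * x) = -x := by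
  rw [← mul_assoc, cliffordBasis_sq, neg_one_mul]

theorem cliffordBasis_swap_mul {j k : Fin 4} (h : j ≠ k) (x : Cl4) :
    cliffordBasis j * (cliffordBasis k * x) = -(cliffordBasis k * (cliffordBasis j * x)) := by
  rw [← mul_assoc, cliffordBasis_swap h, neg_mul, mul_assoc]

/-- Anticommuting the new factor to its sorted place, and cancelling it against an equal factor if
there is one, turns each monomial into plus or minus another one. -/
theorem cliffordBasis_mul_even (k : Fin 4) {x : Cl4} (hx : x ∈ evenMonomialSpan) :
    cliffordBasis k * x ∈ oddMonomialSpan := by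
  have h21 := cliffordBasis_swap (j := 2) (k := 1) (by decide)
  have h31 := cliffordBasis_swap (j := 3) (k := 1) (by decide)
  have h32 := cliffordBasis_swap (j := 3) (k := 2) (by decide)
  have k10 := cliffordBasis_swap_mul (j := 1) (k := 0) (by decide)
  have k20 := cliffordBasis_swap_mul (j := 2) (k := 0) (by decide)
  have k30 := cliffordBasis_swap_mul (j := 3) (k := 0) (by decide)
  have k21 := cliffordBasis_swap_mul (j := 2) (k := 1) (by decide)
  have k31 := cliffordBasis_swap_mul (j := 3) (k := 1) (by decide)
  have k32 := cliffordBasis_swap_mul (j := 3) (k := 2) (by decide)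
  induction hx using Submodule.span_induction with
  | zero => simp
  | add x y _ _ hx hy => rw [mul_add]; exact add_mem hx hy
  | smul r x _ hx => rw [mul_smul_comm]; exact Submodule.smul_mem _ _ hx
  | mem x hx =>
    simp only [Set.mem_insert_iff, Set.mem_singleton_iff] at hx
    rcases hx with rfl | rfl | rfl | rfl | rfl | rfl | rfl | rfl <;> fin_cases k <;>
    · simp only [Fin.zero_eta, Fin.mk_one, Fin.reduceFinMk, mul_assoc, mul_one, mul_neg, neg_neg,
        cliffordBasis_sq, cliffordBasis_sq_mul, h21, h31, h32, k10, k20, k30, k21,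
        k31, k32, neg_mem_iff, oddMonomialSpan]
      apply Submodule.subset_span
      simp

theorem cliffordBasis_mul_odd (k : Fin 4) {x : Cl4} (hx : x ∈ oddMonomialSpan) :
    cliffordBasis k * x ∈ evenMonomialSpan := by
  have h10 := cliffordBasis_swap (j := 1) (k := 0) (by decide)
  have h20 := cliffordBasis_swap (j := 2) (k := 0) (by decide)
  have h30 := cliffordBasis_swap (j := 3) (k := 0) (by decide)
  have h21 := cliffordBasis_swap (j := 2) (k := 1) (by decide)
  have h31 := cliffordBasis_swap (j := 3) (k := 1) (by decide)
  have h32 := cliffordBasis_swap (j := 3) (k := 2) (by decide)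
  have k10 := cliffordBasis_swap_mul (j := 1) (k := 0) (by decide)
  have k20 := cliffordBasis_swap_mul (j := 2) (k := 0) (by decide)
  have k30 := cliffordBasis_swap_mul (j := 3) (k := 0) (by decide)
  have k21 := cliffordBasis_swap_mul (j := 2) (k := 1) (by decide)
  have k31 := cliffordBasis_swap_mul (j := 3) (k := 1) (by decide)
  have k32 := cliffordBasis_swap_mul (j := 3) (k := 2) (by decide)
  induction hx using Submodule.span_induction with
  | zero => simp
  | add x y _ _ hx hy => rw [mul_add]; exact add_mem hx hy
  | smul r x _ hx => rw [mul_smul_comm]; exact Submodule.smul_mem _ _ hx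
  | mem x hx =>
    simp only [Set.mem_insert_iff, Set.mem_singleton_iff] at hx
    rcases hx with rfl | rfl | rfl | rfl | rfl | rfl | rfl | rfl <;> fin_cases k <;>
    · simp only [Fin.zero_eta, Fin.mk_one, Fin.reduceFinMk, mul_assoc, mul_one, mul_neg, neg_neg,
        cliffordBasis_sq, cliffordBasis_sq_mul, h10, h20, h30, h21, h31, h32, k10, k20, k30, k21,
        k31, k32, neg_mem_iff, evenMonomialSpan]
      apply Submodule.subset_span
      simp

/-- Only this upper bound on the even part is needed: linear independence of the monomials follows
from that of their images under `cliffordRep`. -/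
theorem mem_evenMonomialSpan {x : Cl4} (hx : x ∈ CliffordAlgebra.evenOdd cliffordForm 0) :
    x ∈ evenMonomialSpan := by
  induction x, hx using CliffordAlgebra.even_induction with
  | algebraMap r =>
    rw [Algebra.algebraMap_eq_smul_one]
    exact Submodule.smul_mem _ _ (Submodule.subset_span (by simp))
  | add x y _ _ hx hy => exact add_mem hx hy
  | ι_mul_ι_mul v w x _ hx =>
    rw [mul_assoc, clifford_ι_eq_sum w, clifford_ι_eq_sum v, Finset.sum_mul, Finset.sum_mul]
    refine Submodule.sum_mem _ fun j _ => ?_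
    rw [smul_mul_assoc]
    refine Submodule.smul_mem _ _ (cliffordBasis_mul_odd j (Submodule.sum_mem _ fun k _ => ?_))
    rw [smul_mul_assoc]
    exact Submodule.smul_mem _ _ (cliffordBasis_mul_even k hx)

theorem cliffordRep_ι (v : EucSpace 4) :
    cliffordRep (CliffordAlgebra.ι cliffordForm v) =
      Matrix.fromBlocks 0 (-(quatMatrix v).conjTranspose) (quatMatrix v) 0 := by
  rw [cliffordRep, CliffordAlgebra.lift_ι_apply]
  rfl

theorem cliffordRep_basis_zero : cliffordRep (cliffordBasis 0) = Matrix.fromBlocks 0 (-1) 1 0 := by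
  rw [cliffordBasis, cliffordRep_ι]
  ext (i | i) (j | j) <;> fin_cases i <;> fin_cases j <;> simp [quatMatrix]

theorem cliffordRep_basis_one : cliffordRep (cliffordBasis 1) =
      Matrix.fromBlocks 0 !![Complex.I, 0; 0, -Complex.I] !![Complex.I, 0; 0, -Complex.I] 0 := by
  rw [cliffordBasis, cliffordRep_ι]
  ext (i | i) (j | j) <;> fin_cases i <;> fin_cases j <;> simp [quatMatrix]

theorem cliffordRep_basis_two : cliffordRep (cliffordBasis 2) =
      Matrix.fromBlocks 0 !![0, 1; -1, 0] !![0, 1; -1, 0] 0 := by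
  rw [cliffordBasis, cliffordRep_ι]
  ext (i | i) (j | j) <;> fin_cases i <;> fin_cases j <;> simp [quatMatrix]

theorem cliffordRep_basis_three : cliffordRep (cliffordBasis 3) =
      Matrix.fromBlocks 0 !![0, Complex.I; Complex.I, 0] !![0, Complex.I; Complex.I, 0] 0 := by
  rw [cliffordBasis, cliffordRep_ι]
  ext (i | i) (j | j) <;> fin_cases i <;> fin_cases j <;> simp [quatMatrix]

/-- Faithfulness on the even part: it lets spin elements be compared, and their topology be
described, through matrices. -/
theorem cliffordRep_injOn_even {x : Cl4} (hx : x ∈ CliffordAlgebra.evenOdd cliffordForm 0)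
    (h0 : cliffordRep x = 0) : x = 0 := by
  have hx' := mem_evenMonomialSpan hx
  simp only [evenMonomialSpan, Submodule.mem_span_insert, Submodule.mem_span_singleton] at hx'
  obtain ⟨c0, _, ⟨c1, _, ⟨c2, _, ⟨c3, _, ⟨c4, _, ⟨c5, _, ⟨c6, _, ⟨c7, rfl⟩, rfl⟩, rfl⟩, rfl⟩, rfl⟩,
    rfl⟩, rfl⟩, rfl⟩ := hx'
  have h := fun i j => congrArg (fun m : Matrix (Fin 2 ⊕ Fin 2) (Fin 2 ⊕ Fin 2) ℂ => m i j) h0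
  have q0 := cliffordRep_basis_zero
  have q1 := cliffordRep_basis_one
  have q2 := cliffordRep_basis_two
  have q3 := cliffordRep_basis_three
  simp only [map_add, map_smul, map_mul, map_one, q0, q1, q2, q3,
    Matrix.fromBlocks_multiply, add_zero, zero_add, Matrix.mul_fin_two, mul_zero, mul_one,
    zero_mul, one_mul, mul_neg, neg_mul, Complex.I_mul_I, neg_neg, neg_zero] at h
  -- The blocks are quaternionic, hence determined by their first rows. These four complex entries
  -- give eight real equations for the eight coefficients.
  have e1 := h (.inl 0) (.inl 0)
  have e2 := h (.inr 0) (.inr 0)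
  have e3 := h (.inl 0) (.inl 1)
  have e4 := h (.inr 0) (.inr 1)
  simp [Complex.ext_iff] at e1 e2 e3 e4
  obtain ⟨a1, a2⟩ := e1
  obtain ⟨a3, a4⟩ := e2
  obtain ⟨a5, a6⟩ := e3
  obtain ⟨a7, a8⟩ := e4
  have z0 : c0 = 0 := by linarith
  have z1 : c1 = 0 := by linarith
  have z2 : c2 = 0 := by linarith
  have z3 : c3 = 0 := by linarith
  have z4 : c4 = 0 := by linarith
  have z5 : c5 = 0 := by linarith
  have z6 : c6 = 0 := by linarith
  have z7 : c7 = 0 := by linarith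
  simp [z0, z1, z2, z3, z4, z5, z6, z7]

/-! ### Quaternionic matrices -/

theorem quatMatrix_eq_of_re_im (v : EucSpace 4) (m : Matrix (Fin 2) (Fin 2) ℂ)
    (h00 : m 0 0 = v 0 + v 1 * Complex.I) (h01 : m 0 1 = v 2 + v 3 * Complex.I)
    (h10 : m 1 0 = -v 2 + v 3 * Complex.I) (h11 : m 1 1 = v 0 - v 1 * Complex.I) :
    quatMatrix v = m := by
  ext i j
  fin_cases i <;> fin_cases j <;> simp [quatMatrix, *]

/-- A complex `2 × 2` matrix which represents a quaternion. -/
def IsQuaternionic (m : Matrix (Fin 2) (Fin 2) ℂ) : Prop :=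
  m 1 1 = star (m 0 0) ∧ m 1 0 = -star (m 0 1)

theorem isQuaternionic_quatMatrix (v : EucSpace 4) : IsQuaternionic (quatMatrix v) := by
  constructor <;> simp [quatMatrix, sub_eq_add_neg, add_comm]

namespace IsQuaternionic

variable {m k : Matrix (Fin 2) (Fin 2) ℂ}

theorem mul (hm : IsQuaternionic m) (hk : IsQuaternionic k) : IsQuaternionic (m * k) := by
  obtain ⟨h1, h2⟩ := hm
  obtain ⟨h3, h4⟩ := hk
  constructor
  · simp [Matrix.mul_apply, Fin.sum_univ_two, h1, h2, h3, h4]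
    ring
  · simp [Matrix.mul_apply, Fin.sum_univ_two, h1, h2, h3, h4]

theorem add (hm : IsQuaternionic m) (hk : IsQuaternionic k) : IsQuaternionic (m + k) := by
  obtain ⟨h1, h2⟩ := hm
  obtain ⟨h3, h4⟩ := hk
  constructor
  · simp [h1, h3]
  · simp [h2, h4]
    ring

theorem neg (hm : IsQuaternionic m) : IsQuaternionic (-m) := by
  obtain ⟨h1, h2⟩ := hm
  constructor <;> simp [h1, h2]

theorem conjTranspose (hm : IsQuaternionic m) : IsQuaternionic m.conjTranspose := by
  obtain ⟨h1, h2⟩ := hm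
  constructor <;> simp [h1, h2]

theorem smul_one (r : ℝ) : IsQuaternionic ((r : ℂ) • (1 : Matrix (Fin 2) (Fin 2) ℂ)) := by
  constructor <;> simp

/-- The determinant of a quaternion is its squared norm; in particular it is real, non-negative, and
zero only for the zero quaternion. -/
theorem det_eq (hm : IsQuaternionic m) :
    m.det = ((Complex.normSq (m 0 0) + Complex.normSq (m 0 1) : ℝ) : ℂ) := by
  obtain ⟨h1, h2⟩ := hm
  rw [Matrix.det_fin_two, h1, h2]
  push_cast
  rw [Complex.normSq_eq_conj_mul_self, Complex.normSq_eq_conj_mul_self]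
  simp only [Complex.star_def]
  ring

theorem det_eq_one_of_unitary (hm : IsQuaternionic m) (h : m.conjTranspose * m = 1) :
    m.det = 1 := by
  have h1 := congrArg Matrix.det h
  rw [Matrix.det_mul, Matrix.det_conjTranspose, Matrix.det_one, hm.det_eq, Complex.star_def,
    Complex.conj_ofReal, ← Complex.ofReal_mul] at h1
  norm_cast at h1
  have h2 : 0 ≤ Complex.normSq (m 0 0) + Complex.normSq (m 0 1) :=
    add_nonneg (Complex.normSq_nonneg _) (Complex.normSq_nonneg _)
  rw [hm.det_eq]
  norm_cast
  nlinarith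

end IsQuaternionic

/-! ### The two half-spin representations -/

/-- The action of a spin element on the first half-spin space. -/
noncomputable def Spin4.fst (a : Spin4) : Matrix (Fin 2) (Fin 2) ℂ :=
  (cliffordRep (a : Cl4)).toBlocks₁₁

/-- The action of a spin element on the second half-spin space. -/
noncomputable def Spin4.snd (a : Spin4) : Matrix (Fin 2) (Fin 2) ℂ :=
  (cliffordRep (a : Cl4)).toBlocks₂₂

/-- A vector swaps the two half-spin spaces, so a product of two vectors preserves them and acts on
each by a product of quaternions. -/
theorem cliffordRep_even {x : Cl4} (hx : x ∈ CliffordAlgebra.evenOdd cliffordForm 0) :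
    ∃ p n, IsQuaternionic p ∧ IsQuaternionic n ∧
      cliffordRep x = Matrix.fromBlocks p 0 0 n := by
  induction x, hx using CliffordAlgebra.even_induction with
  | algebraMap r =>
    refine ⟨(r : ℂ) • 1, (r : ℂ) • 1, .smul_one r, .smul_one r, ?_⟩
    rw [AlgHom.commutes]
    ext (i | i) (j | j) <;>
      simp [Matrix.algebraMap_matrix_apply, Matrix.one_apply]
  | add x y _ _ hx hy =>
    obtain ⟨p, n, hp, hn, h⟩ := hx
    obtain ⟨p', n', hp', hn', h'⟩ := hy
    exact ⟨p + p', n + n', hp.add hp', hn.add hn', by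
      rw [map_add, h, h', Matrix.fromBlocks_add]; simp⟩
  | ι_mul_ι_mul v w x _ hx =>
    obtain ⟨p, n, hp, hn, h⟩ := hx
    refine ⟨-(quatMatrix v).conjTranspose * quatMatrix w * p,
      quatMatrix v * -(quatMatrix w).conjTranspose * n,
      ((isQuaternionic_quatMatrix v).conjTranspose.neg.mul (isQuaternionic_quatMatrix w)).mul hp,
      ((isQuaternionic_quatMatrix v).mul (isQuaternionic_quatMatrix w).conjTranspose.neg).mul hn, ?_⟩
    rw [map_mul, map_mul, cliffordRep_ι, cliffordRep_ι, h]
    simp [Matrix.fromBlocks_multiply]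

theorem Spin4.mem_even (a : Spin4) : (a : Cl4) ∈ CliffordAlgebra.evenOdd cliffordForm 0 :=
  spinGroup.mem_even a.2

theorem Spin4.cliffordRep_eq (a : Spin4) :
    cliffordRep (a : Cl4) = Matrix.fromBlocks a.fst 0 0 a.snd := by
  obtain ⟨p, n, -, -, h⟩ := cliffordRep_even a.mem_even
  rw [Spin4.fst, Spin4.snd, h]
  simp

theorem Spin4.isQuaternionic_fst (a : Spin4) : IsQuaternionic a.fst := by
  obtain ⟨p, n, hp, -, h⟩ := cliffordRep_even a.mem_even
  rwa [Spin4.fst, h]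

theorem Spin4.isQuaternionic_snd (a : Spin4) : IsQuaternionic a.snd := by
  obtain ⟨p, n, -, hn, h⟩ := cliffordRep_even a.mem_even
  rwa [Spin4.snd, h]

theorem Spin4.fst_mul (a b : Spin4) : (a * b).fst = a.fst * b.fst := by
  have h : cliffordRep ((a * b : Spin4) : Cl4) = cliffordRep (a : Cl4) * cliffordRep (b : Cl4) :=
    map_mul _ _ _
  rw [Spin4.fst, h, a.cliffordRep_eq, b.cliffordRep_eq]
  simp [Matrix.fromBlocks_multiply]

theorem Spin4.snd_mul (a b : Spin4) : (a * b).snd = a.snd * b.snd := by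
  have h : cliffordRep ((a * b : Spin4) : Cl4) = cliffordRep (a : Cl4) * cliffordRep (b : Cl4) :=
    map_mul _ _ _
  rw [Spin4.snd, h, a.cliffordRep_eq, b.cliffordRep_eq]
  simp [Matrix.fromBlocks_multiply]

theorem Spin4.cliffordRep_one : cliffordRep ((1 : Spin4) : Cl4) = 1 := map_one _

theorem Spin4.fst_one : (1 : Spin4).fst = 1 := by
  rw [Spin4.fst, Spin4.cliffordRep_one, ← Matrix.fromBlocks_one]
  rfl

theorem Spin4.snd_one : (1 : Spin4).snd = 1 := by
  rw [Spin4.snd, Spin4.cliffordRep_one, ← Matrix.fromBlocks_one]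
  rfl

/-- Vectors act by skew-Hermitian matrices, and `star` negates vectors. Consequently inverses in
Spin(4) become conjugate transposes. -/
theorem cliffordRep_star (x : Cl4) : cliffordRep (star x) = (cliffordRep x).conjTranspose := by
  induction x using CliffordAlgebra.induction with
  | algebraMap r =>
    rw [CliffordAlgebra.star_algebraMap, AlgHom.commutes]
    ext i j
    by_cases h : i = j
    · simp [Matrix.algebraMap_matrix_apply, h]
    · simp [Matrix.algebraMap_matrix_apply, h, Ne.symm h]
  | ι v =>
    rw [CliffordAlgebra.star_ι, map_neg, cliffordRep_ι, Matrix.fromBlocks_conjTranspose,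
      Matrix.fromBlocks_neg]
    simp
  | mul x y hx hy => rw [star_mul, map_mul, map_mul, hx, hy, Matrix.conjTranspose_mul]
  | add x y hx hy => rw [star_add, map_add, map_add, hx, hy, Matrix.conjTranspose_add]

theorem Spin4.cliffordRep_inv (a : Spin4) :
    cliffordRep ((a⁻¹ : Spin4) : Cl4) = (cliffordRep (a : Cl4)).conjTranspose :=
  cliffordRep_star _

theorem Spin4.fst_inv (a : Spin4) : (a⁻¹).fst = a.fst.conjTranspose := by
  rw [Spin4.fst, a.cliffordRep_inv, a.cliffordRep_eq, Matrix.fromBlocks_conjTranspose]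
  simp

theorem Spin4.snd_inv (a : Spin4) : (a⁻¹).snd = a.snd.conjTranspose := by
  rw [Spin4.snd, a.cliffordRep_inv, a.cliffordRep_eq, Matrix.fromBlocks_conjTranspose]
  simp

theorem Spin4.star_fst_mul (a : Spin4) : a.fst.conjTranspose * a.fst = 1 := by
  rw [← a.fst_inv, ← Spin4.fst_mul, inv_mul_cancel, Spin4.fst_one]

theorem Spin4.star_snd_mul (a : Spin4) : a.snd.conjTranspose * a.snd = 1 := by
  rw [← a.snd_inv, ← Spin4.snd_mul, inv_mul_cancel, Spin4.snd_one]

theorem Spin4.det_fst (a : Spin4) : a.fst.det = 1 :=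
  a.isQuaternionic_fst.det_eq_one_of_unitary a.star_fst_mul

theorem Spin4.det_snd (a : Spin4) : a.snd.det = 1 :=
  a.isQuaternionic_snd.det_eq_one_of_unitary a.star_snd_mul

theorem Spin4.ext_cliffordRep {a b : Spin4}
    (h : cliffordRep (a : Cl4) = cliffordRep (b : Cl4)) : a = b := by
  refine Subtype.ext (sub_eq_zero.1 (cliffordRep_injOn_even ?_ ?_))
  · exact Submodule.sub_mem _ a.mem_even b.mem_even
  · rw [map_sub, h, sub_self]

theorem Spin4.ext_fst_snd {a b : Spin4} (hp : a.fst = b.fst) (hn : a.snd = b.snd) : a = b :=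
  Spin4.ext_cliffordRep (by rw [a.cliffordRep_eq, b.cliffordRep_eq, hp, hn])

/-- The element `-1` of `Spin(4)`. -/
noncomputable def Spin4.minusOne : Spin4 :=
  ⟨-1, by
    -- Since -1 is the square of a basis vector, it lies in the Lipschitz group.
    let u : Cl4ˣ := ⟨cliffordBasis 0, -cliffordBasis 0, by
      rw [mul_neg, cliffordBasis_sq, neg_neg], by rw [neg_mul, cliffordBasis_sq, neg_neg]⟩
    refine ⟨⟨⟨u * u, ?_, ?_⟩, ?_⟩, ?_⟩
    · have hu : u ∈ lipschitzGroup cliffordForm := Subgroup.subset_closure ⟨_, rfl⟩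
      exact mul_mem hu hu
    · exact cliffordBasis_sq 0
    · change (-1 : Cl4) ∈ unitary Cl4
      rw [Unitary.mem_iff]
      simp
    · change (-1 : Cl4) ∈ CliffordAlgebra.even cliffordForm
      exact neg_mem (one_mem (CliffordAlgebra.even cliffordForm))⟩

theorem Spin4.coe_minusOne : (Spin4.minusOne : Cl4) = -1 := rfl

theorem Spin4.fst_minusOne : Spin4.minusOne.fst = -1 := by
  rw [Spin4.fst, Spin4.coe_minusOne, map_neg, map_one, ← Matrix.fromBlocks_one,
    Matrix.fromBlocks_neg]
  rfl

theorem Spin4.snd_minusOne : Spin4.minusOne.snd = -1 := by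
  rw [Spin4.snd, Spin4.coe_minusOne, map_neg, map_one, ← Matrix.fromBlocks_one,
    Matrix.fromBlocks_neg]
  rfl

theorem Spin4.minusOne_mul_self : Spin4.minusOne * Spin4.minusOne = 1 :=
  Subtype.ext (by change (-1 : Cl4) * (-1) = 1; simp)

theorem Spin4.minusOne_mul_comm (a : Spin4) : Spin4.minusOne * a = a * Spin4.minusOne :=
  Subtype.ext (by change (-1 : Cl4) * a = a * (-1); simp)

/-! ### The action on spinors -/

/-- The first half-spin component of a spinor. -/
def Spinor.fstPart (v : Spinor) : Fin 2 → ℂ := v ∘ Sum.inl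

/-- The second half-spin component of a spinor. -/
def Spinor.sndPart (v : Spinor) : Fin 2 → ℂ := v ∘ Sum.inr

theorem Spinor.ext_iff_parts {v w : Spinor} :
    v = w ↔ Spinor.fstPart v = Spinor.fstPart w ∧ Spinor.sndPart v = Spinor.sndPart w := by
  constructor
  · rintro rfl; exact ⟨rfl, rfl⟩
  · rintro ⟨h1, h2⟩
    ext (i | i)
    · exact congrFun h1 i
    · exact congrFun h2 i

theorem Spin4.fstPart_act (a : Spin4) (v : Spinor) :
    Spinor.fstPart (cliffordAct (a : Cl4) v) = a.fst.mulVec (Spinor.fstPart v) := by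
  rw [cliffordAct, a.cliffordRep_eq, Matrix.fromBlocks_mulVec]
  ext i
  simp [Spinor.fstPart]

theorem Spin4.sndPart_act (a : Spin4) (v : Spinor) :
    Spinor.sndPart (cliffordAct (a : Cl4) v) = a.snd.mulVec (Spinor.sndPart v) := by
  rw [cliffordAct, a.cliffordRep_eq, Matrix.fromBlocks_mulVec]
  ext i
  simp [Spinor.sndPart]

theorem Spin4.act_eq_self_iff (a : Spin4) (v : Spinor) :
    cliffordAct (a : Cl4) v = v ↔ a.fst.mulVec (Spinor.fstPart v) = Spinor.fstPart v ∧
      a.snd.mulVec (Spinor.sndPart v) = Spinor.sndPart v := by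
  rw [Spinor.ext_iff_parts, a.fstPart_act, a.sndPart_act]

/-- A fixed vector makes `m - 1` singular; being a quaternion, whose determinant is its squared
norm, `m - 1` is then zero. -/
theorem IsQuaternionic.eq_one_of_fixed {m : Matrix (Fin 2) (Fin 2) ℂ} (hm : IsQuaternionic m)
    {v : Fin 2 → ℂ} (hv : v ≠ 0) (h : m.mulVec v = v) : m = 1 := by
  have hd : (m - 1).det = 0 := by
    by_contra hne
    refine hv (Matrix.eq_zero_of_mulVec_eq_zero hne ?_)
    rw [Matrix.sub_mulVec, h, Matrix.one_mulVec, sub_self]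
  have hq : IsQuaternionic (m - 1) := by
    have := hm.add (IsQuaternionic.smul_one (-1))
    simpa [sub_eq_add_neg] using this
  rw [hq.det_eq] at hd
  norm_cast at hd
  have h0 : (m - 1) 0 0 = 0 := Complex.normSq_eq_zero.1 (by
    linarith [Complex.normSq_nonneg ((m - 1) 0 0), Complex.normSq_nonneg ((m - 1) 0 1)])
  have h1 : (m - 1) 0 1 = 0 := Complex.normSq_eq_zero.1 (by
    linarith [Complex.normSq_nonneg ((m - 1) 0 0), Complex.normSq_nonneg ((m - 1) 0 1)])
  rw [← sub_eq_zero]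
  ext i j
  fin_cases i <;> fin_cases j
  · exact h0
  · exact h1
  · simpa [h1] using hq.2
  · simpa [h0] using hq.1

theorem Spin4.fst_eq_one_of_fixed {a : Spin4} {v : Spinor} (hv : Spinor.fstPart v ≠ 0)
    (h : cliffordAct (a : Cl4) v = v) : a.fst = 1 :=
  a.isQuaternionic_fst.eq_one_of_fixed hv ((a.act_eq_self_iff v).1 h).1

theorem Spin4.snd_eq_one_of_fixed {a : Spin4} {v : Spinor} (hv : Spinor.sndPart v ≠ 0)
    (h : cliffordAct (a : Cl4) v = v) : a.snd = 1 :=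
  a.isQuaternionic_snd.eq_one_of_fixed hv ((a.act_eq_self_iff v).1 h).2

/-- This fixes the convention on chirality: positive Weyl spinors live in the second summand and
negative ones in the first. -/
theorem cliffordRep_volumeElement :
    cliffordRep volumeElement = Matrix.fromBlocks (-1) 0 0 1 := by
  have e0 := cliffordRep_basis_zero
  have e1 := cliffordRep_basis_one
  have e2 := cliffordRep_basis_two
  have e3 := cliffordRep_basis_three
  simp only [volumeElement, map_neg, map_mul, e0, e1, e2, e3, Matrix.fromBlocks_multiply]
  ext (i | i) (j | j) <;> fin_cases i <;> fin_cases j <;> simp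

theorem IsPositiveWeyl.fstPart_eq {v : Spinor} (h : IsPositiveWeyl v) :
    Spinor.fstPart v = 0 := by
  rw [IsPositiveWeyl, cliffordAct, cliffordRep_volumeElement, Matrix.fromBlocks_mulVec] at h
  ext i
  have := congrFun h (Sum.inl i)
  simp only [Sum.elim_inl, Matrix.zero_mulVec, Matrix.neg_mulVec, Matrix.one_mulVec, add_zero,
    Pi.neg_apply, Function.comp_apply] at this
  exact self_eq_neg.1 this.symm

theorem IsNegativeWeyl.sndPart_eq {v : Spinor} (h : IsNegativeWeyl v) :
    Spinor.sndPart v = 0 := by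
  rw [IsNegativeWeyl, cliffordAct, cliffordRep_volumeElement, Matrix.fromBlocks_mulVec] at h
  ext i
  have := congrFun h (Sum.inr i)
  simp only [Sum.elim_inr, Matrix.zero_mulVec, Matrix.one_mulVec, zero_add,
    Pi.neg_apply, Function.comp_apply] at this
  exact self_eq_neg.1 this

theorem quatMatrix_injective : Function.Injective quatMatrix := by
  intro v w h
  have h0 := congrFun (congrFun h 0) 0
  have h1 := congrFun (congrFun h 0) 1
  simp [quatMatrix, Complex.ext_iff] at h0 h1
  ext i
  fin_cases i
  · exact h0.1
  · exact h0.2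
  · exact h1.1
  · exact h1.2

theorem clifford_ι_injective : Function.Injective (CliffordAlgebra.ι cliffordForm) := by
  intro v w h
  have h1 := congrArg (fun x => (cliffordRep x).toBlocks₂₁) h
  simp only [cliffordRep_ι, Matrix.toBlocks_fromBlocks₂₁] at h1
  exact quatMatrix_injective h1

/-! ### The covering `Spin(4) → SO(4)` -/

theorem Spin4.mul_coe_inv (a : Spin4) : (a : Cl4) * ((a⁻¹ : Spin4) : Cl4) = 1 :=
  spinGroup.coe_mul_star_self a

theorem Spin4.coe_inv_mul (a : Spin4) : ((a⁻¹ : Spin4) : Cl4) * (a : Cl4) = 1 :=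
  spinGroup.coe_star_mul_self a

/-- Conjugation by a spin element preserves vectors, and it preserves the scalar square of a vector,
which is minus its squared norm. -/
theorem Spin4.exists_isometry (a : Spin4) : ∃ h : EucSpace 4 ≃ₗᵢ[ℝ] EucSpace 4, ∀ v,
    CliffordAlgebra.ι cliffordForm (h v) =
      (a : Cl4) * CliffordAlgebra.ι cliffordForm v * ((a⁻¹ : Spin4) : Cl4) := by
  have h1 : ∀ v, ∃ w, CliffordAlgebra.ι cliffordForm w =
      (a : Cl4) * CliffordAlgebra.ι cliffordForm v * ((a⁻¹ : Spin4) : Cl4) := fun v =>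
    spinGroup.conjAct_smul_ι_mem_range_ι (x := spinGroup.toUnits a) a.2 v
  choose f hf using h1
  let L : EucSpace 4 →ₗ[ℝ] EucSpace 4 :=
    { toFun := f
      map_add' := fun v w => clifford_ι_injective (by
        rw [map_add, hf, hf, hf, map_add, mul_add, add_mul])
      map_smul' := fun r v => clifford_ι_injective (by
        rw [map_smul, hf, hf, map_smul, RingHom.id_apply, mul_smul_comm, smul_mul_assoc]) }
  have hL : ∀ v, ‖L v‖ = ‖v‖ := by
    intro v
    have h2 : CliffordAlgebra.ι cliffordForm (f v) * CliffordAlgebra.ι cliffordForm (f v) =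
        algebraMap ℝ Cl4 (-(inner ℝ v v)) := by
      have : (a : Cl4) * CliffordAlgebra.ι cliffordForm v * ((a⁻¹ : Spin4) : Cl4) *
          ((a : Cl4) * CliffordAlgebra.ι cliffordForm v * ((a⁻¹ : Spin4) : Cl4)) =
          (a : Cl4) * (CliffordAlgebra.ι cliffordForm v * ((((a⁻¹ : Spin4) : Cl4) * (a : Cl4)) *
            CliffordAlgebra.ι cliffordForm v)) * ((a⁻¹ : Spin4) : Cl4) := by
        simp only [mul_assoc]
      rw [hf, this, a.coe_inv_mul, one_mul, clifford_ι_sq, ← Algebra.commutes, mul_assoc,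
        a.mul_coe_inv, mul_one]
    rw [clifford_ι_sq] at h2
    have h3 := neg_injective (FaithfulSMul.algebraMap_injective ℝ Cl4 h2)
    rw [real_inner_self_eq_norm_sq, real_inner_self_eq_norm_sq] at h3
    exact (sq_eq_sq₀ (norm_nonneg _) (norm_nonneg _)).1 h3
  exact ⟨LinearIsometry.toLinearIsometryEquiv ⟨L, hL⟩ rfl, hf⟩

/-- The lower left block of `h v * a = a * v`, where vectors are off-diagonal and spin elements
block diagonal. -/
theorem Spin4.quatMatrix_mul_fst {a : Spin4} {h : EucSpace 4 ≃ₗᵢ[ℝ] EucSpace 4}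
    (H : ∀ v, CliffordAlgebra.ι cliffordForm (h v) =
      (a : Cl4) * CliffordAlgebra.ι cliffordForm v * ((a⁻¹ : Spin4) : Cl4)) (v : EucSpace 4) :
    quatMatrix (h v) * a.fst = a.snd * quatMatrix v := by
  have h1 : CliffordAlgebra.ι cliffordForm (h v) * (a : Cl4) =
      (a : Cl4) * CliffordAlgebra.ι cliffordForm v := by
    rw [H, mul_assoc, a.coe_inv_mul, mul_one]
  have h2 := congrArg (fun x => (cliffordRep x).toBlocks₂₁) h1
  simpa [cliffordRep_ι, a.cliffordRep_eq, Matrix.fromBlocks_multiply] using h2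

theorem Spin4.fst_mul_star (a : Spin4) : a.fst * a.fst.conjTranspose = 1 :=
  mul_eq_one_comm.1 a.star_fst_mul

theorem Spin4.quatMatrix_eq {a : Spin4} {h : EucSpace 4 ≃ₗᵢ[ℝ] EucSpace 4}
    (H : ∀ v, CliffordAlgebra.ι cliffordForm (h v) =
      (a : Cl4) * CliffordAlgebra.ι cliffordForm v * ((a⁻¹ : Spin4) : Cl4)) (v : EucSpace 4) :
    quatMatrix (h v) = a.snd * (quatMatrix v * a.fst.conjTranspose) := by
  rw [← mul_assoc, ← Spin4.quatMatrix_mul_fst H, mul_assoc, a.fst_mul_star, mul_one]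

/-- The matrix of left multiplication by a quaternion. -/
def quatLeftMatrix (a b c d : ℝ) : Matrix (Fin 4) (Fin 4) ℝ :=
  !![a, -b, -c, -d; b, a, -d, c; c, d, a, -b; d, -c, b, a]

/-- The matrix of right multiplication by a quaternion. -/
def quatRightMatrix (a b c d : ℝ) : Matrix (Fin 4) (Fin 4) ℝ :=
  !![a, -b, -c, -d; b, a, d, -c; c, -d, a, b; d, c, -b, a]

theorem det_quatLeftMatrix (a b c d : ℝ) :
    (quatLeftMatrix a b c d).det = (a ^ 2 + b ^ 2 + c ^ 2 + d ^ 2) ^ 2 := by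
  simp [quatLeftMatrix, Matrix.det_succ_row_zero, Fin.sum_univ_succ, Fin.succAbove]
  ring

theorem det_quatRightMatrix (a b c d : ℝ) :
    (quatRightMatrix a b c d).det = (a ^ 2 + b ^ 2 + c ^ 2 + d ^ 2) ^ 2 := by
  simp [quatRightMatrix, Matrix.det_succ_row_zero, Fin.sum_univ_succ, Fin.succAbove]
  ring

/-- The vector of a quaternionic matrix. -/
def quatVector (m : Matrix (Fin 2) (Fin 2) ℂ) : EucSpace 4 :=
  !₂[(m 0 0).re, (m 0 0).im, (m 0 1).re, (m 0 1).im]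

theorem IsQuaternionic.quatMatrix_quatVector {m : Matrix (Fin 2) (Fin 2) ℂ}
    (hm : IsQuaternionic m) : quatMatrix (quatVector m) = m := by
  obtain ⟨h1, h2⟩ := hm
  apply quatMatrix_eq_of_re_im <;> simp [quatVector, h1, h2, Complex.ext_iff]

theorem quatVector_quatMatrix (v : EucSpace 4) : quatVector (quatMatrix v) = v :=
  quatMatrix_injective (isQuaternionic_quatMatrix v).quatMatrix_quatVector

theorem IsQuaternionic.mul_quatMatrix {m : Matrix (Fin 2) (Fin 2) ℂ} (hm : IsQuaternionic m)
    (v : EucSpace 4) : m * quatMatrix v =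
      quatMatrix (Matrix.toEuclideanLin
        (quatLeftMatrix (m 0 0).re (m 0 0).im (m 0 1).re (m 0 1).im) v) := by
  obtain ⟨h1, h2⟩ := hm
  symm
  apply quatMatrix_eq_of_re_im <;>
    simp [Matrix.mul_apply, Fin.sum_univ_two, quatMatrix, h1, h2, Complex.ext_iff,
      quatLeftMatrix, Matrix.mulVec, dotProduct, Fin.sum_univ_four] <;>
    constructor <;> ring

theorem IsQuaternionic.quatMatrix_mul {m : Matrix (Fin 2) (Fin 2) ℂ} (hm : IsQuaternionic m)
    (v : EucSpace 4) : quatMatrix v * m =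
      quatMatrix (Matrix.toEuclideanLin
        (quatRightMatrix (m 0 0).re (m 0 0).im (m 0 1).re (m 0 1).im) v) := by
  obtain ⟨h1, h2⟩ := hm
  symm
  apply quatMatrix_eq_of_re_im <;>
    simp [Matrix.mul_apply, Fin.sum_univ_two, quatMatrix, h1, h2, Complex.ext_iff,
      quatRightMatrix, Matrix.mulVec, dotProduct, Fin.sum_univ_four] <;>
    constructor <;> ring

theorem det_toEuclideanLin (m : Matrix (Fin 4) (Fin 4) ℝ) :
    LinearMap.det (Matrix.toEuclideanLin m) = m.det := by
  change LinearMap.det (Matrix.toLpLin 2 2 m) = m.det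
  rw [Matrix.toLpLin_eq_toLin, LinearMap.det_toLin]

theorem IsQuaternionic.sum_sq_eq_one {m : Matrix (Fin 2) (Fin 2) ℂ} (hm : IsQuaternionic m)
    (hd : m.det = 1) :
    (m 0 0).re ^ 2 + (m 0 0).im ^ 2 + (m 0 1).re ^ 2 + (m 0 1).im ^ 2 = 1 := by
  rw [hm.det_eq] at hd
  norm_cast at hd
  rw [← hd, Complex.normSq_apply, Complex.normSq_apply]
  ring

/-- The rotation is a left multiplication after a right multiplication by unit quaternions, and each
has as real determinant the fourth power of the norm. -/
theorem Spin4.det_eq_one {a : Spin4} {h : EucSpace 4 ≃ₗᵢ[ℝ] EucSpace 4}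
    (H : ∀ v, CliffordAlgebra.ι cliffordForm (h v) =
      (a : Cl4) * CliffordAlgebra.ι cliffordForm v * ((a⁻¹ : Spin4) : Cl4)) :
    h ∈ SpecialOrthogonal 4 := by
  change LinearMap.det (h.toLinearEquiv : EucSpace 4 →ₗ[ℝ] EucSpace 4) = 1
  have hp := a.isQuaternionic_fst.conjTranspose
  have hpd : a.fst.conjTranspose.det = 1 := by
    rw [← a.fst_inv]; exact Spin4.det_fst _
  have h1 : (h.toLinearEquiv : EucSpace 4 →ₗ[ℝ] EucSpace 4) =
      Matrix.toEuclideanLin (quatLeftMatrix (a.snd 0 0).re (a.snd 0 0).im (a.snd 0 1).re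
        (a.snd 0 1).im) ∘ₗ
      Matrix.toEuclideanLin (quatRightMatrix (a.fst.conjTranspose 0 0).re
        (a.fst.conjTranspose 0 0).im (a.fst.conjTranspose 0 1).re
        (a.fst.conjTranspose 0 1).im) := by
    refine LinearMap.ext fun v => quatMatrix_injective ?_
    change quatMatrix (h v) = _
    rw [LinearMap.comp_apply, ← a.isQuaternionic_snd.mul_quatMatrix, ← hp.quatMatrix_mul,
      Spin4.quatMatrix_eq H]
  rw [h1, LinearMap.det_comp, det_toEuclideanLin, det_toEuclideanLin, det_quatLeftMatrix,
    det_quatRightMatrix, hp.sum_sq_eq_one hpd, a.isQuaternionic_snd.sum_sq_eq_one a.det_snd]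
  norm_num

/-- The rotation under a spin element. -/
noncomputable def Spin4.rotation (a : Spin4) : SpecialOrthogonal 4 :=
  ⟨a.exists_isometry.choose, Spin4.det_eq_one a.exists_isometry.choose_spec⟩

theorem Spin4.spinCovers_rotation (a : Spin4) : SpinCovers a a.rotation :=
  a.exists_isometry.choose_spec

theorem SpinCovers.eq_rotation {a : Spin4} {h : SpecialOrthogonal 4} (H : SpinCovers a h) :
    h = a.rotation := by
  refine Subtype.ext (LinearIsometryEquiv.ext fun v => clifford_ι_injective ?_)
  rw [H, a.spinCovers_rotation]

theorem SpinCovers.mul {a b : Spin4} {h k : SpecialOrthogonal 4} (H : SpinCovers a h)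
    (K : SpinCovers b k) : SpinCovers (a * b) (h * k) := by
  intro v
  change CliffordAlgebra.ι cliffordForm (h.1 (k.1 v)) = ((a : Cl4) * (b : Cl4)) * _ * _
  rw [mul_inv_rev, H, K]
  change _ = _ * _ * (((b⁻¹ : Spin4) : Cl4) * ((a⁻¹ : Spin4) : Cl4))
  simp only [mul_assoc]

theorem Spin4.rotation_mul (a b : Spin4) : (a * b).rotation = a.rotation * b.rotation :=
  (a.spinCovers_rotation.mul b.spinCovers_rotation).eq_rotation.symm

theorem Spin4.rotation_one : (1 : Spin4).rotation = 1 := by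
  have h := Spin4.rotation_mul 1 1
  rw [mul_one] at h
  simpa using h

theorem Spin4.rotation_inv (a : Spin4) : (a⁻¹).rotation = a.rotation⁻¹ := by
  rw [eq_inv_iff_mul_eq_one, ← Spin4.rotation_mul, inv_mul_cancel, Spin4.rotation_one]

theorem Spin4.quatMatrix_rotation (a : Spin4) (v : EucSpace 4) :
    quatMatrix (a.rotation.1 v) = a.snd * (quatMatrix v * a.fst.conjTranspose) :=
  Spin4.quatMatrix_eq a.spinCovers_rotation v

theorem quatMatrix_e0 : quatMatrix (EuclideanSpace.single 0 1) = 1 := by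
  ext i j; fin_cases i <;> fin_cases j <;> simp [quatMatrix]

theorem quatMatrix_e1 :
    quatMatrix (EuclideanSpace.single 1 1) = !![Complex.I, 0; 0, -Complex.I] := by
  ext i j; fin_cases i <;> fin_cases j <;> simp [quatMatrix]

theorem quatMatrix_e2 : quatMatrix (EuclideanSpace.single 2 1) = !![0, 1; -1, 0] := by
  ext i j; fin_cases i <;> fin_cases j <;> simp [quatMatrix]

/-- Commuting with `i` kills the off-diagonal entry and commuting with `j` the imaginary part; what
is left is a real number of square 1. -/
theorem IsQuaternionic.eq_one_or_of_commute {m : Matrix (Fin 2) (Fin 2) ℂ}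
    (hm : IsQuaternionic m) (hd : m.det = 1)
    (h : ∀ v, quatMatrix v * m = m * quatMatrix v) : m = 1 ∨ m = -1 := by
  have h1 := h (EuclideanSpace.single 1 1)
  have h2 := h (EuclideanSpace.single 2 1)
  rw [quatMatrix_e1] at h1
  rw [quatMatrix_e2] at h2
  have a1 := congrFun (congrFun h1 0) 1
  have a2 := congrFun (congrFun h2 0) 1
  have hs := hm.sum_sq_eq_one hd
  obtain ⟨b1, b2⟩ := hm
  simp [Matrix.mul_apply, Fin.sum_univ_two, Complex.ext_iff] at a1 a2
  rw [b1] at a2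
  simp at a2
  have c1 : (m 0 1).re = 0 := by linarith
  have c2 : (m 0 1).im = 0 := by linarith
  have c3 : (m 0 0).im = 0 := by linarith
  have c4 : m 0 1 = 0 := Complex.ext c1 c2
  rw [c1, c2, c3] at hs
  have c5 : ((m 0 0).re - 1) * ((m 0 0).re + 1) = 0 := by linarith
  rcases mul_eq_zero.1 c5 with c | c
  · left
    have e : m 0 0 = 1 := Complex.ext (by simp; linarith) (by simpa using c3)
    ext i j
    fin_cases i <;> fin_cases j <;> simp [e, c4, b1, b2]
  · right
    have e : m 0 0 = -1 := Complex.ext (by simp; linarith) (by simpa using c3)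
    ext i j
    fin_cases i <;> fin_cases j <;> simp [e, c4, b1, b2]

/-- Evaluating at the quaternion 1 gives `fst = snd`, and then this common block commutes with all
quaternions. -/
theorem Spin4.eq_one_or_of_rotation_eq_one {a : Spin4} (h : a.rotation = 1) :
    a = 1 ∨ a = Spin4.minusOne := by
  have h1 : ∀ v, quatMatrix v * a.fst = a.snd * quatMatrix v := by
    intro v
    have := Spin4.quatMatrix_mul_fst a.spinCovers_rotation v
    rwa [h] at this
  have h2 : a.fst = a.snd := by
    have := h1 (EuclideanSpace.single 0 1)
    rwa [quatMatrix_e0, one_mul, mul_one] at this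
  rw [← h2] at h1
  rcases a.isQuaternionic_fst.eq_one_or_of_commute a.det_fst h1 with h3 | h3
  · left
    exact Spin4.ext_fst_snd (by rw [h3, Spin4.fst_one]) (by rw [← h2, h3, Spin4.snd_one])
  · right
    exact Spin4.ext_fst_snd (by rw [h3, Spin4.fst_minusOne]) (by rw [← h2, h3, Spin4.snd_minusOne])

theorem Spin4.rotation_minusOne : Spin4.minusOne.rotation = 1 := by
  refine (SpinCovers.eq_rotation (h := 1) fun v => ?_).symm
  have h : (Spin4.minusOne⁻¹ : Spin4) = Spin4.minusOne :=
    inv_eq_of_mul_eq_one_left Spin4.minusOne_mul_self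
  rw [h, Spin4.coe_minusOne]
  simp

theorem Spin4.eq_or_eq_of_rotation_eq {a b : Spin4} (h : a.rotation = b.rotation) :
    a = b ∨ a = Spin4.minusOne * b := by
  have h1 : (a * b⁻¹).rotation = 1 := by
    rw [Spin4.rotation_mul, Spin4.rotation_inv, h, mul_inv_cancel]
  rcases Spin4.eq_one_or_of_rotation_eq_one h1 with h2 | h2
  · exact Or.inl (mul_inv_eq_one.1 h2)
  · exact Or.inr (mul_inv_eq_iff_eq_mul.1 h2)

theorem ι_mem_pinGroup {u : EucSpace 4} (hu : ‖u‖ = 1) :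
    CliffordAlgebra.ι cliffordForm u ∈ pinGroup cliffordForm := by
  have h : CliffordAlgebra.ι cliffordForm u * CliffordAlgebra.ι cliffordForm u = -1 := by
    rw [clifford_ι_sq, real_inner_self_eq_norm_sq, hu]
    simp
  let x : Cl4ˣ := ⟨CliffordAlgebra.ι cliffordForm u, -CliffordAlgebra.ι cliffordForm u, by
    rw [mul_neg, h, neg_neg], by rw [neg_mul, h, neg_neg]⟩
  refine ⟨⟨x, Subgroup.subset_closure ⟨u, rfl⟩, rfl⟩, ?_⟩
  change _ ∈ unitary Cl4
  rw [Unitary.mem_iff, CliffordAlgebra.star_ι, mul_neg, neg_mul, h, neg_neg]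
  exact ⟨rfl, rfl⟩

/-- The reflection is `w ↦ -(u * w * u⁻¹)`, written without the inverse. -/
theorem ι_reflection_mul {u : EucSpace 4} (hu : ‖u‖ = 1) (w : EucSpace 4) :
    CliffordAlgebra.ι cliffordForm ((ℝ ∙ u)ᗮ.reflection w) * CliffordAlgebra.ι cliffordForm u =
      -(CliffordAlgebra.ι cliffordForm u * CliffordAlgebra.ι cliffordForm w) := by
  have h1 : (ℝ ∙ u)ᗮ.reflection w = w - (2 * inner ℝ u w) • u := by
    rw [Submodule.reflection_orthogonal_apply, Submodule.reflection_singleton_apply, hu]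
    simp only [RCLike.ofReal_real_eq_id, id_eq, one_pow, div_one, neg_sub, two_smul,
      two_mul, add_smul]
  rw [h1, map_sub, map_smul, sub_mul, smul_mul_assoc, clifford_ι_sq, clifford_ι_swap w u,
    real_inner_self_eq_norm_sq, hu, real_inner_comm]
  simp only [Algebra.algebraMap_eq_smul_one, smul_smul]
  module

/-- The product of the unit normals does it. The involution absorbs the sign of each reflection, and
the parity of the product follows the sign of the determinant, so that determinant 1 will give an
even element. -/
theorem exists_pinGroup_of_reflections (l : List (EucSpace 4)) :
    ∃ x ∈ pinGroup cliffordForm,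
      (∀ w, CliffordAlgebra.ι cliffordForm
          ((l.map fun v => (ℝ ∙ v)ᗮ.reflection).prod w) * x =
        CliffordAlgebra.involute x * CliffordAlgebra.ι cliffordForm w) ∧
      ((x ∈ CliffordAlgebra.evenOdd cliffordForm 0 ∧ LinearMap.det
          ((l.map fun v => (ℝ ∙ v)ᗮ.reflection).prod.toLinearEquiv :
            EucSpace 4 →ₗ[ℝ] EucSpace 4) = 1) ∨
       (x ∈ CliffordAlgebra.evenOdd cliffordForm 1 ∧ LinearMap.det
          ((l.map fun v => (ℝ ∙ v)ᗮ.reflection).prod.toLinearEquiv :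
            EucSpace 4 →ₗ[ℝ] EucSpace 4) = -1)) := by
  induction l with
  | nil =>
    refine ⟨1, one_mem _, fun w => by simp, Or.inl ⟨SetLike.one_mem_graded _, ?_⟩⟩
    exact LinearMap.det_id
  | cons v l ih =>
    obtain ⟨x, hx, hw, hd⟩ := ih
    set φ := (l.map fun v => (ℝ ∙ v)ᗮ.reflection).prod with hφ
    rw [List.map_cons, List.prod_cons, ← hφ]
    -- The list may contain the zero vector, whose "reflection" is the identity and contributes no
    -- factor.
    by_cases hv : v = 0
    · have h1 : ((ℝ ∙ v)ᗮ.reflection : EucSpace 4 ≃ₗᵢ[ℝ] EucSpace 4) = 1 := by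
        subst hv
        ext1 w
        exact Submodule.reflection_mem_subspace_eq_self (by simp)
      rw [h1, one_mul]
      exact ⟨x, hx, hw, hd⟩
    · obtain ⟨u, hu, hs⟩ : ∃ u : EucSpace 4, ‖u‖ = 1 ∧ (ℝ ∙ v) = (ℝ ∙ u) := by
        have hv' : ‖v‖⁻¹ ≠ 0 := inv_ne_zero (norm_ne_zero_iff.2 hv)
        refine ⟨‖v‖⁻¹ • v, norm_smul_inv_norm hv, ?_⟩
        exact (Submodule.span_singleton_smul_eq (IsUnit.mk0 _ hv') v).symm
      have hdet : LinearMap.det (((ℝ ∙ v)ᗮ.reflection * φ).toLinearEquiv :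
          EucSpace 4 →ₗ[ℝ] EucSpace 4) =
          - LinearMap.det (φ.toLinearEquiv : EucSpace 4 →ₗ[ℝ] EucSpace 4) := by
        have h2 : (((ℝ ∙ v)ᗮ.reflection * φ).toLinearEquiv : EucSpace 4 →ₗ[ℝ] EucSpace 4) =
            ((ℝ ∙ v)ᗮ.reflection.toLinearEquiv : EucSpace 4 →ₗ[ℝ] EucSpace 4) ∘ₗ
              (φ.toLinearEquiv : EucSpace 4 →ₗ[ℝ] EucSpace 4) := rfl
        have h3 : LinearMap.det ((ℝ ∙ v)ᗮ.reflection.toLinearEquiv :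
            EucSpace 4 →ₗ[ℝ] EucSpace 4) = -1 := by
          refine (Submodule.det_reflection (ℝ ∙ v)ᗮ).trans ?_
          rw [Submodule.orthogonal_orthogonal, finrank_span_singleton hv, pow_one]
        rw [h2, LinearMap.det_comp, h3, neg_one_mul]
      refine ⟨CliffordAlgebra.ι cliffordForm u * x, mul_mem (ι_mem_pinGroup hu) hx, ?_, ?_⟩
      · intro w
        have h4 : ((ℝ ∙ v)ᗮ.reflection * φ) w = (ℝ ∙ u)ᗮ.reflection (φ w) := by
          simp only [hs]; rfl
        rw [h4, ← mul_assoc, ι_reflection_mul hu, neg_mul, mul_assoc, hw, map_mul,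
          CliffordAlgebra.involute_ι, neg_mul, neg_mul, mul_assoc]
      · rw [hdet]
        have hu1 := CliffordAlgebra.ι_mem_evenOdd_one cliffordForm u
        rcases hd with ⟨h5, h6⟩ | ⟨h5, h6⟩
        · right
          exact ⟨by simpa using SetLike.mul_mem_graded hu1 h5, by rw [h6]⟩
        · left
          refine ⟨?_, by rw [h6, neg_neg]⟩
          have := SetLike.mul_mem_graded hu1 h5
          exact this

/-- An isometry is a product of reflections, and determinant 1 selects the even case, where the
involution is trivial. -/
theorem Spin4.rotation_surjective : Function.Surjective Spin4.rotation := by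
  intro h
  obtain ⟨l, -, hl⟩ := h.1.reflections_generate_dim
  obtain ⟨x, hx, hw, hd⟩ := exists_pinGroup_of_reflections l
  rw [← hl] at hw hd
  have hdet : LinearMap.det (h.1.toLinearEquiv : EucSpace 4 →ₗ[ℝ] EucSpace 4) = 1 := h.2
  rw [hdet] at hd
  rcases hd with ⟨h1, -⟩ | ⟨-, h2⟩
  · let a : Spin4 := ⟨x, hx, h1⟩
    refine ⟨a, (SpinCovers.eq_rotation fun v => ?_).symm⟩
    have h3 := hw v
    rw [CliffordAlgebra.involute_eq_of_mem_even h1] at h3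
    change _ = x * _ * _
    rw [← h3, mul_assoc]
    change _ = _ * ((a : Cl4) * ((a⁻¹ : Spin4) : Cl4))
    rw [a.mul_coe_inv, mul_one]
  · norm_num at h2

/-! ### The topology of `Spin(4)` -/

theorem Spin4.isInducing_cliffordRep :
    Topology.IsInducing (fun a : Spin4 => cliffordRep (a : Cl4)) := ⟨rfl⟩

theorem Spin4.continuous_cliffordRep : Continuous (fun a : Spin4 => cliffordRep (a : Cl4)) :=
  Spin4.isInducing_cliffordRep.continuous

theorem Spin4.continuous_fst : Continuous Spin4.fst :=
  Continuous.matrix_submatrix Spin4.continuous_cliffordRep Sum.inl Sum.inl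

theorem Spin4.continuous_snd : Continuous Spin4.snd :=
  Continuous.matrix_submatrix Spin4.continuous_cliffordRep Sum.inr Sum.inr

theorem Spin4.tendsto_iff {α : Type*} {l : Filter α} {f : α → Spin4} {a : Spin4} :
    Filter.Tendsto f l (𝓝 a) ↔ Filter.Tendsto (fun t => (f t).fst) l (𝓝 a.fst) ∧
      Filter.Tendsto (fun t => (f t).snd) l (𝓝 a.snd) := by
  constructor
  · intro h
    exact ⟨(Spin4.continuous_fst.tendsto a).comp h, (Spin4.continuous_snd.tendsto a).comp h⟩
  · rintro ⟨h1, h2⟩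
    rw [Spin4.isInducing_cliffordRep.tendsto_nhds_iff]
    have h3 : Continuous fun q : Matrix (Fin 2) (Fin 2) ℂ × Matrix (Fin 2) (Fin 2) ℂ =>
        Matrix.fromBlocks q.1 0 0 q.2 :=
      Continuous.matrix_fromBlocks _root_.continuous_fst continuous_const continuous_const
        _root_.continuous_snd
    have h4 := (h3.tendsto (a.fst, a.snd)).comp (h1.prodMk_nhds h2)
    refine Filter.Tendsto.congr (fun t => ?_) (a.cliffordRep_eq ▸ h4)
    exact (f t).cliffordRep_eq.symm

instance : IsTopologicalGroup Spin4 where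
  continuous_mul := by
    rw [Spin4.isInducing_cliffordRep.continuous_iff]
    have h : Continuous fun q : Spin4 × Spin4 => cliffordRep (q.1 : Cl4) * cliffordRep (q.2 : Cl4) :=
      (Spin4.continuous_cliffordRep.comp continuous_fst).matrix_mul
        (Spin4.continuous_cliffordRep.comp continuous_snd)
    exact h.congr fun q => (map_mul cliffordRep _ _).symm
  continuous_inv := by
    rw [Spin4.isInducing_cliffordRep.continuous_iff]
    exact Spin4.continuous_cliffordRep.matrix_conjTranspose.congr fun a =>
      a.cliffordRep_inv.symm

instance : T2Space Spin4 :=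
  T2Space.of_injective_continuous (fun _ _ h => Spin4.ext_cliffordRep h)
    Spin4.continuous_cliffordRep

/-- A rotation as a continuous linear map. -/
noncomputable def rotCLM (h : SpecialOrthogonal 4) :
    EucSpace 4 →L[ℝ] EucSpace 4 :=
  (h.1.toContinuousLinearEquiv : EucSpace 4 →L[ℝ] EucSpace 4)

theorem continuous_clm_of_apply {X : Type*} [TopologicalSpace X]
    {f : X → EucSpace 4 →L[ℝ] EucSpace 4} (h : ∀ v, Continuous fun x => f x v) : Continuous f :=
  continuous_clm_apply.2 h

theorem continuous_quatVector : Continuous quatVector := by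
  refine (PiLp.continuous_toLp 2 _).comp (continuous_pi fun i => ?_)
  fin_cases i <;> simp <;> fun_prop

theorem Spin4.rotation_apply_eq (a : Spin4) (v : EucSpace 4) :
    a.rotation.1 v = quatVector (a.snd * (quatMatrix v * a.fst.conjTranspose)) := by
  rw [← a.quatMatrix_rotation, quatVector_quatMatrix]

theorem Spin4.continuous_rotCLM : Continuous fun a : Spin4 => rotCLM a.rotation := by
  refine continuous_clm_of_apply fun v => ?_
  have h : Continuous fun a : Spin4 =>
      quatVector (a.snd * (quatMatrix v * a.fst.conjTranspose)) :=
    continuous_quatVector.comp (Spin4.continuous_snd.matrix_mul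
      (continuous_const.matrix_mul Spin4.continuous_fst.matrix_conjTranspose))
  exact h.congr fun a => (a.rotation_apply_eq v).symm

/-- The average of `k(u) * u⁻¹` over unit quaternions, up to a factor. -/
noncomputable def quatAverage (k : EucSpace 4 →L[ℝ] EucSpace 4) : Matrix (Fin 2) (Fin 2) ℂ :=
  ∑ i, quatMatrix (k (EuclideanSpace.single i 1)) *
    (quatMatrix (EuclideanSpace.single i 1)).conjTranspose

theorem quatMatrix_e3 :
    quatMatrix (EuclideanSpace.single 3 1) = !![0, Complex.I; Complex.I, 0] := by
  ext i j; fin_cases i <;> fin_cases j <;> simp [quatMatrix]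

/-- Averaging the conjugates of a quaternion over 1, `i`, `j`, `k` keeps only its real part. -/
theorem IsQuaternionic.sum_conj {m : Matrix (Fin 2) (Fin 2) ℂ} (hm : IsQuaternionic m) :
    ∑ i, quatMatrix (EuclideanSpace.single i 1) * m *
      (quatMatrix (EuclideanSpace.single i 1)).conjTranspose =
      ((4 * (m 0 0).re : ℝ) : ℂ) • 1 := by
  obtain ⟨h1, h2⟩ := hm
  have hm : m = !![m 0 0, m 0 1; -star (m 0 1), star (m 0 0)] := by
    conv_lhs => rw [Matrix.eta_fin_two m, h1, h2]
  clear h1 h2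
  generalize m 0 0 = p, m 0 1 = q at hm
  subst hm
  rw [Fin.sum_univ_four, quatMatrix_e0, quatMatrix_e1, quatMatrix_e2, quatMatrix_e3]
  have c1 : (!![Complex.I, 0; 0, -Complex.I]).conjTranspose = !![-Complex.I, 0; 0, Complex.I] := by
    ext i j; fin_cases i <;> fin_cases j <;> simp
  have c2 : (!![(0 : ℂ), 1; -1, 0]).conjTranspose = !![0, -1; 1, 0] := by
    ext i j; fin_cases i <;> fin_cases j <;> simp
  have c3 : (!![0, Complex.I; Complex.I, 0]).conjTranspose = !![0, -Complex.I; -Complex.I, 0] := by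
    ext i j; fin_cases i <;> fin_cases j <;> simp
  rw [c1, c2, c3]
  ext i j
  fin_cases i <;> fin_cases j <;>
    simp [Complex.ext_iff] <;> ring_nf

/-- An explicit inverse of the covering: the rotation determines `snd` up to the real factor `4 * Re
fst`. Continuity of lifts near the identity comes from this. -/
theorem Spin4.quatAverage_rotation (a : Spin4) :
    quatAverage (rotCLM a.rotation) = ((4 * (a.fst 0 0).re : ℝ) : ℂ) • a.snd := by
  have h1 : ∀ v, quatMatrix (rotCLM a.rotation v) =
      a.snd * (quatMatrix v * a.fst.conjTranspose) := a.quatMatrix_rotation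
  simp only [quatAverage, h1, mul_assoc]
  rw [← Finset.mul_sum]
  simp only [← mul_assoc]
  rw [a.isQuaternionic_fst.conjTranspose.sum_conj, mul_smul_comm, mul_one]
  simp

theorem continuous_quatMatrix : Continuous quatMatrix := by
  refine continuous_matrix fun i j => ?_
  fin_cases i <;> fin_cases j <;> simp [quatMatrix] <;> fun_prop

theorem continuous_quatAverage : Continuous quatAverage := by
  refine continuous_finsetSum _ fun i _ => Continuous.matrix_mul ?_ continuous_const
  exact continuous_quatMatrix.comp (ContinuousLinearMap.apply ℝ _ _).continuous

theorem IsQuaternionic.norm_quatVector_sub {m : Matrix (Fin 2) (Fin 2) ℂ}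
    (hm : IsQuaternionic m) (hd : m.det = 1) :
    ‖quatVector m - quatVector 1‖ ^ 2 = 2 - 2 * (m 0 0).re := by
  have h := hm.sum_sq_eq_one hd
  rw [EuclideanSpace.norm_sq_eq, Fin.sum_univ_four]
  simp [quatVector]
  linarith

theorem Spin4.exists_lift_nonneg (h : SpecialOrthogonal 4) :
    ∃ a : Spin4, a.rotation = h ∧ 0 ≤ (a.fst 0 0).re := by
  obtain ⟨a, rfl⟩ := Spin4.rotation_surjective h
  rcases le_total 0 (a.fst 0 0).re with h1 | h1
  · exact ⟨a, rfl, h1⟩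
  · refine ⟨Spin4.minusOne * a, ?_, ?_⟩
    · rw [Spin4.rotation_mul, Spin4.rotation_minusOne, one_mul]
    · rw [Spin4.fst_mul, Spin4.fst_minusOne]
      simpa using h1

/-- The average tends to 4. Its determinant is the square of `4 * Re fst`, as `snd` has determinant
1, so `Re fst` tends to 1, the sign being fixed by `h0`. For a unit quaternion this forces `fst` to
tend to 1, and dividing the average by the factor gives `snd`. -/
theorem Spin4.tendsto_one_of_rotation {α : Type*} {l : Filter α} {f : α → Spin4}
    (h0 : ∀ t, 0 ≤ ((f t).fst 0 0).re)
    (h : Filter.Tendsto (fun t => rotCLM (f t).rotation) l (𝓝 (rotCLM 1))) :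
    Filter.Tendsto f l (𝓝 1) := by
  have h1 := (continuous_quatAverage.tendsto _).comp h
  have e1 : quatAverage (rotCLM 1) = (4 : ℂ) • 1 := by
    rw [← Spin4.rotation_one, Spin4.quatAverage_rotation, Spin4.fst_one, Spin4.snd_one]
    simp
  have h1' : Filter.Tendsto (fun t => ((4 * ((f t).fst 0 0).re : ℝ) : ℂ) • (f t).snd) l
      (𝓝 ((4 : ℂ) • 1)) := by
    rw [← e1]
    exact h1.congr fun t => (f t).quatAverage_rotation
  have h2 : Filter.Tendsto (fun t => ((f t).fst 0 0).re) l (𝓝 1) := by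
    have hd := ((Continuous.matrix_det continuous_id).tendsto _).comp h1'
    have hd2 := (Complex.continuous_re.tendsto _).comp hd
    have hd3 := (Real.continuous_sqrt.tendsto _).comp hd2
    have hd4 := hd3.div_const 4
    have e2 : √((id ((4 : ℂ) • (1 : Matrix (Fin 2) (Fin 2) ℂ))).det.re) / 4 = 1 := by
      have : (id ((4 : ℂ) • (1 : Matrix (Fin 2) (Fin 2) ℂ))).det = ((16 : ℝ) : ℂ) := by
        rw [id, Matrix.det_smul, Matrix.det_one]; norm_num
      rw [this, Complex.ofReal_re, show (16 : ℝ) = 4 ^ 2 by norm_num, Real.sqrt_sq (by norm_num)]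
      norm_num
    rw [e2] at hd4
    refine hd4.congr fun t => ?_
    simp only [Function.comp_apply, id]
    rw [Matrix.det_smul, (f t).det_snd, mul_one, Fintype.card_fin, ← Complex.ofReal_pow,
      Complex.ofReal_re, Real.sqrt_sq (by linarith [h0 t])]
    ring
  have h3 : Filter.Tendsto (fun t => (f t).fst) l (𝓝 1) := by
    have h4 : Filter.Tendsto (fun t => quatVector (f t).fst) l (𝓝 (quatVector 1)) := by
      rw [tendsto_iff_norm_sub_tendsto_zero]
      -- A unit quaternion `q` satisfies `‖q - 1‖ ^ 2 = 2 - 2 * Re q`.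
      have h5 : Filter.Tendsto (fun t => √(2 - 2 * ((f t).fst 0 0).re)) l (𝓝 √(2 - 2 * 1)) :=
        (Real.continuous_sqrt.tendsto _).comp (tendsto_const_nhds.sub (h2.const_mul 2))
      rw [show (2 : ℝ) - 2 * 1 = 0 by norm_num, Real.sqrt_zero] at h5
      refine h5.congr fun t => ?_
      rw [← (f t).isQuaternionic_fst.norm_quatVector_sub (f t).det_fst,
        Real.sqrt_sq (norm_nonneg _)]
    have h6 := (continuous_quatMatrix.tendsto _).comp h4
    have h7 : quatMatrix (quatVector 1) = 1 := by
      rw [← Spin4.fst_one]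
      exact (Spin4.isQuaternionic_fst 1).quatMatrix_quatVector
    rw [h7] at h6
    exact h6.congr fun t => (f t).isQuaternionic_fst.quatMatrix_quatVector
  rw [Spin4.tendsto_iff, Spin4.fst_one, Spin4.snd_one]
  refine ⟨h3, ?_⟩
  have h8 : Filter.Tendsto (fun t => ((4 * ((f t).fst 0 0).re : ℝ) : ℂ)⁻¹) l (𝓝 ((4 : ℂ)⁻¹)) := by
    refine Filter.Tendsto.inv₀ ?_ (by norm_num)
    have := (Complex.continuous_ofReal.tendsto _).comp (h2.const_mul 4)
    simpa [Function.comp_def] using this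
  have h9 := h8.smul h1'
  rw [smul_smul, inv_mul_cancel₀ (by norm_num), one_smul] at h9
  refine h9.congr' ?_
  filter_upwards [h2.eventually_ne one_ne_zero] with t ht
  rw [smul_smul, inv_mul_cancel₀ (by exact_mod_cast mul_ne_zero four_ne_zero ht), one_smul]

/-- A section of the covering `Spin(4) → SO(4)` which is continuous at the identity. -/
theorem Spin4.exists_section : ∃ s : SpecialOrthogonal 4 → Spin4,
    (∀ h, (s h).rotation = h) ∧ s 1 = 1 ∧
    ∀ {α : Type} {l : Filter α} {f : α → SpecialOrthogonal 4},
      Filter.Tendsto (fun t => rotCLM (f t)) l (𝓝 (rotCLM 1)) →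
      Filter.Tendsto (fun t => s (f t)) l (𝓝 1) := by
  choose s h1 h2 using Spin4.exists_lift_nonneg
  refine ⟨s, h1, ?_, fun {α l f} h => ?_⟩
  -- Of the two lifts of the identity, only 1 has non-negative real part.
  · rcases Spin4.eq_one_or_of_rotation_eq_one (h1 1) with h | h
    · exact h
    · have := h2 1
      rw [h, Spin4.fst_minusOne] at this
      norm_num at this
  · refine Spin4.tendsto_one_of_rotation (fun t => h2 _) ?_
    simpa only [h1] using h

/-! ### Lifts of transition functions -/

namespace OrbifoldChart

variable {n : ℕ} {M : Type u} [TopologicalSpace M] {c d e : OrbifoldChart n M}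

theorem isOpen_dom (c : OrbifoldChart n M) : IsOpen c.dom :=
  c.toHomeo.open_target.preimage continuous_quotient_mk'

theorem mk_group_apply (c : OrbifoldChart n M) {γ : EucSpace n ≃ₗᵢ[ℝ] EucSpace n}
    (hγ : γ ∈ c.group) (y : EucSpace n) :
    Quotient.mk (orbitSetoid c.group) (γ y) = Quotient.mk (orbitSetoid c.group) y :=
  Quotient.sound ⟨γ⁻¹, c.group.inv_mem hγ, γ.symm_apply_apply y⟩

theorem group_apply_mem_dom (c : OrbifoldChart n M) {γ : EucSpace n ≃ₗᵢ[ℝ] EucSpace n}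
    (hγ : γ ∈ c.group) {y : EucSpace n} : γ y ∈ c.dom ↔ y ∈ c.dom := by
  rw [dom, Set.mem_ofPred_eq, Set.mem_ofPred_eq, c.mk_group_apply hγ]

theorem proj_group_apply (c : OrbifoldChart n M) {γ : EucSpace n ≃ₗᵢ[ℝ] EucSpace n}
    (hγ : γ ∈ c.group) (y : EucSpace n) : c.proj (γ y) = c.proj y := by
  rw [proj, c.mk_group_apply hγ, proj]

theorem exists_group_of_proj_eq (c : OrbifoldChart n M) {y z : EucSpace n} (hy : y ∈ c.dom)
    (hz : z ∈ c.dom) (h : c.proj y = c.proj z) : ∃ γ ∈ c.group, γ y = z :=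
  Quotient.exact (c.toHomeo.symm.injOn hy hz h)

theorem isTransitionLift_group (c : OrbifoldChart n M) {γ : EucSpace n ≃ₗᵢ[ℝ] EucSpace n}
    (hγ : γ ∈ c.group) : c.IsTransitionLift c
      (γ.toHomeomorph.toOpenPartialHomeomorph.restrOpen c.dom c.isOpen_dom) where
  source_subset := by
    intro y hy
    exact hy.2
  target_subset := by
    intro y hy
    have h : γ.symm y ∈ c.dom := hy.2
    have := (c.group_apply_mem_dom hγ).2 h
    rwa [γ.apply_symm_apply] at this
  smooth := γ.contDiff.contDiffOn
  smooth_symm := γ.symm.contDiff.contDiffOn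
  proj_eq := fun y _ => c.proj_group_apply hγ y

theorem IsTransitionLift.symm {F : OpenPartialHomeomorph (EucSpace n) (EucSpace n)}
    (h : c.IsTransitionLift d F) : d.IsTransitionLift c F.symm where
  source_subset := h.target_subset
  target_subset := h.source_subset
  smooth := h.smooth_symm
  smooth_symm := h.smooth
  proj_eq := by
    intro y hy
    have := h.proj_eq _ (F.map_target hy)
    rw [F.right_inv hy] at this
    exact this.symm

theorem IsTransitionLift.trans {F G : OpenPartialHomeomorph (EucSpace n) (EucSpace n)}
    (h : c.IsTransitionLift d F) (h' : d.IsTransitionLift e G) :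
    c.IsTransitionLift e (F.trans G) where
  source_subset := fun y hy => h.source_subset (by
    rw [OpenPartialHomeomorph.trans_source] at hy; exact hy.1)
  target_subset := fun y hy => h'.target_subset (by
    rw [OpenPartialHomeomorph.trans_target] at hy; exact hy.1)
  smooth := by
    rw [OpenPartialHomeomorph.coe_trans, OpenPartialHomeomorph.trans_source]
    exact h'.smooth.comp (h.smooth.mono Set.inter_subset_left) fun y hy => hy.2
  smooth_symm := by
    rw [OpenPartialHomeomorph.coe_trans_symm, OpenPartialHomeomorph.trans_target]
    exact h.smooth_symm.comp (h'.smooth_symm.mono Set.inter_subset_left) fun y hy => hy.2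
  proj_eq := by
    intro y hy
    rw [OpenPartialHomeomorph.trans_source] at hy
    rw [OpenPartialHomeomorph.coe_trans, Function.comp_apply, h'.proj_eq _ hy.2, h.proj_eq _ hy.1]

theorem IsTransitionLift.differentiableAt
    {F : OpenPartialHomeomorph (EucSpace n) (EucSpace n)}
    (h : c.IsTransitionLift d F) {y : EucSpace n} (hy : y ∈ F.source) :
    DifferentiableAt ℝ F y :=
  (h.smooth.contDiffAt (F.open_source.mem_nhds hy)).differentiableAt (by simp)

theorem IsTransitionLift.continuousOn_fderiv
    {F : OpenPartialHomeomorph (EucSpace n) (EucSpace n)}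
    (h : c.IsTransitionLift d F) : ContinuousOn (fderiv ℝ F) F.source :=
  h.smooth.continuousOn_fderiv_of_isOpen F.open_source (by simp)

theorem IsTransitionLift.fderiv_symm_comp
    {F : OpenPartialHomeomorph (EucSpace n) (EucSpace n)}
    (h : c.IsTransitionLift d F) {y : EucSpace n} (hy : y ∈ F.source) :
    (fderiv ℝ F.symm (F y)).comp (fderiv ℝ F y) = ContinuousLinearMap.id ℝ (EucSpace n) := by
  have h1 : DifferentiableAt ℝ F.symm (F y) := h.symm.differentiableAt (F.map_source hy)
  rw [← fderiv_comp y h1 (h.differentiableAt hy), ← fderiv_id (𝕜 := ℝ) (x := y)]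
  refine Filter.EventuallyEq.fderiv_eq ?_
  filter_upwards [F.open_source.mem_nhds hy] with z hz
  exact F.left_inv hz

/-- Near each point, a lift of the identity has the value and the differential of an element of
the group of the chart. -/
theorem IsTransitionLift.exists_group_eq
    {F : OpenPartialHomeomorph (EucSpace n) (EucSpace n)}
    (h : c.IsTransitionLift c F) {z : EucSpace n} (hz : z ∈ F.source) :
    ∃ γ ∈ c.group, γ z = F z ∧
      fderiv ℝ F z = (γ.toContinuousLinearEquiv : EucSpace n →L[ℝ] EucSpace n) := by
  have := c.finite_group
  have hF := h.differentiableAt hz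
  -- Along the line `z + t v`, each value of `F` is the value of one of finitely many group
  -- elements. If none of them had both the value and the derivative of `F` at `t = 0`, all would
  -- differ from `F` for small non-zero `t`.
  have key : ∀ v, ∃ γ : c.group, γ.1 z = F z ∧ fderiv ℝ F z v = γ.1 v := by
    intro v
    have h1 : ∀ᶠ t : ℝ in 𝓝[≠] 0, ∃ γ : c.group, F (z + t • v) - γ.1 (z + t • v) = 0 := by
      have hc : Continuous fun t : ℝ => z + t • v := by fun_prop
      have h2 : ∀ᶠ t : ℝ in 𝓝 0, z + t • v ∈ F.source := by
        refine hc.continuousAt.eventually_mem (F.open_source.mem_nhds ?_)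
        simpa using hz
      filter_upwards [nhdsWithin_le_nhds h2] with t ht
      obtain ⟨γ, hγ, hγ'⟩ := c.exists_group_of_proj_eq (h.source_subset ht)
        (h.target_subset (F.map_source ht)) (h.proj_eq _ ht).symm
      exact ⟨⟨γ, hγ⟩, by rw [hγ', sub_self]⟩
    by_contra! hne
    have h3 : ∀ γ : c.group, ∀ᶠ t : ℝ in 𝓝[≠] 0, F (z + t • v) - γ.1 (z + t • v) ≠ 0 := by
      intro γ
      have hd : HasDerivAt (fun t : ℝ => F (z + t • v) - γ.1 (z + t • v))
          (fderiv ℝ F z v - γ.1 v) 0 := by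
        have hl : HasDerivAt (fun t : ℝ => z + t • v) v 0 := by
          simpa using ((hasDerivAt_id (0 : ℝ)).smul_const v).const_add z
        have hF' : HasFDerivAt F (fderiv ℝ F z) (z + (0 : ℝ) • v) := by
          simpa using hF.hasFDerivAt
        have hg : HasFDerivAt γ.1 (γ.1.toContinuousLinearEquiv : EucSpace n →L[ℝ] EucSpace n)
            (z + (0 : ℝ) • v) :=
          ContinuousLinearMap.hasFDerivAt
            (γ.1.toContinuousLinearEquiv : EucSpace n →L[ℝ] EucSpace n)
        have hg' : HasDerivAt (fun t : ℝ => γ.1 (z + t • v)) (γ.1 v) 0 :=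
          HasFDerivAt.comp_hasDerivAt (f := fun t : ℝ => z + t • v) 0 hg hl
        exact (hF'.comp_hasDerivAt 0 hl).sub hg'
      by_cases hγ : γ.1 z = F z
      · exact hd.eventually_ne (sub_ne_zero.2 (hne γ hγ))
      · refine nhdsWithin_le_nhds (hd.continuousAt.eventually_ne ?_)
        simpa [sub_eq_zero] using Ne.symm hγ
    have h4 := Filter.eventually_all.2 h3
    obtain ⟨t, ⟨γ, h5⟩, h6⟩ := (h1.and h4).exists
    exact h6 γ h5
  -- The group element found above depends on the direction. But a real vector space which is a
  -- finite union of subspaces equals one of them, so a single element serves all directions.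
  let S : {γ : c.group // γ.1 z = F z} → Submodule ℝ (EucSpace n) := fun γ =>
    LinearMap.ker ((fderiv ℝ F z -
      (γ.1.1.toContinuousLinearEquiv : EucSpace n →L[ℝ] EucSpace n) :
        EucSpace n →L[ℝ] EucSpace n) : EucSpace n →ₗ[ℝ] EucSpace n)
  obtain ⟨γ, hγ⟩ : ∃ γ, S γ = ⊤ := by
    refine Subspace.exists_eq_top_of_iUnion_eq_univ (Set.eq_univ_of_forall fun v => ?_)
    obtain ⟨γ, h1, h2⟩ := key v
    refine Set.mem_iUnion.2 ⟨⟨γ, h1⟩, ?_⟩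
    change fderiv ℝ F z v - γ.1 v = 0
    rw [h2, sub_self]
  refine ⟨γ.1.1, γ.1.2, γ.2, ContinuousLinearMap.ext fun v => ?_⟩
  have h1 : v ∈ S γ := hγ ▸ Submodule.mem_top
  exact sub_eq_zero.1 h1

end OrbifoldChart

/-! ### The frame bundle -/

namespace OrbifoldMetric

variable {n : ℕ} {M : Type u} [TopologicalSpace M] {O : OrientedOrbifold n M}
  (g : OrbifoldMetric O)

/-- The differential of a lift of a transition function sends frames to frames. -/
theorem map_mem_frames {i j : O.ι} {F : OpenPartialHomeomorph (EucSpace n) (EucSpace n)}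
    (hF : (O.chart i).IsTransitionLift (O.chart j) F)
    {f : EucSpace n × (EucSpace n →L[ℝ] EucSpace n)} (hf : f ∈ g.frames i) (hy : f.1 ∈ F.source) :
    (F f.1, (fderiv ℝ F f.1).comp f.2) ∈ g.frames j := by
  refine ⟨hF.target_subset (F.map_source hy), fun v w => ?_, ?_⟩
  · exact (g.invariant i j F hF f.1 hy _ _).trans (hf.2.1 v w)
  · have h : ((fderiv ℝ F f.1).comp f.2).det = (fderiv ℝ F f.1).det * f.2.det :=
      LinearMap.det_comp _ _
    change 0 < ((fderiv ℝ F f.1).comp f.2).det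
    rw [h]
    exact mul_pos (O.oriented i j F hF f.1 hy) hf.2.2

theorem frameRel_of_group {i : O.ι} {γ : EucSpace n ≃ₗᵢ[ℝ] EucSpace n}
    (hγ : γ ∈ (O.chart i).group) (f f' : g.frames i) (h1 : γ f.1.1 = f'.1.1)
    (h2 : (γ.toContinuousLinearEquiv : EucSpace n →L[ℝ] EucSpace n).comp f.1.2 = f'.1.2) :
    g.FrameRel ⟨i, f⟩ ⟨i, f'⟩ := by
  refine ⟨_, (O.chart i).isTransitionLift_group hγ, ⟨Set.mem_univ _, f.2.1⟩, h1, ?_⟩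
  rw [← h2]
  congr 1
  exact (γ.toContinuousLinearEquiv : EucSpace n →L[ℝ] EucSpace n).fderiv

/-- Needed because `FrameBundle` is a bare `Quot`: equality of frames now means the relation itself,
not the equivalence it generates. -/
theorem frameRel_equivalence : Equivalence g.FrameRel where
  refl a := g.frameRel_of_group (O.chart a.1).group.one_mem a.2 a.2 rfl rfl
  symm := by
    rintro a b ⟨F, hF, ha, hb, hab⟩
    refine ⟨F.symm, hF.symm, hb ▸ F.map_source ha, ?_, ?_⟩
    · rw [← hb, F.left_inv ha]
    · rw [← hb, ← hab, ← ContinuousLinearMap.comp_assoc, hF.fderiv_symm_comp ha,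
        ContinuousLinearMap.id_comp]
  trans := by
    rintro a b c ⟨F, hF, ha, hb, hab⟩ ⟨G, hG, hb', hc, hbc⟩
    have hs : F a.2.1.1 ∈ G.source := by rw [hb]; exact hb'
    refine ⟨F.trans G, hF.trans hG, ?_, ?_, ?_⟩
    · rw [OpenPartialHomeomorph.trans_source]
      exact ⟨ha, hs⟩
    · rw [OpenPartialHomeomorph.coe_trans, Function.comp_apply, hb, hc]
    · rw [OpenPartialHomeomorph.coe_trans, fderiv_comp _ (hG.differentiableAt hs)
        (hF.differentiableAt ha), ContinuousLinearMap.comp_assoc, hab, hb, hbc]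

theorem frameMk_eq_iff {i j : O.ι} {f : g.frames i} {f' : g.frames j} :
    g.frameMk i f = g.frameMk j f' ↔ g.FrameRel ⟨i, f⟩ ⟨j, f'⟩ := by
  exact (Quot.eq (r := g.FrameRel)).trans g.frameRel_equivalence.eqvGen_iff

/-- Within one chart, an arbitrary lift of the identity affects a frame only through its value and
differential at one point, where it agrees with a group element. -/
theorem frameMk_eq_iff_group {i : O.ι} {f f' : g.frames i} :
    g.frameMk i f = g.frameMk i f' ↔ ∃ γ ∈ (O.chart i).group, γ f.1.1 = f'.1.1 ∧
      (γ.toContinuousLinearEquiv : EucSpace n →L[ℝ] EucSpace n).comp f.1.2 = f'.1.2 := by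
  rw [g.frameMk_eq_iff]
  constructor
  · rintro ⟨F, hF, hs, h1, h2⟩
    obtain ⟨γ, hγ, h3, h4⟩ := OrbifoldChart.IsTransitionLift.exists_group_eq hF hs
    exact ⟨γ, hγ, h3.trans h1, by rw [← h2, h4]⟩
  · rintro ⟨γ, hγ, h1, h2⟩
    exact g.frameRel_of_group hγ f f' h1 h2

theorem frameMk_surjective (f : g.FrameBundle) : ∃ i f', g.frameMk i f' = f := by
  obtain ⟨⟨i, f'⟩, rfl⟩ := Quot.exists_rep f
  exact ⟨i, f', rfl⟩

/-- Every frame over a point of a chart is represented in that chart, over any preimage of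
the point. -/
theorem exists_frameMk_eq {i : O.ι} {z : EucSpace n} (hz : z ∈ (O.chart i).dom)
    {f : g.FrameBundle} (hf : g.base f = (O.chart i).proj z) :
    ∃ f' : g.frames i, f'.1.1 = z ∧ g.frameMk i f' = f := by
  obtain ⟨j, f₀, rfl⟩ := g.frameMk_surjective f
  obtain ⟨F, hF, hs, hFz⟩ := O.compat j i f₀.1.1 f₀.2.1 z hz hf
  exact ⟨⟨_, g.map_mem_frames hF f₀.2 hs⟩, hFz,
    (g.frameMk_eq_iff.2 ⟨F, hF, hs, rfl, rfl⟩).symm⟩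

theorem continuous_frameMk (i : O.ι) : Continuous (g.frameMk i) :=
  continuous_quot_mk.comp continuous_sigmaMk

/-- A transition lift carrying one frame to another does so for all nearby frames, and continuously.
Hence the saturation of an open set is open in every chart. -/
theorem isOpenMap_frameMk (i : O.ι) : IsOpenMap (g.frameMk i) := by
  intro W hW
  refine isOpen_coinduced.2 (isOpen_sigma_iff.2 fun j => ?_)
  rw [isOpen_iff_mem_nhds]
  rintro b ⟨a, haW, hab⟩
  obtain ⟨F, hF, hs, h1, h2⟩ := g.frameMk_eq_iff.1 (Eq.symm hab : g.frameMk j b = g.frameMk i a)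
  obtain ⟨W', hW', rfl⟩ := isOpen_induced_iff.1 hW
  have hcont : ContinuousAt (fun b' : g.frames j =>
      (F b'.1.1, (fderiv ℝ F b'.1.1).comp b'.1.2)) b := by
    have e1 : ContinuousAt (fun b' : g.frames j => b'.1.1) b :=
      (continuous_fst.comp continuous_subtype_val).continuousAt
    have e2 : ContinuousAt (fun b' : g.frames j => b'.1.2) b :=
      (continuous_snd.comp continuous_subtype_val).continuousAt
    have e3 : ContinuousAt F b.1.1 := F.continuousAt hs
    have e4 : ContinuousAt (fderiv ℝ F) b.1.1 :=
      hF.continuousOn_fderiv.continuousAt (F.open_source.mem_nhds hs)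
    exact (ContinuousAt.comp (f := fun b' : g.frames j => b'.1.1) e3 e1).prodMk
      ((ContinuousAt.comp (f := fun b' : g.frames j => b'.1.1) e4 e1).clm_comp e2)
  have hmem : (F b.1.1, (fderiv ℝ F b.1.1).comp b.1.2) ∈ W' := by
    have : (F b.1.1, (fderiv ℝ F b.1.1).comp b.1.2) = a.1 := Prod.ext h1 h2
    rw [this]
    exact haW
  have hsrc : ∀ᶠ b' : g.frames j in 𝓝 b, b'.1.1 ∈ F.source :=
    (continuous_fst.comp continuous_subtype_val).continuousAt.eventually_mem
      (F.open_source.mem_nhds hs)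
  filter_upwards [hcont.eventually_mem (hW'.mem_nhds hmem), hsrc] with b' h3 h4
  let a' : g.frames i := ⟨_, g.map_mem_frames hF b'.2 h4⟩
  have heq : g.frameMk j b' = g.frameMk i a' := g.frameMk_eq_iff.2 ⟨F, hF, h4, rfl, rfl⟩
  exact ⟨a', h3, heq.symm⟩

theorem rotate_frameMk (i : O.ι) (f : g.frames i) (h : SpecialOrthogonal n) :
    g.rotate (g.frameMk i f) h = g.frameMk i (g.rotateFrame i f h) := rfl

theorem rotate_mul (f : g.FrameBundle) (h k : SpecialOrthogonal n) :
    g.rotate f (h * k) = g.rotate (g.rotate f h) k := by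
  obtain ⟨i, f, rfl⟩ := g.frameMk_surjective f
  rfl

theorem base_rotate (f : g.FrameBundle) (h : SpecialOrthogonal n) :
    g.base (g.rotate f h) = g.base f := by
  obtain ⟨i, f, rfl⟩ := g.frameMk_surjective f
  rfl

end OrbifoldMetric

/-! ### An equivariant frame of a local smooth covering -/

section InverseSqrt

open Matrix

open scoped Matrix.Norms.L2Operator MatrixOrder

variable {n : ℕ}

/-- The inverse of the positive square root of a positive definite matrix. -/
noncomputable def invSqrtMatrix (A : Matrix (Fin n) (Fin n) ℝ) : Matrix (Fin n) (Fin n) ℝ :=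
  cfc (fun x : ℝ => (√x)⁻¹) A

theorem Matrix.PosDef.spectrum_subset_Ioi {A : Matrix (Fin n) (Fin n) ℝ} (hA : A.PosDef) :
    spectrum ℝ A ⊆ Set.Ioi 0 := by
  rw [hA.isHermitian.spectrum_real_eq_range_eigenvalues]
  rintro _ ⟨k, rfl⟩
  exact hA.eigenvalues_pos k

theorem continuousOn_inv_sqrt : ContinuousOn (fun x : ℝ => (√x)⁻¹) (Set.Ioi 0) :=
  Real.continuous_sqrt.continuousOn.inv₀ fun _ hx => (Real.sqrt_pos.2 hx).ne'

theorem isSelfAdjoint_invSqrtMatrix (A : Matrix (Fin n) (Fin n) ℝ) :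
    IsSelfAdjoint (invSqrtMatrix A) :=
  cfc_predicate _ _

theorem invSqrtMatrix_mul_mul {A : Matrix (Fin n) (Fin n) ℝ} (hA : A.PosDef) :
    invSqrtMatrix A * A * invSqrtMatrix A = 1 := by
  have hs : IsSelfAdjoint A := hA.isHermitian
  have hc := continuousOn_inv_sqrt.mono hA.spectrum_subset_Ioi
  have h1 : invSqrtMatrix A * A = cfc (fun x : ℝ => (√x)⁻¹ * x) A := by
    rw [cfc_mul (fun x : ℝ => (√x)⁻¹) (fun x => x) A hc continuousOn_id, cfc_id' ℝ A]
    rfl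
  have h2 : invSqrtMatrix A * A * invSqrtMatrix A =
      cfc (fun x : ℝ => (√x)⁻¹ * x * (√x)⁻¹) A := by
    rw [cfc_mul (fun x : ℝ => (√x)⁻¹ * x) (fun x => (√x)⁻¹) A (hc.mul continuousOn_id) hc, ← h1]
    rfl
  rw [h2, ← cfc_const_one ℝ A]
  refine cfc_congr fun x hx => ?_
  have hx' : 0 < x := hA.spectrum_subset_Ioi hx
  have h3 : √x ≠ 0 := (Real.sqrt_pos.2 hx').ne'
  have h4 : √x * √x = x := Real.mul_self_sqrt hx'.le
  field_simp
  nlinarith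

theorem det_invSqrtMatrix_pos {A : Matrix (Fin n) (Fin n) ℝ} (hA : A.PosDef) :
    0 < (invSqrtMatrix A).det := by
  have h1 : (0 : Matrix (Fin n) (Fin n) ℝ) ≤ invSqrtMatrix A :=
    cfc_nonneg fun x _ => inv_nonneg.2 (Real.sqrt_nonneg x)
  have h2 : 0 ≤ (invSqrtMatrix A).det := (Matrix.nonneg_iff_posSemidef.1 h1).det_nonneg
  refine lt_of_le_of_ne h2 fun h3 => ?_
  have h4 := congrArg Matrix.det (invSqrtMatrix_mul_mul hA)
  rw [Matrix.det_mul, ← h3, mul_zero, Matrix.det_one] at h4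
  exact zero_ne_one h4

theorem continuousOn_invSqrtMatrix {X : Type*} [TopologicalSpace X]
    {A : X → Matrix (Fin n) (Fin n) ℝ} {s : Set X} (hc : ContinuousOn A s)
    (hA : ∀ x ∈ s, (A x).PosDef) : ContinuousOn (fun x => invSqrtMatrix (A x)) s := by
  refine ContinuousOn.cfc_of_mem_nhdsSet (s := Set.Ioi 0) _ ?_ hc
    (fun x hx => (hA x hx).isHermitian) continuousOn_inv_sqrt
  exact isOpen_Ioi.mem_nhdsSet.2 (Set.iUnion₂_subset fun x hx => (hA x hx).spectrum_subset_Ioi)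

/-- Functional calculus commutes with star automorphisms. This naturality makes the symmetric frame
equivariant, which a Gram–Schmidt frame would not be. -/
theorem invSqrtMatrix_conj {A : Matrix (Fin n) (Fin n) ℝ} (hA : A.PosDef)
    (U : unitary (Matrix (Fin n) (Fin n) ℝ)) :
    invSqrtMatrix (U.1 * A * star U.1) =
      U.1 * invSqrtMatrix A * star U.1 := by
  have hc := continuousOn_inv_sqrt.mono hA.spectrum_subset_Ioi
  have hs : IsSelfAdjoint A := hA.isHermitian
  have hφ : Continuous (Unitary.conjStarAlgAut ℝ (Matrix (Fin n) (Fin n) ℝ) U) := by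
    have : Continuous fun B : Matrix (Fin n) (Fin n) ℝ =>
      U.1 * B * star U.1 :=
      (continuous_const.mul continuous_id).mul continuous_const
    exact this
  have h := StarAlgHomClass.map_cfc (Unitary.conjStarAlgAut ℝ (Matrix (Fin n) (Fin n) ℝ) U)
    (fun x : ℝ => (√x)⁻¹) A hc hφ hs
    (hs.map (Unitary.conjStarAlgAut ℝ (Matrix (Fin n) (Fin n) ℝ) U))
  exact h.symm

end InverseSqrt

namespace OrbifoldMetric

open Matrix

variable {n : ℕ} {M : Type u} [TopologicalSpace M] {O : OrientedOrbifold n M}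
  (g : OrbifoldMetric O) (i : O.ι)

/-- The Gram matrix of the metric in the standard basis. -/
noncomputable def gram (z : EucSpace n) : Matrix (Fin n) (Fin n) ℝ :=
  Matrix.of fun a b => g.metric i z (EuclideanSpace.single a 1) (EuclideanSpace.single b 1)

theorem metric_eq_gram (z v w : EucSpace n) :
    g.metric i z v w = inner ℝ v (Matrix.toEuclideanCLM (𝕜 := ℝ) (g.gram i z) w) := by
  have h : ∀ v : EucSpace n, v = ∑ k, v k • EuclideanSpace.single k (1 : ℝ) := by
    intro v
    ext j
    simp [Pi.single_apply]
  rw [Matrix.inner_toEuclideanCLM]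
  conv_lhs => rw [h v, h w]
  simp only [map_sum, map_smul, _root_.sum_apply, _root_.smul_apply,
    smul_eq_mul, dotProduct, Matrix.mulVec, gram, Matrix.of_apply]
  simp only [Finset.mul_sum]
  rw [Finset.sum_comm]
  exact Finset.sum_congr rfl fun a _ => Finset.sum_congr rfl fun b _ => by ring

variable {i}

theorem gram_posDef {z : EucSpace n} (hz : z ∈ (O.chart i).dom) : (g.gram i z).PosDef := by
  rw [Matrix.posDef_iff_dotProduct_mulVec]
  refine ⟨?_, fun x hx => ?_⟩
  · ext a b
    simp only [Matrix.conjTranspose_apply, gram, Matrix.of_apply, star_trivial]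
    exact g.symm i z hz _ _
  · have h := g.pos i z hz (WithLp.toLp 2 x) (by simpa using hx)
    rw [g.metric_eq_gram, Matrix.inner_toEuclideanCLM] at h
    simpa using h

variable (i)

/-- The frame of the local smooth covering given by the inverse square root of the metric. It is
equivariant under the group of the chart. -/
noncomputable def symFrame (z : EucSpace n) : EucSpace n →L[ℝ] EucSpace n :=
  Matrix.toEuclideanCLM (𝕜 := ℝ) (invSqrtMatrix (g.gram i z))

variable {i}

theorem symFrame_mem_frames {z : EucSpace n} (hz : z ∈ (O.chart i).dom) :
    (z, g.symFrame i z) ∈ g.frames i := by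
  have hG := g.gram_posDef hz
  refine ⟨hz, fun v w => ?_, ?_⟩
  · change g.metric i z (g.symFrame i z v) (g.symFrame i z w) = _
    have h1 : ContinuousLinearMap.adjoint (g.symFrame i z) = g.symFrame i z := by
      rw [← ContinuousLinearMap.star_eq_adjoint, symFrame, ← map_star,
        (isSelfAdjoint_invSqrtMatrix _).star_eq]
    have h2 : g.symFrame i z (Matrix.toEuclideanCLM (𝕜 := ℝ) (g.gram i z) (g.symFrame i z w)) =
        w := by
      have h3 := congrArg (Matrix.toEuclideanCLM (𝕜 := ℝ)) (invSqrtMatrix_mul_mul hG)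
      rw [map_mul, map_mul, map_one] at h3
      exact congrArg (fun f => f w) h3
    rw [g.metric_eq_gram, ← ContinuousLinearMap.adjoint_inner_right, h1, h2]
  · change 0 < (g.symFrame i z).det
    have h : (g.symFrame i z).det = (invSqrtMatrix (g.gram i z)).det := by
      change LinearMap.det (Matrix.toLpLin 2 2 _) = _
      rw [Matrix.toLpLin_eq_toLin, LinearMap.det_toLin]
    rw [h]
    exact det_invSqrtMatrix_pos hG

variable (i) in
/-- The inverse of the equivariant frame. -/
noncomputable def symFrameInv (z : EucSpace n) : EucSpace n →L[ℝ] EucSpace n :=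
  Matrix.toEuclideanCLM (𝕜 := ℝ) (invSqrtMatrix (g.gram i z) * g.gram i z)

theorem symFrameInv_mul {z : EucSpace n} (hz : z ∈ (O.chart i).dom) :
    g.symFrameInv i z * g.symFrame i z = 1 := by
  rw [symFrame, symFrameInv, ← map_mul, invSqrtMatrix_mul_mul (g.gram_posDef hz), map_one]

theorem mul_symFrameInv {z : EucSpace n} (hz : z ∈ (O.chart i).dom) :
    g.symFrame i z * g.symFrameInv i z = 1 := by
  rw [symFrame, symFrameInv, ← map_mul,
    mul_eq_one_comm.1 (invSqrtMatrix_mul_mul (g.gram_posDef hz)), map_one]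

theorem continuousOn_gram : ContinuousOn (g.gram i) (O.chart i).dom := by
  refine continuousOn_pi.2 fun a => continuousOn_pi.2 fun b => ?_
  exact ((g.smooth i).continuousOn.clm_apply continuousOn_const).clm_apply continuousOn_const

theorem continuous_toEuclideanCLM : Continuous (Matrix.toEuclideanCLM (n := Fin n) (𝕜 := ℝ)) :=
  LinearMap.continuous_of_finiteDimensional
    (Matrix.toEuclideanCLM (n := Fin n) (𝕜 := ℝ)).toAlgEquiv.toLinearMap

theorem continuousOn_symFrame : ContinuousOn (g.symFrame i) (O.chart i).dom :=
  continuous_toEuclideanCLM.comp_continuousOn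
    (continuousOn_invSqrtMatrix g.continuousOn_gram fun _ hz => g.gram_posDef hz)

theorem continuousOn_symFrameInv : ContinuousOn (g.symFrameInv i) (O.chart i).dom :=
  continuous_toEuclideanCLM.comp_continuousOn
    ((continuousOn_invSqrtMatrix g.continuousOn_gram fun _ hz => g.gram_posDef hz).mul
      g.continuousOn_gram)

theorem symFrame_group {γ : EucSpace n ≃ₗᵢ[ℝ] EucSpace n} (hγ : γ ∈ (O.chart i).group)
    {z : EucSpace n} (hz : z ∈ (O.chart i).dom) :
    (γ.toContinuousLinearEquiv : EucSpace n →L[ℝ] EucSpace n).comp (g.symFrame i z) =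
      (g.symFrame i (γ z)).comp (γ.toContinuousLinearEquiv : EucSpace n →L[ℝ] EucSpace n) := by
  set T : EucSpace n →L[ℝ] EucSpace n :=
    (γ.toContinuousLinearEquiv : EucSpace n →L[ℝ] EucSpace n) with hT
  have hTT : star T * T = 1 := by
    ext1 v
    refine ext_inner_left ℝ fun w => ?_
    change inner ℝ w (ContinuousLinearMap.adjoint T (T v)) = inner ℝ w v
    rw [ContinuousLinearMap.adjoint_inner_right]
    exact γ.inner_map_map w v
  have hinj : Function.Injective (Matrix.toEuclideanCLM (n := Fin n) (𝕜 := ℝ)) :=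
    EquivLike.injective _
  set R : Matrix (Fin n) (Fin n) ℝ := (Matrix.toEuclideanCLM (n := Fin n) (𝕜 := ℝ)).symm T with hR
  have hRT : Matrix.toEuclideanCLM (n := Fin n) (𝕜 := ℝ) R = T :=
    (Matrix.toEuclideanCLM (n := Fin n) (𝕜 := ℝ)).apply_symm_apply T
  have hRR : star R * R = 1 := by
    apply hinj
    rw [map_mul, map_star, hRT, hTT, map_one]
  have hRR' : R * star R = 1 := mul_eq_one_comm.1 hRR
  let U : unitary (Matrix (Fin n) (Fin n) ℝ) := ⟨R, hRR, hRR'⟩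
  -- Invariance of the metric under `γ`, seen as a lift of the identity, in matrix form.
  have hG : star R * g.gram i (γ z) * R = g.gram i z := by
    apply hinj
    ext1 v
    refine ext_inner_left ℝ fun w => ?_
    rw [map_mul, map_mul, map_star, hRT, ← g.metric_eq_gram]
    change inner ℝ w (ContinuousLinearMap.adjoint T _) = _
    rw [ContinuousLinearMap.adjoint_inner_right]
    refine (g.metric_eq_gram i (γ z) (T w) (T v)).symm.trans ?_
    have h := g.invariant i i _ ((O.chart i).isTransitionLift_group hγ) z ⟨Set.mem_univ _, hz⟩ w v
    have hd : fderiv ℝ (γ.toHomeomorph.toOpenPartialHomeomorph.restrOpen (O.chart i).dom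
        (O.chart i).isOpen_dom) z = T := T.fderiv
    rw [hd] at h
    exact h
  have hG' : g.gram i (γ z) = U.1 * g.gram i z * star U.1 := by
    rw [← hG]
    change _ = R * (star R * g.gram i (γ z) * R) * star R
    rw [mul_assoc, mul_assoc, hRR', mul_one, ← mul_assoc, hRR', one_mul]
  change T * g.symFrame i z = g.symFrame i (γ z) * T
  rw [symFrame, symFrame, hG', invSqrtMatrix_conj (g.gram_posDef hz), ← hRT, ← map_mul, ← map_mul,
    mul_assoc, mul_assoc]
  change _ = Matrix.toEuclideanCLM (𝕜 := ℝ) (R * (invSqrtMatrix (g.gram i z) * (star R * R)))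
  rw [hRR, mul_one]

end OrbifoldMetric

/-! ### The frame bundle in terms of the equivariant frame -/

theorem det_eq_one_of_isometry {n : ℕ} (h : EucSpace n ≃ₗᵢ[ℝ] EucSpace n)
    (hp : 0 < LinearMap.det (h.toLinearEquiv : EucSpace n →ₗ[ℝ] EucSpace n)) :
    LinearMap.det (h.toLinearEquiv : EucSpace n →ₗ[ℝ] EucSpace n) = 1 := by
  rw [← abs_of_pos hp, ← LinearMap.normDet_eq_abs_det]
  exact LinearIsometry.normDet_eq_one h.toLinearIsometry

namespace OrbifoldMetric

variable {n : ℕ} {M : Type u} [TopologicalSpace M] {O : OrientedOrbifold n M}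
  (g : OrbifoldMetric O) {i : O.ι}

/-- The equivariant frame of a local smooth covering, as a frame of the orbifold. -/
noncomputable def symMk (z : (O.chart i).dom) : g.FrameBundle :=
  g.frameMk i ⟨(z.1, g.symFrame i z.1), g.symFrame_mem_frames z.2⟩

theorem base_symMk (z : (O.chart i).dom) : g.base (g.symMk z) = (O.chart i).proj z.1 := rfl

/-- Two oriented orthonormal frames at a point differ by a rotation. The explicit formula for it is
kept because continuity in the frame is read off from it. -/
theorem exists_rotateFrame_eq (f : g.frames i) : ∃ h : SpecialOrthogonal n,
    (h.1.toContinuousLinearEquiv : EucSpace n →L[ℝ] EucSpace n) =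
      g.symFrameInv i f.1.1 * f.1.2 ∧
    g.rotateFrame i ⟨(f.1.1, g.symFrame i f.1.1), g.symFrame_mem_frames f.2.1⟩ h = f := by
  set T := g.symFrameInv i f.1.1 * f.1.2 with hT
  have hST : (g.symFrame i f.1.1).comp T = f.1.2 := by
    change g.symFrame i f.1.1 * T = f.1.2
    rw [hT, ← mul_assoc, g.mul_symFrameInv f.2.1, one_mul]
  have hnorm : ∀ v, ‖T v‖ = ‖v‖ := by
    intro v
    have h1 := (g.symFrame_mem_frames f.2.1).2.1 (T v) (T v)
    have h2 : g.symFrame i f.1.1 (T v) = f.1.2 v := congrArg (fun k => k v) hST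
    rw [h2] at h1
    have h3 := h1.symm.trans (f.2.2.1 v v)
    rw [real_inner_self_eq_norm_sq, real_inner_self_eq_norm_sq] at h3
    exact (sq_eq_sq₀ (norm_nonneg _) (norm_nonneg _)).1 h3
  let h : EucSpace n ≃ₗᵢ[ℝ] EucSpace n :=
    LinearIsometry.toLinearIsometryEquiv ⟨T.toLinearMap, hnorm⟩ rfl
  have hh : (h.toContinuousLinearEquiv : EucSpace n →L[ℝ] EucSpace n) = T := rfl
  refine ⟨⟨h, det_eq_one_of_isometry h ?_⟩, hh, ?_⟩
  · have h1 : f.1.2.det = (g.symFrame i f.1.1).det *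
        LinearMap.det (h.toLinearEquiv : EucSpace n →ₗ[ℝ] EucSpace n) := by
      rw [← hST]
      exact LinearMap.det_comp _ _
    have h2 := f.2.2.2
    rw [h1] at h2
    exact pos_of_mul_pos_right h2 (g.symFrame_mem_frames f.2.1).2.2.le
  · exact Subtype.ext (Prod.ext rfl hST)

theorem exists_rotate_symMk_eq (z : (O.chart i).dom) {f : g.FrameBundle}
    (hf : g.base f = (O.chart i).proj z.1) :
    ∃ h : SpecialOrthogonal n, g.rotate (g.symMk z) h = f := by
  obtain ⟨z, hz⟩ := z
  obtain ⟨f', rfl, rfl⟩ := g.exists_frameMk_eq hz hf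
  obtain ⟨h, -, hh⟩ := g.exists_rotateFrame_eq f'
  exact ⟨h, congrArg (g.frameMk i) hh⟩

/-- By equivariance of the symmetric frame, the differential of `γ` acts on the rotation component
simply by left multiplication by `γ`. -/
theorem rotate_symMk_eq_iff {z w : (O.chart i).dom} {h k : SpecialOrthogonal n} :
    g.rotate (g.symMk z) h = g.rotate (g.symMk w) k ↔
      ∃ γ ∈ (O.chart i).group, γ z.1 = w.1 ∧ γ * h.1 = k.1 := by
  rw [symMk, symMk, rotate_frameMk, rotate_frameMk, frameMk_eq_iff_group]
  refine exists_congr fun γ => and_congr_right fun hγ => and_congr_right fun hzw => ?_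
  change (γ.toContinuousLinearEquiv : EucSpace n →L[ℝ] EucSpace n).comp
      ((g.symFrame i z.1).comp (h.1.toContinuousLinearEquiv : EucSpace n →L[ℝ] EucSpace n)) =
      (g.symFrame i w.1).comp (k.1.toContinuousLinearEquiv : EucSpace n →L[ℝ] EucSpace n) ↔ _
  have hzw' : γ z.1 = w.1 := hzw
  rw [← ContinuousLinearMap.comp_assoc, g.symFrame_group hγ z.2, hzw',
    ContinuousLinearMap.comp_assoc]
  constructor
  · intro H
    ext1 v
    have h1 := congrArg (fun f => g.symFrameInv i w.1 (f v)) H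
    have h2 : ∀ v, g.symFrameInv i w.1 (g.symFrame i w.1 v) = v := fun v =>
      congrArg (fun f => f v) (g.symFrameInv_mul w.2)
    simp only [ContinuousLinearMap.comp_apply, h2] at h1
    exact h1
  · intro H
    congr 1
    rw [← H]
    rfl

end OrbifoldMetric

namespace OrbifoldMetric

variable {M : Type u} [TopologicalSpace M] {O : OrientedOrbifold 4 M}
  (g : OrbifoldMetric O) {i : O.ι}

/-- The parametrization of the frame bundle by the equivariant frame and the spin group. -/
noncomputable def spinFrame (q : (O.chart i).dom × Spin4) : g.FrameBundle :=
  g.rotate (g.symMk q.1) q.2.rotation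

theorem base_spinFrame (q : (O.chart i).dom × Spin4) :
    g.base (g.spinFrame q) = (O.chart i).proj q.1.1 := by
  rw [spinFrame, base_rotate, base_symMk]

theorem spinFrame_mul (z : (O.chart i).dom) (a b : Spin4) :
    g.spinFrame (z, a * b) = g.rotate (g.spinFrame (z, a)) b.rotation := by
  rw [spinFrame, Spin4.rotation_mul, rotate_mul]
  rfl

theorem exists_spinFrame_eq (z : (O.chart i).dom) {f : g.FrameBundle}
    (hf : g.base f = (O.chart i).proj z.1) : ∃ a : Spin4, g.spinFrame (z, a) = f := by
  obtain ⟨h, hh⟩ := g.exists_rotate_symMk_eq z hf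
  obtain ⟨a, rfl⟩ := Spin4.rotation_surjective h
  exact ⟨a, hh⟩

theorem spinFrame_eq_iff {p q : (O.chart i).dom × Spin4} :
    g.spinFrame p = g.spinFrame q ↔ ∃ γ ∈ (O.chart i).group, γ p.1.1 = q.1.1 ∧
      γ * p.2.rotation.1 = q.2.rotation.1 := by
  rw [spinFrame, spinFrame, rotate_symMk_eq_iff]

theorem continuous_spinFrame : Continuous (g.spinFrame (i := i)) := by
  have h1 : Continuous fun q : (O.chart i).dom × Spin4 =>
      (q.1.1, (g.symFrame i q.1.1).comp (rotCLM q.2.rotation)) := by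
    refine (continuous_subtype_val.comp continuous_fst).prodMk ?_
    exact ((continuousOn_iff_continuous_domRestrict.1 g.continuousOn_symFrame).comp
      continuous_fst).clm_comp (Spin4.continuous_rotCLM.comp continuous_snd)
  exact (g.continuous_frameMk i).comp (h1.subtype_mk fun q =>
    (g.rotateFrame i ⟨_, g.symFrame_mem_frames q.1.2⟩ q.2.rotation).2)

/-- It is enough to have, for each point of the source, a right inverse of the frame map which is
continuous at its image. The rotation relative to the one under `a₀` is near 1, and the section of
the spin covering is continuous there. -/
theorem isOpenMap_spinFrame : IsOpenMap (g.spinFrame (i := i)) := by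
  let φ : (O.chart i).dom × Spin4 → g.frames i := fun q =>
    g.rotateFrame i ⟨_, g.symFrame_mem_frames q.1.2⟩ q.2.rotation
  suffices hφ : IsOpenMap φ from (g.isOpenMap_frameMk i).comp hφ
  rw [isOpenMap_iff_nhds_le]
  rintro ⟨z₀, a₀⟩
  obtain ⟨s, hs, hs1, hst⟩ := Spin4.exists_section
  choose k hk1 hk2 using g.exists_rotateFrame_eq (i := i)
  let ψ : g.frames i → (O.chart i).dom × Spin4 := fun f =>
    (⟨f.1.1, f.2.1⟩, s (k f * a₀.rotation⁻¹) * a₀)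
  have h1 : ∀ f, φ (ψ f) = f := by
    intro f
    refine Eq.trans ?_ (hk2 f)
    change g.rotateFrame i _ (s (k f * a₀.rotation⁻¹) * a₀).rotation = _
    rw [Spin4.rotation_mul, hs, inv_mul_cancel_right]
  have h2 : k (φ (z₀, a₀)) = a₀.rotation := by
    refine Subtype.ext (LinearIsometryEquiv.ext fun v => ?_)
    have h3 := congrArg (fun f => f v) (hk1 (φ (z₀, a₀)))
    refine h3.trans ?_
    exact congrArg (fun f => f (a₀.rotation.1 v)) (g.symFrameInv_mul z₀.2)
  have h3 : Filter.Tendsto ψ (𝓝 (φ (z₀, a₀))) (𝓝 (z₀, a₀)) := by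
    refine Filter.Tendsto.prodMk_nhds ?_ ?_
    · have : Continuous fun f : g.frames i => (⟨f.1.1, f.2.1⟩ : (O.chart i).dom) :=
        (continuous_fst.comp continuous_subtype_val).subtype_mk _
      exact this.tendsto (φ (z₀, a₀))
    · have h4 : Continuous fun f : g.frames i => rotCLM (k f * a₀.rotation⁻¹) := by
        have h5 : ∀ f : g.frames i, rotCLM (k f * a₀.rotation⁻¹) =
            ((g.symFrameInv i f.1.1).comp f.1.2).comp (rotCLM a₀.rotation⁻¹) := by
          intro f
          have : (g.symFrameInv i f.1.1).comp f.1.2 = rotCLM (k f) := (hk1 f).symm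
          rw [this]
          rfl
        simp only [h5]
        have h6 : Continuous fun f : g.frames i => g.symFrameInv i f.1.1 :=
          g.continuousOn_symFrameInv.comp_continuous
            (continuous_fst.comp continuous_subtype_val) fun f => f.2.1
        exact (h6.clm_comp (continuous_snd.comp continuous_subtype_val)).clm_comp continuous_const
      have h7 := h4.tendsto (φ (z₀, a₀))
      rw [h2, mul_inv_cancel] at h7
      have h8 := (hst h7).mul_const a₀
      rwa [one_mul] at h8
  calc 𝓝 (φ (z₀, a₀)) = Filter.map (φ ∘ ψ) (𝓝 (φ (z₀, a₀))) := by
        rw [show φ ∘ ψ = id from funext h1, Filter.map_id]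
    _ ≤ Filter.map φ (𝓝 (z₀, a₀)) := by
        rw [← Filter.map_map]
        exact Filter.map_mono h3

end OrbifoldMetric

/-! ### Complex structures and invariant spinors -/

/-- Real coordinates which turn `J` into multiplication by `i` are complex linear for the module
structure of `J`, so they compute the complex determinant. -/
theorem complexDet_eq_det {V : Type*} [AddCommGroup V] [Module ℝ V] {J T : Module.End ℝ V}
    (hJ : J * J = -1) (hT : T * J = J * T) (L : V ≃ₗ[ℝ] (Fin 2 → ℂ))
    (A : Matrix (Fin 2) (Fin 2) ℂ) (hLJ : ∀ v, L (J v) = Complex.I • L v)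
    (hLT : ∀ v, L (T v) = A.mulVec (L v)) : complexDet J hJ T hT = A.det := by
  let := complexModule J hJ
  let L' : V ≃ₗ[ℂ] (Fin 2 → ℂ) :=
    { L with
      map_smul' := by
        intro z v
        change L ((Complex.lift ⟨J, hJ⟩ : ℂ →ₐ[ℝ] Module.End ℝ V) z v) = z • L v
        have h : (Complex.lift ⟨J, hJ⟩ : ℂ →ₐ[ℝ] Module.End ℝ V) z v = z.re • v + z.im • J v := by
          simp [Complex.liftAux_apply, Algebra.algebraMap_eq_smul_one]
        rw [h, map_add, map_smul, map_smul, hLJ]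
        conv_rhs => rw [← Complex.re_add_im z]
        rw [add_smul, mul_smul]
        rfl }
  rw [complexDet, ← LinearMap.det_conj _ L', ← LinearMap.det_toLin' A]
  congr 1
  refine LinearMap.ext fun v => ?_
  have h := hLT (L'.symm v)
  rw [Matrix.toLin'_apply]
  refine h.trans ?_
  congr 1
  exact L'.apply_symm_apply v

/-- Left multiplication of quaternions by `i`. -/
def quatLeftI : Module.End ℝ (EucSpace 4) where
  toFun v := !₂[-v 1, v 0, -v 3, v 2]
  map_add' v w := by ext i; fin_cases i <;> simp [add_comm]
  map_smul' r v := by ext i; fin_cases i <;> simp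

/-- Right multiplication of quaternions by `i`. -/
def quatRightI : Module.End ℝ (EucSpace 4) where
  toFun v := !₂[-v 1, v 0, v 3, -v 2]
  map_add' v w := by ext i; fin_cases i <;> simp [add_comm]
  map_smul' r v := by ext i; fin_cases i <;> simp

theorem quatLeftI_sq : quatLeftI * quatLeftI = -1 := by
  refine LinearMap.ext fun v => ?_
  ext i; fin_cases i <;> simp [quatLeftI]

theorem quatRightI_sq : quatRightI * quatRightI = -1 := by
  refine LinearMap.ext fun v => ?_
  ext i; fin_cases i <;> simp [quatRightI]

theorem inner_quatLeftI (v w : EucSpace 4) :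
    inner ℝ (quatLeftI v) (quatLeftI w) = inner ℝ v w := by
  simp [quatLeftI, PiLp.inner_apply, Fin.sum_univ_four]
  ring

theorem inner_quatRightI (v w : EucSpace 4) :
    inner ℝ (quatRightI v) (quatRightI w) = inner ℝ v w := by
  simp [quatRightI, PiLp.inner_apply, Fin.sum_univ_four]
  ring

theorem quatMatrix_quatLeftI (v : EucSpace 4) :
    quatMatrix (quatLeftI v) = !![Complex.I, 0; 0, -Complex.I] * quatMatrix v := by
  apply quatMatrix_eq_of_re_im <;>
    simp [quatMatrix, quatLeftI, Matrix.mul_apply, Fin.sum_univ_two, Complex.ext_iff]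

theorem quatMatrix_quatRightI (v : EucSpace 4) :
    quatMatrix (quatRightI v) = quatMatrix v * !![Complex.I, 0; 0, -Complex.I] := by
  apply quatMatrix_eq_of_re_im <;>
    simp [quatMatrix, quatRightI, Matrix.mul_apply, Fin.sum_univ_two, Complex.ext_iff]

/-- The first row of a quaternionic matrix, as complex coordinates on `ℝ⁴`. -/
noncomputable def quatRow : EucSpace 4 ≃ₗ[ℝ] (Fin 2 → ℂ) where
  toFun v := quatMatrix v 0
  map_add' v w := by ext j; fin_cases j <;> simp [quatMatrix] <;> ring
  map_smul' r v := by ext j; fin_cases j <;> simp [quatMatrix] <;> ring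
  invFun u := !₂[(u 0).re, (u 0).im, (u 1).re, (u 1).im]
  left_inv v := by ext i; fin_cases i <;> simp [quatMatrix]
  right_inv u := by ext j; fin_cases j <;> simp [quatMatrix]

/-- The first column of a quaternionic matrix, as complex coordinates on `ℝ⁴`. -/
noncomputable def quatCol : EucSpace 4 ≃ₗ[ℝ] (Fin 2 → ℂ) where
  toFun v := fun j => quatMatrix v j 0
  map_add' v w := by ext j; fin_cases j <;> simp [quatMatrix] <;> ring
  map_smul' r v := by ext j; fin_cases j <;> simp [quatMatrix] <;> ring
  invFun u := !₂[(u 0).re, (u 0).im, -(u 1).re, (u 1).im]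
  left_inv v := by ext i; fin_cases i <;> simp [quatMatrix]
  right_inv u := by ext j; fin_cases j <;> simp [quatMatrix]

theorem quatRow_quatLeftI (v : EucSpace 4) : quatRow (quatLeftI v) = Complex.I • quatRow v := by
  change quatMatrix _ 0 = Complex.I • quatMatrix v 0
  rw [quatMatrix_quatLeftI]
  ext j
  simp [Matrix.mul_apply, Fin.sum_univ_two]

theorem quatCol_quatRightI (v : EucSpace 4) :
    quatCol (quatRightI v) = Complex.I • quatCol v := by
  change (fun j => quatMatrix _ j 0) = Complex.I • fun j => quatMatrix v j 0
  rw [quatMatrix_quatRightI]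
  ext j
  simp [Matrix.mul_apply, Fin.sum_univ_two, mul_comm]

/-- Some non-zero spinor is fixed by suitable lifts of all elements of a set of isometries. -/
def HasFixedSpinor (Γ : Set (EucSpace 4 ≃ₗᵢ[ℝ] EucSpace 4)) : Prop :=
  ∃ v : Spinor, v ≠ 0 ∧ ∀ γ ∈ Γ, ∃ a : Spin4, a.rotation.1 = γ ∧ cliffordAct (a : Cl4) v = v

theorem Spinor.fstPart_ne_or_sndPart_ne {v : Spinor} (hv : v ≠ 0) :
    Spinor.fstPart v ≠ 0 ∨ Spinor.sndPart v ≠ 0 := by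
  by_contra! h
  exact hv (Spinor.ext_iff_parts.2 h)

section Criterion

variable {b : EucSpace 4 → EucSpace 4 → ℝ} {e : EucSpace 4 ≃ₗ[ℝ] EucSpace 4}
  {Γ : Set (EucSpace 4 ≃ₗᵢ[ℝ] EucSpace 4)}

/-- The map `e` is meant to be the symmetric frame at the point: it turns the Euclidean product into
the metric and commutes with the isotropy group. The complex structure `J₀` is transported by `e`.
-/
theorem isContainedInSU_of_coordinates (hb : ∀ v w, b (e v) (e w) = inner ℝ v w)
    (he : ∀ γ ∈ Γ, ∀ v, γ (e v) = e (γ v)) {J₀ : Module.End ℝ (EucSpace 4)}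
    (hJ₀ : J₀ * J₀ = -1) (hin : ∀ v w, inner ℝ (J₀ v) (J₀ w) = inner ℝ v w)
    (L : EucSpace 4 ≃ₗ[ℝ] (Fin 2 → ℂ)) (hL : ∀ v, L (J₀ v) = Complex.I • L v)
    (hΓ : ∀ γ ∈ Γ, ∃ A : Matrix (Fin 2) (Fin 2) ℂ, A.det = 1 ∧ ∀ v, L (γ v) = A.mulVec (L v)) :
    ∃ J : Module.End ℝ (EucSpace 4), IsContainedInSU b J
      {T | ∃ γ ∈ Γ, T = (γ.toLinearEquiv : EucSpace 4 →ₗ[ℝ] EucSpace 4)} := by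
  have hb' : ∀ v w, b v w = inner ℝ (e.symm v) (e.symm w) := by
    intro v w
    rw [← hb, e.apply_symm_apply, e.apply_symm_apply]
  have hJJ : ∀ v, J₀ (J₀ v) = -v := fun v => LinearMap.congr_fun hJ₀ v
  let J : Module.End ℝ (EucSpace 4) :=
    (e : EucSpace 4 →ₗ[ℝ] EucSpace 4) ∘ₗ J₀ ∘ₗ (e.symm : EucSpace 4 →ₗ[ℝ] EucSpace 4)
  have hJ : ∀ v, J v = e (J₀ (e.symm v)) := fun v => rfl
  refine ⟨J, fun v w => ?_, ?_, ?_⟩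
  · rw [hb', hb', hJ, hJ, e.symm_apply_apply, e.symm_apply_apply, hin]
  · refine LinearMap.ext fun v => ?_
    change J (J v) = -v
    rw [hJ, hJ, e.symm_apply_apply, hJJ, map_neg, e.apply_symm_apply]
  · rintro _ ⟨γ, hγ, rfl⟩
    obtain ⟨A, hA, hLA⟩ := hΓ γ hγ
    have he' : ∀ v, e.symm (γ v) = γ (e.symm v) := by
      intro v
      rw [LinearEquiv.symm_apply_eq, ← he γ hγ, e.apply_symm_apply]
    -- In the coordinates `L` the isometry is a complex matrix, so it commutes with `i`.
    have hcomm : ∀ v, γ (J₀ v) = J₀ (γ v) := by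
      intro v
      apply L.injective
      rw [hLA, hL, hL, hLA, Matrix.mulVec_smul]
    refine ⟨fun v w => ?_, ?_, ?_⟩
    · change b (γ v) (γ w) = b v w
      rw [hb', hb', he', he', γ.inner_map_map]
    · refine LinearMap.ext fun v => ?_
      change γ (J v) = J (γ v)
      rw [hJ, hJ, he γ hγ, he', hcomm]
    · rw [← hA]
      refine complexDet_eq_det _ _ (e.symm.trans L) A (fun v => ?_) (fun v => ?_)
      · rw [LinearEquiv.trans_apply, LinearEquiv.trans_apply, hJ, e.symm_apply_apply, hL]
      · change L (e.symm (γ v)) = A.mulVec (L (e.symm v))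
        rw [he', hLA]

/-- If the first component of the spinor is non-zero, the lifts have `fst = 1` and the group acts by
left multiplication by `snd` in SU(2). This commutes with right multiplication by `i` and acts
linearly on the first column. The other case exchanges left and right, columns and rows. -/
theorem HasFixedSpinor.exists_isContainedInSU (hb : ∀ v w, b (e v) (e w) = inner ℝ v w)
    (he : ∀ γ ∈ Γ, ∀ v, γ (e v) = e (γ v)) (h : HasFixedSpinor Γ) :
    ∃ J : Module.End ℝ (EucSpace 4), IsContainedInSU b J
      {T | ∃ γ ∈ Γ, T = (γ.toLinearEquiv : EucSpace 4 →ₗ[ℝ] EucSpace 4)} := by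
  obtain ⟨v, hv, hΓ⟩ := h
  rcases Spinor.fstPart_ne_or_sndPart_ne hv with h1 | h1
  · refine isContainedInSU_of_coordinates hb he quatRightI_sq inner_quatRightI quatCol
      quatCol_quatRightI fun γ hγ => ?_
    obtain ⟨a, rfl, ha⟩ := hΓ γ hγ
    refine ⟨a.snd, a.det_snd, fun w => ?_⟩
    change (fun j => quatMatrix _ j 0) = a.snd.mulVec fun j => quatMatrix w j 0
    rw [a.quatMatrix_rotation, Spin4.fst_eq_one_of_fixed h1 ha, Matrix.conjTranspose_one, mul_one]
    rfl
  · refine isContainedInSU_of_coordinates hb he quatLeftI_sq inner_quatLeftI quatRow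
      quatRow_quatLeftI fun γ hγ => ?_
    obtain ⟨a, rfl, ha⟩ := hΓ γ hγ
    refine ⟨(a.fst.conjTranspose).transpose, ?_, fun w => ?_⟩
    · rw [Matrix.det_transpose, ← a.fst_inv, Spin4.det_fst]
    · change quatMatrix _ 0 = (a.fst.conjTranspose).transpose.mulVec (quatMatrix w 0)
      rw [a.quatMatrix_rotation, Spin4.snd_eq_one_of_fixed h1 ha, one_mul,
        Matrix.mulVec_transpose]
      rfl

end Criterion

/-! ### Normal forms of orthogonal complex structures -/

section NormalForm

variable {J : Module.End ℝ (EucSpace 4)}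

theorem exists_unit_orthogonal_pair (u v : EucSpace 4) :
    ∃ w : EucSpace 4, inner ℝ w w = (1 : ℝ) ∧ inner ℝ u w = (0 : ℝ) ∧ inner ℝ v w = (0 : ℝ) := by
  classical
  have h1 : (Submodule.span ℝ ({u, v} : Set (EucSpace 4)))ᗮ ≠ ⊥ := by
    intro h
    rw [Submodule.orthogonal_eq_bot_iff] at h
    have h2 : Module.finrank ℝ (Submodule.span ℝ (({u, v} : Finset (EucSpace 4)) :
        Set (EucSpace 4))) ≤ _ := finrank_span_finset_le_card _
    rw [Finset.coe_pair, h, finrank_top, finrank_euclideanSpace_fin] at h2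
    exact absurd (h2.trans Finset.card_le_two) (by norm_num)
  obtain ⟨w, hw, hw0⟩ := Submodule.exists_mem_ne_zero_of_ne_bot h1
  rw [Submodule.mem_orthogonal] at hw
  have hn : ‖w‖ ≠ 0 := norm_ne_zero_iff.2 hw0
  refine ⟨‖w‖⁻¹ • w, ?_, ?_, ?_⟩
  · rw [real_inner_self_eq_norm_sq, norm_smul, norm_inv, norm_norm, inv_mul_cancel₀ hn, one_pow]
  · rw [inner_smul_right, hw u (Submodule.subset_span (by simp)), mul_zero]
  · rw [inner_smul_right, hw v (Submodule.subset_span (by simp)), mul_zero]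

/-- The isometry sends the standard basis to an orthonormal basis `u`, `J u`, `w`, `J w`, with `w` a
unit vector orthogonal to `u` and `J u`. -/
theorem exists_isometry_quatLeftI (hJ : J * J = -1)
    (hin : ∀ v w, inner ℝ (J v) (J w) = (inner ℝ v w : ℝ)) :
    ∃ k : EucSpace 4 ≃ₗᵢ[ℝ] EucSpace 4, ∀ v, J (k v) = k (quatLeftI v) := by
  have hJJ : ∀ v, J (J v) = -v := fun v => LinearMap.congr_fun hJ v
  have hs : ∀ v w, inner ℝ v (J w) = (-inner ℝ (J v) w : ℝ) := by
    intro v w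
    rw [← hin (J v) w, hJJ, inner_neg_left, neg_neg]
  have h0 : ∀ v, inner ℝ v (J v) = (0 : ℝ) := by
    intro v
    have h := hs v v
    rw [real_inner_comm] at h
    have h' := real_inner_comm v (J v)
    linarith
  obtain ⟨u, huu, -, -⟩ := exists_unit_orthogonal_pair 0 0
  obtain ⟨w, hww, huw, hJw⟩ := exists_unit_orthogonal_pair u (J u)
  have huJ : inner ℝ u (J w) = (0 : ℝ) := by rw [hs, hJw, neg_zero]
  have e0 := h0 u
  have e1 := h0 w
  have e2 := hin u u
  have e3 := hin w w
  have e4 := hin u w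
  let K : EucSpace 4 →ₗ[ℝ] EucSpace 4 :=
    { toFun := fun v => v 0 • u + v 1 • J u + v 2 • w + v 3 • J w
      map_add' := by
        intro v v'
        simp only [PiLp.add_apply, add_smul]
        abel
      map_smul' := by
        intro r v
        simp only [PiLp.smul_apply, smul_eq_mul, mul_smul, smul_add, RingHom.id_apply] }
  have hK : ∀ v, K v = v 0 • u + v 1 • J u + v 2 • w + v 3 • J w := fun v => rfl
  have hKin : ∀ v v', inner ℝ (K v) (K v') = (inner ℝ v v' : ℝ) := by
    intro v v'
    have c1 := real_inner_comm u (J u)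
    have c2 := real_inner_comm u w
    have c3 := real_inner_comm u (J w)
    have c4 := real_inner_comm (J u) w
    have c5 := real_inner_comm (J u) (J w)
    have c6 := real_inner_comm w (J w)
    rw [hK, hK]
    simp only [inner_add_left, inner_add_right, inner_smul_left, inner_smul_right, c1, c2, c3, c4,
      c5, c6, e0, e1, e2, e3, e4, huu, hww, huw, hJw, huJ, PiLp.inner_apply, Fin.sum_univ_four,
      RCLike.inner_apply, conj_trivial]
    ring
  let k := (K.isometryOfInner hKin).toLinearIsometryEquiv rfl
  refine ⟨k, fun v => ?_⟩
  have hk : ∀ v, k v = K v := fun v => rfl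
  rw [hk, hk, hK, hK]
  simp only [map_add, map_smul, hJJ, quatLeftI, LinearMap.coe_mk, AddHom.coe_mk,
    PiLp.toLp_apply, Matrix.cons_val]
  module

/-- An orientation-reversing isometry is corrected by the reflection of the last coordinate, which
exchanges left and right multiplication by `i`. Thus the orientation of `J` decides which
alternative occurs. -/
theorem exists_isometry_det_one (hJ : J * J = -1)
    (hin : ∀ v w, inner ℝ (J v) (J w) = (inner ℝ v w : ℝ)) :
    ∃ κ : Spin4, (∀ v, J (κ.rotation.1 v) = κ.rotation.1 (quatLeftI v)) ∨
      (∀ v, J (κ.rotation.1 v) = κ.rotation.1 (quatRightI v)) := by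
  obtain ⟨k, hk⟩ := exists_isometry_quatLeftI hJ hin
  have hunit : LinearMap.det (k.toLinearEquiv : EucSpace 4 →ₗ[ℝ] EucSpace 4) ≠ 0 :=
    (LinearEquiv.isUnit_det' k.toLinearEquiv).ne_zero
  rcases hunit.lt_or_gt with hd | hd
  · set e : EucSpace 4 := EuclideanSpace.single 3 1 with he
    have hne : e ≠ 0 := by simp [he]
    have h2 : ((k * (ℝ ∙ e)ᗮ.reflection).toLinearEquiv : EucSpace 4 →ₗ[ℝ] EucSpace 4) =
        (k.toLinearEquiv : EucSpace 4 →ₗ[ℝ] EucSpace 4) ∘ₗ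
          ((ℝ ∙ e)ᗮ.reflection.toLinearEquiv : EucSpace 4 →ₗ[ℝ] EucSpace 4) := rfl
    have h3 : LinearMap.det ((ℝ ∙ e)ᗮ.reflection.toLinearEquiv :
        EucSpace 4 →ₗ[ℝ] EucSpace 4) = -1 := by
      refine (Submodule.det_reflection (ℝ ∙ e)ᗮ).trans ?_
      rw [Submodule.orthogonal_orthogonal, finrank_span_singleton hne, pow_one]
    have hr : ∀ v : EucSpace 4, (ℝ ∙ e)ᗮ.reflection v = !₂[v 0, v 1, v 2, -v 3] := by
      intro v
      rw [Submodule.reflection_orthogonal_apply, Submodule.reflection_singleton_apply]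
      ext i
      fin_cases i <;> simp [he, EuclideanSpace.inner_single_left]
      ring
    have hdet := det_eq_one_of_isometry (k * (ℝ ∙ e)ᗮ.reflection) (by
      rw [h2, LinearMap.det_comp, h3]
      linarith)
    obtain ⟨κ, hκ⟩ := Spin4.rotation_surjective ⟨k * (ℝ ∙ e)ᗮ.reflection, hdet⟩
    refine ⟨κ, Or.inr fun v => ?_⟩
    rw [hκ]
    change J (k ((ℝ ∙ e)ᗮ.reflection v)) = k ((ℝ ∙ e)ᗮ.reflection (quatRightI v))
    rw [hk, hr, hr]
    congr 1
    ext i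
    fin_cases i <;> simp [quatLeftI, quatRightI]
  · obtain ⟨κ, hκ⟩ := Spin4.rotation_surjective ⟨k, det_eq_one_of_isometry k hd⟩
    exact ⟨κ, Or.inl fun v => by rw [hκ]; exact hk v⟩

end NormalForm

theorem IsQuaternionic.eq_one_or_of_offdiag {m : Matrix (Fin 2) (Fin 2) ℂ} (hm : IsQuaternionic m)
    (h : m 0 1 = 0) (h1 : m 0 0 ^ 2 = 1) : m = 1 ∨ m = -1 := by
  have h10 : m 1 0 = 0 := by rw [hm.2, h, star_zero, neg_zero]
  rcases (sq_eq_sq_iff_eq_or_eq_neg.1 (h1.trans (one_pow 2).symm)) with h00 | h00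
  · left
    ext i j
    fin_cases i <;> fin_cases j <;> simp [h00, h, h10, hm.1]
  · right
    ext i j
    fin_cases i <;> fin_cases j <;> simp [h00, h, h10, hm.1]

namespace Spin4

variable {a : Spin4}

/-- Evaluating at the quaternion 1 and cancelling `fst` shows that `snd` commutes with `i`. -/
theorem snd_offdiag_of_commute
    (h : ∀ v, a.rotation.1 (quatLeftI v) = quatLeftI (a.rotation.1 v)) : a.snd 0 1 = 0 := by
  have h1 := congrArg quatMatrix (h (EuclideanSpace.single 0 1))
  rw [quatMatrix_quatLeftI, quatMatrix_rotation, quatMatrix_rotation, quatMatrix_quatLeftI,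
    quatMatrix_e0, mul_one, one_mul] at h1
  have h2 := congrArg (· * a.fst) h1
  simp only [mul_assoc, star_fst_mul, mul_one] at h2
  have h3 := congrFun (congrFun h2 0) 1
  simp [Matrix.mul_apply, Fin.sum_univ_two] at h3
  have h4 : (2 * Complex.I) * a.snd 0 1 = 0 := by linear_combination -h3
  simpa using h4

theorem fst_offdiag_of_commute
    (h : ∀ v, a.rotation.1 (quatRightI v) = quatRightI (a.rotation.1 v)) : a.fst 0 1 = 0 := by
  have h1 := congrArg quatMatrix (h (EuclideanSpace.single 0 1))
  rw [quatMatrix_quatRightI, quatMatrix_rotation, quatMatrix_rotation, quatMatrix_quatRightI,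
    quatMatrix_e0, one_mul, one_mul] at h1
  have h2 := congrArg (a.snd.conjTranspose * ·) h1
  simp only [← mul_assoc, star_snd_mul, one_mul] at h2
  have h3 := congrFun (congrFun h2 1) 0
  simp [Matrix.mul_apply, Fin.sum_univ_two] at h3
  have h4 : (2 * Complex.I) * star (a.fst 0 1) = 0 := by
    simp only [RCLike.star_def]
    linear_combination -h3
  simpa using h4

/-- Since `fst` has determinant 1, the complex determinant of the rotation is `snd 0 0 ^ 2`; setting
it to 1 makes `snd` equal to ±1. -/
theorem quatRow_rotation (h : a.snd 0 1 = 0) (v : EucSpace 4) :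
    quatRow (a.rotation.1 v) =
      (a.snd 0 0 • a.fst.conjTranspose.transpose).mulVec (quatRow v) := by
  change quatMatrix _ 0 = Matrix.mulVec _ (quatMatrix v 0)
  rw [quatMatrix_rotation]
  ext j
  simp [Matrix.mul_apply, Matrix.mulVec, dotProduct, Fin.sum_univ_two, h]
  ring

theorem quatCol_rotation (h : a.fst 0 1 = 0) (v : EucSpace 4) :
    quatCol (a.rotation.1 v) =
      (star (a.fst 0 0) • a.snd).mulVec (quatCol v) := by
  change (fun j => quatMatrix _ j 0) = Matrix.mulVec _ (fun j => quatMatrix v j 0)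
  rw [quatMatrix_rotation]
  ext j
  simp [Matrix.mul_apply, Matrix.mulVec, dotProduct, Fin.sum_univ_two, h]
  ring

theorem exists_fixing_of_snd (h : a.snd = 1 ∨ a.snd = -1) : ∃ b : Spin4,
    b.rotation = a.rotation ∧ b.snd = 1 := by
  rcases h with h | h
  · exact ⟨a, rfl, h⟩
  · refine ⟨minusOne * a, by rw [rotation_mul, rotation_minusOne, one_mul], ?_⟩
    rw [snd_mul, snd_minusOne, h, neg_one_mul, neg_neg]

theorem exists_fixing_of_fst (h : a.fst = 1 ∨ a.fst = -1) : ∃ b : Spin4,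
    b.rotation = a.rotation ∧ b.fst = 1 := by
  rcases h with h | h
  · exact ⟨a, rfl, h⟩
  · refine ⟨minusOne * a, by rw [rotation_mul, rotation_minusOne, one_mul], ?_⟩
    rw [fst_mul, fst_minusOne, h, neg_one_mul, neg_neg]

theorem cliffordAct_mul (a b : Spin4) (v : Spinor) :
    cliffordAct ((a * b : Spin4) : Cl4) v = cliffordAct (a : Cl4) (cliffordAct (b : Cl4) v) := by
  change (cliffordRep ((a : Cl4) * (b : Cl4))).mulVec v = _
  rw [map_mul, ← Matrix.mulVec_mulVec]
  rfl

theorem cliffordAct_one (v : Spinor) : cliffordAct ((1 : Spin4) : Cl4) v = v := by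
  rw [cliffordAct, cliffordRep_one, Matrix.one_mulVec]

theorem cliffordAct_inv_self (a : Spin4) (v : Spinor) :
    cliffordAct ((a⁻¹ : Spin4) : Cl4) (cliffordAct (a : Cl4) v) = v := by
  rw [← cliffordAct_mul, inv_mul_cancel, cliffordAct_one]

end Spin4

/-- Fixed spinors may be sought after conjugation by a rotation. -/
theorem HasFixedSpinor.of_conj {Γ : Set (EucSpace 4 ≃ₗᵢ[ℝ] EucSpace 4)}
    (κ : Spin4) {v : Spinor} (hv : v ≠ 0)
    (h : ∀ a : Spin4, a.rotation.1 ∈ Γ → ∃ b : Spin4, b.rotation = (κ⁻¹ * a * κ).rotation ∧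
      cliffordAct (b : Cl4) v = v) (hΓ : ∀ γ ∈ Γ, γ ∈ SpecialOrthogonal 4) :
    HasFixedSpinor Γ := by
  refine ⟨cliffordAct (κ : Cl4) v, fun h0 => hv ?_, fun γ hγ => ?_⟩
  · rw [← Spin4.cliffordAct_inv_self κ v, h0, cliffordAct, Matrix.mulVec_zero]
  · obtain ⟨a, ha⟩ := Spin4.rotation_surjective ⟨γ, hΓ γ hγ⟩
    have ha' : a.rotation.1 = γ := congrArg Subtype.val ha
    obtain ⟨b, hb, hbv⟩ := h a (by rwa [ha'])
    refine ⟨κ * b * κ⁻¹, ?_, ?_⟩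
    · rw [Spin4.rotation_mul, Spin4.rotation_mul, hb, Spin4.rotation_mul, Spin4.rotation_mul,
        Spin4.rotation_inv, mul_assoc, mul_assoc, mul_inv_cancel, mul_one, mul_inv_cancel_left,
        ha']
    · rw [Spin4.cliffordAct_mul, Spin4.cliffordAct_inv_self, Spin4.cliffordAct_mul, hbv]

/-- After transport by the frame and conjugation by a rotation, `J` is left or right multiplication
by `i`. One block of every lift is then ±1, and choosing the sign fixes a whole half-spin space. -/
theorem IsContainedInSU.hasFixedSpinor {b : EucSpace 4 → EucSpace 4 → ℝ}
    {e : EucSpace 4 ≃ₗ[ℝ] EucSpace 4} {Γ : Set (EucSpace 4 ≃ₗᵢ[ℝ] EucSpace 4)}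
    (hb : ∀ v w, b (e v) (e w) = inner ℝ v w) (he : ∀ γ ∈ Γ, ∀ v, γ (e v) = e (γ v))
    (hΓ : ∀ γ ∈ Γ, γ ∈ SpecialOrthogonal 4) {J : Module.End ℝ (EucSpace 4)}
    (h : IsContainedInSU b J
      {T | ∃ γ ∈ Γ, T = (γ.toLinearEquiv : EucSpace 4 →ₗ[ℝ] EucSpace 4)}) :
    HasFixedSpinor Γ := by
  obtain ⟨hbJ, hJ, hT⟩ := h
  have hJJ : ∀ v, J (J v) = -v := fun v => LinearMap.congr_fun hJ v
  have hb' : ∀ v w, b v w = inner ℝ (e.symm v) (e.symm w) := by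
    intro v w
    rw [← hb, e.apply_symm_apply, e.apply_symm_apply]
  let J₀ : Module.End ℝ (EucSpace 4) :=
    (e.symm : EucSpace 4 →ₗ[ℝ] EucSpace 4) ∘ₗ J ∘ₗ (e : EucSpace 4 →ₗ[ℝ] EucSpace 4)
  have hJ₀ : ∀ v, J₀ v = e.symm (J (e v)) := fun v => rfl
  have heJ : ∀ v, e (J₀ v) = J (e v) := fun v => e.apply_symm_apply _
  have hsq : J₀ * J₀ = -1 := by
    refine LinearMap.ext fun v => ?_
    change J₀ (J₀ v) = -v
    apply e.injective
    rw [heJ, heJ, hJJ, map_neg]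
  have hin : ∀ v w, inner ℝ (J₀ v) (J₀ w) = (inner ℝ v w : ℝ) := by
    intro v w
    rw [← hb, heJ, heJ, hbJ, hb]
  have he' : ∀ γ ∈ Γ, ∀ v, e.symm (γ v) = γ (e.symm v) := by
    intro γ hγ v
    rw [LinearEquiv.symm_apply_eq, ← he γ hγ, e.apply_symm_apply]
  have hcomm : ∀ γ ∈ Γ, ∀ v, γ (J₀ v) = J₀ (γ v) := by
    intro γ hγ v
    obtain ⟨-, hc, -⟩ := hT _ ⟨γ, hγ, rfl⟩
    have hc' : γ (J (e v)) = J (γ (e v)) := LinearMap.congr_fun hc (e v)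
    rw [hJ₀, hJ₀, ← he' γ hγ, hc', he γ hγ]
  obtain ⟨κ, hκ⟩ := exists_isometry_det_one hsq hin
  have hrot : ∀ (a : Spin4) v, κ.rotation.1 ((κ⁻¹ * a * κ).rotation.1 v) =
      a.rotation.1 (κ.rotation.1 v) := by
    intro a v
    have h1 : κ.rotation * (κ⁻¹ * a * κ).rotation = a.rotation * κ.rotation := by
      rw [← Spin4.rotation_mul, ← Spin4.rotation_mul, mul_assoc, mul_inv_cancel_left]
    exact congrArg (fun h : SpecialOrthogonal 4 => h.1 v) h1
  -- the complex determinant in the coordinates given by `κ`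
  have hdet : ∀ (I₀ : Module.End ℝ (EucSpace 4)) (L : EucSpace 4 ≃ₗ[ℝ] (Fin 2 → ℂ))
      (_ : ∀ v, L (I₀ v) = Complex.I • L v)
      (_ : ∀ v, J₀ (κ.rotation.1 v) = κ.rotation.1 (I₀ v)) (a : Spin4) (_ : a.rotation.1 ∈ Γ)
      (A : Matrix (Fin 2) (Fin 2) ℂ)
      (_ : ∀ v, L ((κ⁻¹ * a * κ).rotation.1 v) = A.mulVec (L v)), A.det = 1 := by
    intro I₀ L hL hI a ha A hA
    obtain ⟨-, hc, hd⟩ := hT _ ⟨_, ha, rfl⟩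
    rw [← hd]
    obtain ⟨k, hk⟩ : ∃ k : EucSpace 4 ≃ₗ[ℝ] EucSpace 4, ∀ v, k v = e (κ.rotation.1 v) :=
      ⟨κ.rotation.1.toLinearEquiv.trans e, fun v => rfl⟩
    have hks : ∀ v, L (k.symm (k v)) = L v := fun v => by rw [k.symm_apply_apply]
    symm
    refine complexDet_eq_det hJ hc (k.symm.trans L) A (fun v => ?_) (fun v => ?_)
    · obtain ⟨u, rfl⟩ : ∃ u, v = k u := ⟨k.symm v, (k.apply_symm_apply v).symm⟩
      rw [LinearEquiv.trans_apply, LinearEquiv.trans_apply, hks, hk, ← heJ, hI, ← hk, hks, hL]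
    · obtain ⟨u, rfl⟩ : ∃ u, v = k u := ⟨k.symm v, (k.apply_symm_apply v).symm⟩
      rw [LinearEquiv.trans_apply, LinearEquiv.trans_apply, hks]
      change L (k.symm (a.rotation.1 (k u))) = _
      rw [hk, he _ ha, ← hrot, ← hk, hks, hA]
  have hcomm' : ∀ (I₀ : Module.End ℝ (EucSpace 4))
      (_ : ∀ v, J₀ (κ.rotation.1 v) = κ.rotation.1 (I₀ v)) (a : Spin4) (_ : a.rotation.1 ∈ Γ) v,
      (κ⁻¹ * a * κ).rotation.1 (I₀ v) = I₀ ((κ⁻¹ * a * κ).rotation.1 v) := by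
    intro I₀ hI a ha v
    apply κ.rotation.1.injective
    rw [hrot, ← hI, ← hI, hcomm _ ha, hrot]
  rcases hκ with hκ | hκ
  -- Any non-zero spinor in the second summand would do, as the chosen lifts act trivially there.
  · refine HasFixedSpinor.of_conj κ (v := Sum.elim 0 1) (fun h0 => ?_) (fun a ha => ?_) hΓ
    · simpa using congrFun h0 (Sum.inr 0)
    · have hoff := Spin4.snd_offdiag_of_commute (hcomm' _ hκ a ha)
      have hd := hdet _ quatRow quatRow_quatLeftI hκ a ha _ (Spin4.quatRow_rotation hoff)
      rw [Matrix.det_smul, Matrix.det_transpose, ← Spin4.fst_inv, Spin4.det_fst, mul_one,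
        Fintype.card_fin] at hd
      obtain ⟨b, hb1, hb2⟩ := Spin4.exists_fixing_of_snd
        ((Spin4.isQuaternionic_snd _).eq_one_or_of_offdiag hoff hd)
      refine ⟨b, hb1, (Spin4.act_eq_self_iff b _).2 ⟨?_, ?_⟩⟩
      · have : Spinor.fstPart (Sum.elim 0 1 : Spinor) = 0 := rfl
        rw [this, Matrix.mulVec_zero]
      · rw [hb2, Matrix.one_mulVec]
  · refine HasFixedSpinor.of_conj κ (v := Sum.elim 1 0) (fun h0 => ?_) (fun a ha => ?_) hΓ
    · simpa using congrFun h0 (Sum.inl 0)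
    · have hoff := Spin4.fst_offdiag_of_commute (hcomm' _ hκ a ha)
      have hd := hdet _ quatCol quatCol_quatRightI hκ a ha _ (Spin4.quatCol_rotation hoff)
      rw [Matrix.det_smul, Spin4.det_snd, mul_one, Fintype.card_fin, ← star_pow,
        star_eq_iff_star_eq, star_one] at hd
      obtain ⟨b, hb1, hb2⟩ := Spin4.exists_fixing_of_fst
        ((Spin4.isQuaternionic_fst _).eq_one_or_of_offdiag hoff hd.symm)
      refine ⟨b, hb1, (Spin4.act_eq_self_iff b _).2 ⟨?_, ?_⟩⟩
      · rw [hb2, Matrix.one_mulVec]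
      · have : Spinor.sndPart (Sum.elim 1 0 : Spinor) = 0 := rfl
        rw [this, Matrix.mulVec_zero]

/-! ### Stabilizers in the spin bundle and vanishing of spinor fields -/

section

variable {M : Type u} [TopologicalSpace M] {O : OrientedOrbifold 4 M} {g : OrbifoldMetric O}
  {U : Opens M} {i : O.ι} {y : EucSpace 4}

/-- The isotropy group lies in `SU(2)` for some complex structure iff it fixes a spinor. -/
theorem isotropyInSU_iff (hy : y ∈ (O.chart i).dom) :
    IsotropyInSU g i y ↔
      HasFixedSpinor ((O.chart i).isotropy y : Set (EucSpace 4 ≃ₗᵢ[ℝ] EucSpace 4)) := by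
  let e : EucSpace 4 ≃ₗ[ℝ] EucSpace 4 := LinearEquiv.ofLinearMap (g.symFrame i y).toLinearMap
    (g.symFrameInv i y).toLinearMap
    (LinearMap.ext fun v => DFunLike.congr_fun (g.mul_symFrameInv hy) v)
    (LinearMap.ext fun v => DFunLike.congr_fun (g.symFrameInv_mul hy) v)
  have he : ∀ v, e v = g.symFrame i y v := fun v => rfl
  have hb : ∀ v w, g.metric i y (e v) (e w) = inner ℝ v w := (g.symFrame_mem_frames hy).2.1
  have hc : ∀ γ ∈ ((O.chart i).isotropy y : Set (EucSpace 4 ≃ₗᵢ[ℝ] EucSpace 4)), ∀ v,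
      γ (e v) = e (γ v) := by
    rintro γ ⟨hγ, hγy⟩ v
    have h := DFunLike.congr_fun (g.symFrame_group hγ hy) v
    rw [hγy] at h
    exact h
  constructor
  · rintro ⟨J, hJ⟩
    exact hJ.hasFixedSpinor (b := fun v w => g.metric i y v w) hb hc
      fun γ hγ => (O.chart i).group_le hγ.1
  · intro h
    exact h.exists_isContainedInSU (b := fun v w => g.metric i y v w) hb hc

namespace SpinStructure

variable (σ : SpinStructure g U)

theorem π_act (p : σ.P) (a : Spin4) : (σ.π (σ.act p a)).1 = g.rotate (σ.π p).1 a.rotation :=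
  σ.equivariant p a _ a.spinCovers_rotation

theorem act_inv_act (p : σ.P) (a : Spin4) : σ.act (σ.act p a) a⁻¹ = p := by
  rw [← σ.act_mul, mul_inv_cancel, σ.act_one]

theorem act_minusOne_ne (p : σ.P) : σ.act p Spin4.minusOne ≠ p :=
  σ.neg_one_free p _ Spin4.coe_minusOne

theorem π_act_eq_spinFrame {p : σ.P} {z : (O.chart i).dom} {b : Spin4}
    (hp : (σ.π p).1 = g.spinFrame (z, b)) (a : Spin4) :
    (σ.π (σ.act p a)).1 = g.spinFrame (z, b * a) := by
  rw [π_act, hp, OrbifoldMetric.spinFrame_mul]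

theorem π_act_minusOne (p : σ.P) : σ.π (σ.act p Spin4.minusOne) = σ.π p := by
  obtain ⟨i, f, hf⟩ := g.frameMk_surjective (σ.π p).1
  obtain ⟨a, ha⟩ := g.exists_spinFrame_eq (⟨f.1.1, f.2.1⟩ : (O.chart i).dom)
    (f := (σ.π p).1) (by rw [← hf]; rfl)
  apply Subtype.ext
  rw [σ.π_act_eq_spinFrame ha.symm, ← ha, OrbifoldMetric.spinFrame_eq_iff]
  refine ⟨1, one_mem _, rfl, ?_⟩
  rw [one_mul, Spin4.rotation_mul, Spin4.rotation_minusOne, mul_one]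

/-- The points `p` and `p · (-1)` are distinct and lie in the same fibre, which has only two points.
-/
theorem eq_or_eq_of_π_eq {p q : σ.P} (h : σ.π q = σ.π p) :
    q = p ∨ q = σ.act p Spin4.minusOne := by
  have hfin : (σ.π ⁻¹' {σ.π p}).Finite :=
    Set.finite_of_ncard_ne_zero (by rw [σ.two_sheets]; norm_num)
  have hsub : ({p, σ.act p Spin4.minusOne} : Set σ.P) ⊆ σ.π ⁻¹' {σ.π p} := by
    rintro r (rfl | rfl)
    · rfl
    · exact σ.π_act_minusOne p
  have heq := Set.eq_of_subset_of_ncard_le hsub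
    (by rw [σ.two_sheets, Set.ncard_pair (σ.act_minusOne_ne p).symm]) hfin
  have hq : q ∈ ({p, σ.act p Spin4.minusOne} : Set σ.P) := by rw [heq]; exact h
  exact hq

theorem exists_π_eq (f : {f : g.FrameBundle // g.base f ∈ U}) : ∃ p, σ.π p = f :=
  Set.nonempty_of_ncard_ne_zero (s := σ.π ⁻¹' {f}) (by rw [σ.two_sheets]; norm_num)

/-- Points of the spin bundle in the orbit of `p` are those over the same point of the base. -/
theorem exists_act_eq {p q : σ.P} {z : (O.chart i).dom} {a : Spin4}
    (hp : (σ.π p).1 = g.spinFrame (z, a)) (hq : σ.base q = (O.chart i).proj z.1) :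
    ∃ b, σ.act p b = q := by
  obtain ⟨c, hc⟩ := g.exists_spinFrame_eq z (f := (σ.π q).1) hq
  have h : σ.π q = σ.π (σ.act p (a⁻¹ * c)) := by
    apply Subtype.ext
    rw [σ.π_act_eq_spinFrame hp, mul_inv_cancel_left, hc]
  rcases σ.eq_or_eq_of_π_eq h with h | h
  · exact ⟨_, h.symm⟩
  · exact ⟨_, (σ.act_mul _ _ _).trans h.symm⟩

theorem exists_over_frame (z : (O.chart i).dom) (hz : (O.chart i).proj z.1 ∈ U) :
    ∃ p, (σ.π p).1 = g.spinFrame (z, 1) := by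
  obtain ⟨p, hp⟩ := σ.exists_π_eq ⟨g.spinFrame (z, 1), by rwa [OrbifoldMetric.base_spinFrame]⟩
  exact ⟨p, by rw [hp]⟩

section Stabilizer

variable {σ} {p : σ.P} {hy : y ∈ (O.chart i).dom}

theorem rotation_mem_isotropy (hp : (σ.π p).1 = g.spinFrame (⟨y, hy⟩, 1)) {a : Spin4} (ha : σ.act p a = p) :
    a.rotation.1 ∈ (O.chart i).isotropy y := by
  have h := σ.π_act_eq_spinFrame hp a
  rw [ha, hp, OrbifoldMetric.spinFrame_eq_iff] at h
  obtain ⟨γ, hγ, hγy, h⟩ := h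
  rw [one_mul, Spin4.rotation_one] at h
  rw [← h]
  exact ⟨hγ, hγy⟩

/-- Since `γ` fixes the frame class up to the rotation it covers, a lift of `γ` sends `p` to itself
or to `p · (-1)`; in the second case minus the lift fixes `p`. -/
theorem exists_stabilizer_lift (hp : (σ.π p).1 = g.spinFrame (⟨y, hy⟩, 1))
    {γ : EucSpace 4 ≃ₗᵢ[ℝ] EucSpace 4}
    (hγ : γ ∈ (O.chart i).isotropy y) : ∃ a : Spin4, a.rotation.1 = γ ∧ σ.act p a = p := by
  obtain ⟨a, ha⟩ := Spin4.rotation_surjective ⟨γ, (O.chart i).group_le hγ.1⟩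
  have hγ' : a.rotation.1 = γ := congrArg Subtype.val ha
  have h : σ.π (σ.act p a) = σ.π p := by
    apply Subtype.ext
    rw [σ.π_act_eq_spinFrame hp, hp]
    symm
    rw [OrbifoldMetric.spinFrame_eq_iff]
    refine ⟨γ, hγ.1, hγ.2, ?_⟩
    rw [one_mul, Spin4.rotation_one, hγ']
    rfl
  rcases σ.eq_or_eq_of_π_eq h with h | h
  · exact ⟨a, hγ', h⟩
  · refine ⟨a * Spin4.minusOne, ?_, ?_⟩
    · rw [Spin4.rotation_mul, Spin4.rotation_minusOne, mul_one, hγ']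
    · rw [σ.act_mul, h, ← σ.act_mul, Spin4.minusOne_mul_self, σ.act_one]

theorem hasFixedSpinor (hp : (σ.π p).1 = g.spinFrame (⟨y, hy⟩, 1)) {v : Spinor} (hv : v ≠ 0)
    (h : ∀ a : Spin4, σ.act p a = p → cliffordAct (a : Cl4) v = v) :
    HasFixedSpinor ((O.chart i).isotropy y : Set (EucSpace 4 ≃ₗᵢ[ℝ] EucSpace 4)) := by
  refine ⟨v, hv, fun γ hγ => ?_⟩
  obtain ⟨a, ha, hpa⟩ := exists_stabilizer_lift hp hγ
  exact ⟨a, ha, h a hpa⟩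

end Stabilizer

end SpinStructure

namespace SpinorField

variable {σ : SpinStructure g U} (ψ : SpinorField σ)

theorem toFun_fixed {p : σ.P} {a : Spin4} (h : σ.act p a = p) :
    cliffordAct (a : Cl4) (ψ.toFun p) = ψ.toFun p := by
  have h1 := ψ.equivariant p a⁻¹
  rw [inv_inv] at h1
  rw [← h1]
  congr 1
  conv_lhs => rw [← h, σ.act_inv_act]

/-- The fibre over a point of the orbifold is one Spin(4)-orbit, so vanishing can be tested at one
point of it. -/
theorem vanishesAt_of_eq_zero {p : σ.P} {z : (O.chart i).dom} {a : Spin4}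
    (hp : (σ.π p).1 = g.spinFrame (z, a)) (h : ψ.toFun p = 0) :
    ψ.VanishesAt ((O.chart i).proj z.1) := by
  intro q hq
  obtain ⟨b, rfl⟩ := σ.exists_act_eq hp hq
  rw [ψ.equivariant, h, cliffordAct, Matrix.mulVec_zero]

theorem vanishesAt_or_vanishesAt (φ : SpinorField σ) (hψ : ψ.IsPositive) (hφ : φ.IsNegative)
    (hy : y ∈ (O.chart i).dom) (hU : (O.chart i).proj y ∈ U) (hsing : (O.chart i).isotropy y ≠ ⊥) :
    ψ.VanishesAt ((O.chart i).proj y) ∨ φ.VanishesAt ((O.chart i).proj y) := by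
  obtain ⟨p, hp⟩ := σ.exists_over_frame ⟨y, hy⟩ hU
  by_contra! h
  obtain ⟨γ, hγ, hγ1⟩ := (Subgroup.ne_bot_iff_exists_ne_one).1 hsing |>.elim
    fun γ hγ => (⟨γ.1, γ.2, fun h => hγ (Subtype.ext h)⟩ :
      ∃ γ, γ ∈ (O.chart i).isotropy y ∧ γ ≠ 1)
  obtain ⟨a, rfl, ha⟩ := SpinStructure.exists_stabilizer_lift hp hγ
  have h1 : ψ.toFun p ≠ 0 := fun h0 => h.1 (ψ.vanishesAt_of_eq_zero hp h0)
  have h2 : φ.toFun p ≠ 0 := fun h0 => h.2 (φ.vanishesAt_of_eq_zero hp h0)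
  have h3 := (Spinor.fstPart_ne_or_sndPart_ne h1).resolve_left
    (not_not_intro (hψ p).fstPart_eq)
  have h4 := (Spinor.fstPart_ne_or_sndPart_ne h2).resolve_right
    (not_not_intro (hφ p).sndPart_eq)
  -- The negative spinor makes the first block trivial and the positive one the second.
  have h5 : a = 1 := Spin4.ext_fst_snd
    ((Spin4.fst_eq_one_of_fixed h4 (φ.toFun_fixed ha)).trans Spin4.fst_one.symm)
    ((Spin4.snd_eq_one_of_fixed h3 (ψ.toFun_fixed ha)).trans Spin4.snd_one.symm)
  exact hγ1 (by rw [h5, Spin4.rotation_one]; rfl)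

theorem vanishesAt_of_not_isotropyInSU (hy : y ∈ (O.chart i).dom)
    (hU : (O.chart i).proj y ∈ U) (h : ¬ IsotropyInSU g i y) :
    ψ.VanishesAt ((O.chart i).proj y) := by
  obtain ⟨p, hp⟩ := σ.exists_over_frame ⟨y, hy⟩ hU
  refine ψ.vanishesAt_of_eq_zero hp ?_
  by_contra h0
  exact h ((isotropyInSU_iff hy).2
    (SpinStructure.hasFixedSpinor hp h0 fun a ha => ψ.toFun_fixed ha))

end SpinorField

end

/-! ### Open maps and quotient maps -/

section Topology

variable {X Y Z : Type*} [TopologicalSpace X] [TopologicalSpace Y] [TopologicalSpace Z]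

theorem IsLocalHomeomorph.isOpenMap_of_comp {π : Y → Z} (hπ : IsLocalHomeomorph π) {f : X → Y}
    (hf : Continuous f) (h : IsOpenMap (π ∘ f)) : IsOpenMap f := by
  refine IsOpenMap.of_nhds_le fun x => ?_
  obtain ⟨e, he, rfl⟩ := hπ (f x)
  have h1 : e.source ∈ 𝓝 (f x) := e.open_source.mem_nhds he
  refine (Filter.map_le_map_iff_of_injOn h1 (hf.continuousAt h1) e.injOn).1 ?_
  rw [hπ.map_nhds_eq, Filter.map_map]
  exact h.nhds_le x

/-- Serves to compare two spin bundles over a slice, both presented as quotients of the same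
product. -/
theorem Topology.IsQuotientMap.exists_homeomorph {f : X → Y} {f' : X → Z}
    (hf : IsQuotientMap f) (hf' : IsQuotientMap f') (h : ∀ x x', f x = f x' ↔ f' x = f' x') :
    ∃ Φ : Y ≃ₜ Z, ∀ x, Φ (f x) = f' x := by
  have h1 : ∀ x, f' (Function.surjInv hf.surjective (f x)) = f' x := fun x =>
    (h _ _).1 (Function.surjInv_eq hf.surjective _)
  have h2 : ∀ x, f (Function.surjInv hf'.surjective (f' x)) = f x := fun x =>
    (h _ _).2 (Function.surjInv_eq hf'.surjective _)
  refine ⟨{ toFun := fun y => f' (Function.surjInv hf.surjective y)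
            invFun := fun z => f (Function.surjInv hf'.surjective z)
            left_inv := fun y => ?_
            right_inv := fun z => ?_
            continuous_toFun := ?_
            continuous_invFun := ?_ }, h1⟩
  · obtain ⟨x, rfl⟩ := hf.surjective y
    simp only [h1, h2]
  · obtain ⟨x, rfl⟩ := hf'.surjective z
    simp only [h1, h2]
  · exact hf.continuous_iff.2 (hf'.continuous.congr fun x => (h1 x).symm)
  · exact hf'.continuous_iff.2 (hf.continuous.congr fun x => (h2 x).symm)

end Topology

/-! ### Slices and the local form of a spin bundle -/

namespace OrbifoldChart

variable {n : ℕ} {M : Type u} [TopologicalSpace M]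

/-- A convex slice for the action of the group of the chart near `y`. -/
structure IsSlice (c : OrbifoldChart n M) (y : EucSpace n) (B : Set (EucSpace n)) : Prop where
  isOpen : IsOpen B
  convex : Convex ℝ B
  mem : y ∈ B
  subset : B ⊆ c.dom
  apply_mem : ∀ γ ∈ c.isotropy y, ∀ z ∈ B, γ z ∈ B
  fixes : ∀ γ ∈ c.group, ∀ z ∈ B, γ z ∈ B → γ y = y

theorem continuousOn_proj (c : OrbifoldChart n M) : ContinuousOn c.proj c.dom :=
  c.toHomeo.symm.continuousOn.comp continuous_quotient_mk'.continuousOn fun _ h => h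

theorem isOpenMap_mk (c : OrbifoldChart n M) :
    IsOpenMap (Quotient.mk (orbitSetoid c.group)) := by
  intro W hW
  have h : Quotient.mk (orbitSetoid c.group) ⁻¹' (Quotient.mk (orbitSetoid c.group) '' W) =
      ⋃ γ : c.group, γ.1 ⁻¹' W := by
    ext z
    simp only [Set.mem_preimage, Set.mem_image, Set.mem_iUnion]
    constructor
    · rintro ⟨w, hw, hwz⟩
      obtain ⟨γ, hγ, h⟩ := Quotient.exact hwz.symm
      exact ⟨⟨γ, hγ⟩, by rwa [h]⟩
    · rintro ⟨γ, hγ⟩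
      exact ⟨_, hγ, c.mk_group_apply γ.2 z⟩
  exact isOpen_coinduced.2 (h.symm ▸ isOpen_iUnion fun γ => hW.preimage γ.1.continuous)

theorem isOpen_proj_image (c : OrbifoldChart n M) {B : Set (EucSpace n)} (hB : IsOpen B)
    (h : B ⊆ c.dom) : IsOpen (c.proj '' B) := by
  have h1 : c.proj '' B = c.toHomeo.symm '' (Quotient.mk (orbitSetoid c.group) '' B) := by
    rw [Set.image_image]
    rfl
  rw [h1]
  refine c.toHomeo.symm.isOpen_image_of_subset_source (c.isOpenMap_mk B hB) ?_
  rintro _ ⟨z, hz, rfl⟩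
  exact h hz

theorem exists_isSlice (c : OrbifoldChart n M) {y : EucSpace n} (hy : y ∈ c.dom) {W : Set M}
    (hW : IsOpen W) (hyW : c.proj y ∈ W) : ∃ B, c.IsSlice y B ∧ ∀ z ∈ B, c.proj z ∈ W := by
  have := c.finite_group
  have h1 : IsOpen (c.dom ∩ c.proj ⁻¹' W) := c.continuousOn_proj.isOpen_inter_preimage c.isOpen_dom hW
  obtain ⟨ε, hε, hsub⟩ := Metric.isOpen_iff.1 h1 y ⟨hy, hyW⟩
  -- The radius is less than half of each non-zero displacement of `y` by the finite group, so an
  -- element mapping a point of the ball into the ball must fix `y`.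
  have h2 : ∀ γ : c.group, ∀ᶠ r in 𝓝[>] (0 : ℝ), γ.1 y = y ∨ 2 * r < dist (γ.1 y) y := by
    intro γ
    by_cases hγ : γ.1 y = y
    · exact Filter.Eventually.of_forall fun r => Or.inl hγ
    · filter_upwards [Ioo_mem_nhdsGT (half_pos (dist_pos.2 hγ))] with r hr
      right
      linarith [hr.2]
  obtain ⟨r, ⟨hr0, hrε⟩, hr⟩ :=
    (Filter.Eventually.and (Ioo_mem_nhdsGT hε) (Filter.eventually_all.2 h2)).exists
  have hB : Metric.ball y r ⊆ c.dom ∩ c.proj ⁻¹' W := (Metric.ball_subset_ball hrε.le).trans hsub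
  refine ⟨Metric.ball y r, ⟨Metric.isOpen_ball, convex_ball y r, Metric.mem_ball_self hr0,
    fun z hz => (hB hz).1, ?_, ?_⟩, fun z hz => (hB hz).2⟩
  · rintro γ ⟨hγ, hγy⟩ z hz
    rw [Metric.mem_ball] at hz ⊢
    calc dist (γ z) y = dist (γ z) (γ y) := by rw [hγy]
      _ = dist z y := γ.dist_map z y
      _ < r := hz
  · intro γ hγ z hz hγz
    refine (hr ⟨γ, hγ⟩).resolve_right fun h => ?_
    rw [Metric.mem_ball] at hz hγz
    have h3 := dist_triangle (γ y) (γ z) y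
    have h4 : dist (γ y) (γ z) = dist z y := by rw [γ.dist_map, dist_comm]
    have h5 : 2 * r < dist (γ y) y := h
    linarith

end OrbifoldChart

namespace SpinStructure

variable {M : Type u} [TopologicalSpace M] {O : OrientedOrbifold 4 M} {g : OrbifoldMetric O}
  {U : Opens M} {i : O.ι} {y : EucSpace 4} {B : Set (EucSpace 4)} (σ : SpinStructure g U)

/-- The symmetric frame over a slice lifts to the spin bundle. -/
theorem exists_section (hB : (O.chart i).IsSlice y B) (hBU : ∀ z ∈ B, (O.chart i).proj z ∈ U)
    {p : σ.P} (hp : (σ.π p).1 = g.spinFrame (⟨y, hB.subset hB.mem⟩, 1)) :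
    ∃ s : B → σ.P, Continuous s ∧ s ⟨y, hB.mem⟩ = p ∧
      ∀ z : B, (σ.π (s z)).1 = g.spinFrame (⟨z, hB.subset z.2⟩, 1) := by
  -- A convex slice is contractible and locally path connected, so a map from it lifts through the
  -- covering.
  have : ContractibleSpace B := hB.convex.contractibleSpace ⟨y, hB.mem⟩
  have : LocallyPathConnectedSpace B := hB.isOpen.locallyPathConnectedSpace
  have hj : Continuous fun z : B => g.spinFrame ((⟨z, hB.subset z.2⟩ : (O.chart i).dom), 1) :=
    g.continuous_spinFrame.comp
      ((continuous_subtype_val.subtype_mk _).prodMk continuous_const)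
  have hjU : ∀ z : B, g.base (g.spinFrame ((⟨z, hB.subset z.2⟩ : (O.chart i).dom), 1)) ∈ U := by
    intro z
    rw [OrbifoldMetric.base_spinFrame]
    exact hBU z z.2
  let j : C(B, {f : g.FrameBundle // g.base f ∈ U}) := ⟨fun z => ⟨_, hjU z⟩, hj.subtype_mk hjU⟩
  obtain ⟨F, ⟨h1, h2⟩, -⟩ := σ.isCoveringMap.existsUnique_continuousMap_lifts j ⟨y, hB.mem⟩ p
    (Subtype.ext hp)
  exact ⟨F, F.continuous, h1, fun z => congrArg Subtype.val (congrFun h2 z)⟩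

/-- Over a slice, the spin bundle is the quotient of a product by the stabilizer of a point. -/
theorem exists_uniformization (hB : (O.chart i).IsSlice y B)
    (hBU : ∀ z ∈ B, (O.chart i).proj z ∈ U) {V : Set M} (hV : V = (O.chart i).proj '' B)
    {p : σ.P} (hp : (σ.π p).1 = g.spinFrame (⟨y, hB.subset hB.mem⟩, 1)) :
    ∃ Q : B × Spin4 → {q : σ.P // σ.base q ∈ V}, Topology.IsQuotientMap Q ∧
      (∀ z : B, ∀ a, (σ.π (Q (z, a)).1).1 = g.spinFrame (⟨z, hB.subset z.2⟩, a)) ∧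
      (∀ z b a, (Q (z, b * a)).1 = σ.act (Q (z, b)).1 a) ∧
      ∀ q r : B × Spin4, Q q = Q r ↔
        ∃ c, σ.act p c = p ∧ c.rotation.1 q.1.1 = r.1.1 ∧ r.2 = c * q.2 := by
  obtain ⟨s, hs, hsy, hsπ⟩ := σ.exists_section hB hBU hp
  have : PreconnectedSpace B := isPreconnected_iff_preconnectedSpace.1 hB.convex.isPreconnected
  have hiso : ∀ {c}, σ.act p c = p → c.rotation.1 ∈ (O.chart i).isotropy y :=
    fun h => rotation_mem_isotropy hp h
  -- the section is equivariant
  have hequiv : ∀ c (hc : σ.act p c = p) (z : B),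
      σ.act (s ⟨c.rotation.1 z.1, hB.apply_mem _ (hiso hc) _ z.2⟩) c = s z := by
    intro c hc z
    have hcont : Continuous fun z : B =>
        σ.act (s ⟨c.rotation.1 z.1, hB.apply_mem _ (hiso hc) _ z.2⟩) c :=
      σ.continuous_act.comp ((hs.comp
        ((c.rotation.1.continuous.comp continuous_subtype_val).subtype_mk _)).prodMk
          continuous_const)
    -- Both sides are lifts of the same family of frames over the connected slice, and they agree at
    -- `y`.
    refine congrFun (σ.isCoveringMap.eq_of_comp_eq hcont hs (funext fun z => Subtype.ext ?_)
      ⟨y, hB.mem⟩ ?_) z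
    · change (σ.π (σ.act _ c)).1 = (σ.π (s z)).1
      rw [σ.π_act_eq_spinFrame (hsπ _), hsπ]
      symm
      rw [OrbifoldMetric.spinFrame_eq_iff]
      refine ⟨c.rotation.1, (hiso hc).1, rfl, ?_⟩
      rw [one_mul, Spin4.rotation_one]
      rfl
    · have h : (⟨c.rotation.1 y, hB.apply_mem _ (hiso hc) _ hB.mem⟩ : B) = ⟨y, hB.mem⟩ :=
        Subtype.ext (hiso hc).2
      change σ.act (s ⟨c.rotation.1 y, _⟩) c = s ⟨y, hB.mem⟩
      rw [h, hsy, hc]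
  let Q₀ : B × Spin4 → σ.P := fun q => σ.act (s q.1) q.2
  have hQπ : ∀ z : B, ∀ a, (σ.π (Q₀ (z, a))).1 = g.spinFrame (⟨z, hB.subset z.2⟩, a) := by
    intro z a
    rw [σ.π_act_eq_spinFrame (hsπ z), one_mul]
  have hQV : ∀ q, σ.base (Q₀ q) ∈ V := by
    intro q
    rw [base, hQπ q.1 q.2, OrbifoldMetric.base_spinFrame, hV]
    exact ⟨q.1.1, q.1.2, rfl⟩
  have hQ₀c : Continuous Q₀ := σ.continuous_act.comp ((hs.comp continuous_fst).prodMk continuous_snd)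
  have hincl : IsOpenMap fun q : B × Spin4 => ((⟨q.1, hB.subset q.1.2⟩ : (O.chart i).dom), q.2) :=
    (hB.isOpen.isOpenMap_subtype_val.subtype_mk fun z => hB.subset z.2).prodMap IsOpenMap.id
  have hQ₀o : IsOpenMap Q₀ := by
    -- Openness is inherited from `spinFrame` through the local homeomorphism `σ.π`.
    refine σ.isCoveringMap.isLocalHomeomorph.isOpenMap_of_comp hQ₀c ?_
    have h1 : IsOpenMap fun q => (σ.π (Q₀ q)).1 := by
      have h2 : (fun q => (σ.π (Q₀ q)).1) = fun q : B × Spin4 =>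
          g.spinFrame ((⟨q.1, hB.subset q.1.2⟩ : (O.chart i).dom), q.2) :=
        funext fun q => hQπ q.1 q.2
      rw [h2]
      exact g.isOpenMap_spinFrame.comp hincl
    exact h1.subtype_mk fun q => (σ.π (Q₀ q)).2
  refine ⟨fun q => ⟨Q₀ q, hQV q⟩, IsOpenMap.isQuotientMap (hQ₀o.subtype_mk hQV)
    (hQ₀c.subtype_mk hQV) ?_, hQπ, fun z b a => σ.act_mul _ _ _, ?_⟩
  · rintro ⟨q, hq⟩
    rw [hV] at hq
    obtain ⟨z, hz, hzq⟩ := hq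
    obtain ⟨a, rfl⟩ := σ.exists_act_eq (hsπ ⟨z, hz⟩) hzq.symm
    exact ⟨(⟨z, hz⟩, a), rfl⟩
  · have hmpr : ∀ c, σ.act p c = p → ∀ z w : B, c.rotation.1 z.1 = w.1 → ∀ a,
        Q₀ (z, a) = Q₀ (w, c * a) := by
      rintro c hc z ⟨_, hw⟩ rfl a
      change σ.act (s z) a = σ.act (s _) (c * a)
      rw [σ.act_mul, hequiv c hc z]
    rintro ⟨z, a⟩ ⟨w, b⟩
    constructor
    · intro h
      have h' : Q₀ (z, a) = Q₀ (w, b) := congrArg Subtype.val h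
      have h1 := congrArg (fun r => (σ.π r).1) h'
      simp only [hQπ] at h1
      rw [OrbifoldMetric.spinFrame_eq_iff] at h1
      obtain ⟨γ, hγ, hγz, hγa⟩ := h1
      have hγz' : γ z.1 = w.1 := hγz
      have hγy : γ y = y := hB.fixes γ hγ z z.2 (by rw [hγz']; exact w.2)
      obtain ⟨c, rfl, hc⟩ := exists_stabilizer_lift hp (⟨hγ, hγy⟩ : γ ∈ (O.chart i).isotropy y)
      refine ⟨c, hc, hγz, ?_⟩
      have h2 := hmpr c hc z w hγz' a
      rw [h'] at h2
      have h3 : b.rotation = (c * a).rotation := by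
        rw [Spin4.rotation_mul]
        exact Subtype.ext hγa.symm
      -- The frames determine the spin component only up to sign; the wrong sign would give a fixed
      -- point of -1.
      refine (Spin4.eq_or_eq_of_rotation_eq h3).resolve_right fun h4 => ?_
      refine σ.act_minusOne_ne (Q₀ (w, c * a)) ?_
      conv_rhs => rw [← h2]
      change σ.act (σ.act _ _) _ = σ.act _ b
      change b = _ at h4
      rw [← σ.act_mul, h4, Spin4.minusOne_mul_comm]
    · rintro ⟨c, hc, hzw, rfl⟩
      exact Subtype.ext (hmpr c hc z w hzw a)

/-- Over a common slice both bundles are quotients of slice × Spin(4) by relations which depend only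
on the stabilizer. -/
theorem isoNear_of_stabilizer_eq {U' : Opens M} {σ' : SpinStructure g U'}
    (hy : y ∈ (O.chart i).dom) (hU : (O.chart i).proj y ∈ U) (hU' : (O.chart i).proj y ∈ U')
    {p : σ.P} (hp : (σ.π p).1 = g.spinFrame (⟨y, hy⟩, 1))
    {p' : σ'.P} (hp' : (σ'.π p').1 = g.spinFrame (⟨y, hy⟩, 1))
    (h : ∀ c, σ.act p c = p ↔ σ'.act p' c = p') :
    σ.IsoNear σ' ((O.chart i).proj y) := by
  obtain ⟨B, hB, hBW⟩ := (O.chart i).exists_isSlice hy (U ⊓ U').isOpen ⟨hU, hU'⟩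
  let V : Opens M := ⟨(O.chart i).proj '' B, (O.chart i).isOpen_proj_image hB.isOpen hB.subset⟩
  obtain ⟨Q, hQ, hQπ, hQa, hQk⟩ := σ.exists_uniformization hB (fun z hz => (hBW z hz).1)
    (V := V) rfl hp
  obtain ⟨Q', hQ', hQπ', hQa', hQk'⟩ := σ'.exists_uniformization hB (fun z hz => (hBW z hz).2)
    (V := V) rfl hp'
  obtain ⟨Φ, hΦ⟩ := hQ.exists_homeomorph hQ' fun q r => by
    rw [hQk, hQk']
    exact exists_congr fun c => and_congr_left fun _ => h c
  refine ⟨V, ⟨y, hB.mem, rfl⟩, ?_, ?_, Φ, ?_, ?_⟩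
  · rintro _ ⟨z, hz, rfl⟩
    exact (hBW z hz).1
  · rintro _ ⟨z, hz, rfl⟩
    exact (hBW z hz).2
  · intro q
    obtain ⟨⟨z, a⟩, rfl⟩ := hQ.surjective q
    rw [hΦ, hQπ, hQπ']
  · intro q r a hr
    obtain ⟨⟨z, b⟩, rfl⟩ := hQ.surjective q
    have h1 : r = Q (z, b * a) := Subtype.ext (hr.trans (hQa z b a).symm)
    rw [h1, hΦ, hΦ, hQa']

end SpinStructure

/-! ### Uniqueness of the spin structure with invariant spinors -/

namespace Spin4

theorem snd_eq_one_or_of_rotation_eq {a b : Spin4} (h : a.rotation = b.rotation)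
    (hb : b.snd = 1) : a.snd = 1 ∨ a.snd = -1 := by
  rcases eq_or_eq_of_rotation_eq h with rfl | rfl
  · exact Or.inl hb
  · right
    rw [snd_mul, snd_minusOne, hb, mul_one]

theorem fst_eq_one_or_of_rotation_eq {a b : Spin4} (h : a.rotation = b.rotation)
    (hb : b.fst = 1) : a.fst = 1 ∨ a.fst = -1 := by
  rcases eq_or_eq_of_rotation_eq h with rfl | rfl
  · exact Or.inl hb
  · right
    rw [fst_mul, fst_minusOne, hb, mul_one]

theorem rotation_eq_one_or_neg {a : Spin4} (h1 : a.fst = 1 ∨ a.fst = -1)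
    (h2 : a.snd = 1 ∨ a.snd = -1) :
    a.rotation.1 = 1 ∨ a.rotation.1 = LinearIsometryEquiv.neg ℝ := by
  have hneg : ∀ v, quatMatrix (-v) = -quatMatrix v := by
    intro v
    ext j k
    fin_cases j <;> fin_cases k <;> simp [quatMatrix] <;> ring
  have hpos : (∀ v, quatMatrix (a.rotation.1 v) = quatMatrix v) → a.rotation.1 = 1 := fun h =>
    LinearIsometryEquiv.ext fun v => quatMatrix_injective (h v)
  have hmin : (∀ v, quatMatrix (a.rotation.1 v) = -quatMatrix v) →
      a.rotation.1 = LinearIsometryEquiv.neg ℝ := fun h =>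
    LinearIsometryEquiv.ext fun v => quatMatrix_injective ((h v).trans (hneg v).symm)
  rcases h1 with h1 | h1 <;> rcases h2 with h2 | h2
  · exact Or.inl (hpos fun v => by rw [quatMatrix_rotation, h1, h2]; simp)
  · exact Or.inr (hmin fun v => by rw [quatMatrix_rotation, h1, h2]; simp)
  · exact Or.inr (hmin fun v => by rw [quatMatrix_rotation, h1, h2]; simp)
  · exact Or.inl (hpos fun v => by rw [quatMatrix_rotation, h1, h2]; simp)

theorem neg_one_ne_one_matrix : (-1 : Matrix (Fin 2) (Fin 2) ℂ) ≠ 1 := by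
  intro h
  have h1 := congrFun (congrFun h 0) 0
  norm_num [Matrix.neg_apply, Matrix.one_apply] at h1

end Spin4

/-- Two lifts of a group to `Spin(4)`, both with a fixed spinor, coincide unless the group
is contained in `{1, -1}`. -/
theorem Spin4.lift_subset {Γ : Subgroup (EucSpace 4 ≃ₗᵢ[ℝ] EucSpace 4)} {S T : Set Spin4}
    (hS : ∀ γ ∈ Γ, ∃ a ∈ S, a.rotation.1 = γ) (hT : ∀ γ ∈ Γ, ∃ a ∈ T, a.rotation.1 = γ)
    (hSΓ : ∀ a ∈ S, a.rotation.1 ∈ Γ) {v w : Spinor} (hv : v ≠ 0) (hw : w ≠ 0)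
    (hSv : ∀ a ∈ S, cliffordAct (a : Cl4) v = v) (hTw : ∀ a ∈ T, cliffordAct (a : Cl4) w = w)
    (h1 : Γ ≠ ⊥) (h2 : (Γ : Set (EucSpace 4 ≃ₗᵢ[ℝ] EucSpace 4)) ≠
      {1, LinearIsometryEquiv.neg ℝ}) : S ⊆ T := by
  intro c hc
  obtain ⟨d, hd, hdc⟩ := hT _ (hSΓ c hc)
  rcases eq_or_eq_of_rotation_eq (Subtype.ext hdc : d.rotation = c.rotation) with rfl | hdc'
  · exact hd
  exfalso
  -- Here `d` is minus `c`. As `Γ` is neither trivial nor {±1}, it cannot be contained in {±1}.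
  suffices h : ∀ γ ∈ Γ, γ = 1 ∨ γ = LinearIsometryEquiv.neg ℝ by
    apply h2
    refine Set.Subset.antisymm h ?_
    rintro _ (rfl | rfl)
    · exact Γ.one_mem
    · by_contra hn
      refine h1 ((Subgroup.eq_bot_iff_forall _).2 fun γ hγ => (h γ hγ).resolve_right ?_)
      rintro rfl
      exact hn hγ
  intro γ hγ
  obtain ⟨a, ha, rfl⟩ := hS γ hγ
  obtain ⟨b, hb, hba⟩ := hT _ hγ
  have hab : a.rotation = b.rotation := Subtype.ext hba.symm
  -- If both spinors see the same block, it is 1 for `c` and for `d = -c`, which is absurd. If they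
  -- see different blocks, both blocks of each lift are ±1.
  rcases Spinor.fstPart_ne_or_sndPart_ne hv with hv' | hv' <;>
    rcases Spinor.fstPart_ne_or_sndPart_ne hw with hw' | hw'
  · have h3 := fst_eq_one_of_fixed hw' (hTw d hd)
    rw [hdc', fst_mul, fst_minusOne, fst_eq_one_of_fixed hv' (hSv c hc), mul_one] at h3
    exact absurd h3 neg_one_ne_one_matrix
  · exact rotation_eq_one_or_neg (Or.inl (fst_eq_one_of_fixed hv' (hSv a ha)))
      (snd_eq_one_or_of_rotation_eq hab (snd_eq_one_of_fixed hw' (hTw b hb)))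
  · exact rotation_eq_one_or_neg
      (fst_eq_one_or_of_rotation_eq hab (fst_eq_one_of_fixed hw' (hTw b hb)))
      (Or.inl (snd_eq_one_of_fixed hv' (hSv a ha)))
  · have h3 := snd_eq_one_of_fixed hw' (hTw d hd)
    rw [hdc', snd_mul, snd_minusOne, snd_eq_one_of_fixed hv' (hSv c hc), mul_one] at h3
    exact absurd h3 neg_one_ne_one_matrix

section

variable {M : Type u} [TopologicalSpace M] {O : OrientedOrbifold 4 M} {g : OrbifoldMetric O}
  {U U' : Opens M} {i : O.ι} {y : EucSpace 4}

/-- Stabilizers along an orbit are conjugate, so an invariant spinor can be moved to any chosen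
point of the fibre. -/
theorem SpinStructure.HasInvariantSpinor.exists_fixed {σ : SpinStructure g U}
    {hy : y ∈ (O.chart i).dom} (h : σ.HasInvariantSpinor ((O.chart i).proj y)) {p : σ.P}
    (hp : (σ.π p).1 = g.spinFrame (⟨y, hy⟩, 1)) :
    ∃ v : Spinor, v ≠ 0 ∧ ∀ a : Spin4, σ.act p a = p → cliffordAct (a : Cl4) v = v := by
  obtain ⟨q, hq, v, hv, hfix⟩ := h
  obtain ⟨b, rfl⟩ := σ.exists_act_eq hp hq
  refine ⟨cliffordAct (b : Cl4) v, fun h0 => hv ?_, fun c hc => ?_⟩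
  · rw [← Spin4.cliffordAct_inv_self b v, h0, cliffordAct, Matrix.mulVec_zero]
  · have h1 : σ.act (σ.act p b) (b⁻¹ * c * b) = σ.act p b := by
      rw [← σ.act_mul, mul_assoc, mul_inv_cancel_left, σ.act_mul, hc]
    have h2 := hfix _ h1
    conv_rhs => rw [← h2]
    rw [← Spin4.cliffordAct_mul, ← Spin4.cliffordAct_mul, mul_assoc, mul_inv_cancel_left]

/-- A non-zero value of the field is fixed by the stabilizer in `σ`, as the invariant spinor is by
that in `σ₀`. Both stabilizers lift the isotropy group, hence coincide, and the two structures would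
be isomorphic near the point. -/
theorem SpinorField.vanishesAt_of_not_isoNear {σ : SpinStructure g U} {σ₀ : SpinStructure g U'}
    (ψ : SpinorField σ) (hy : y ∈ (O.chart i).dom) (hU : (O.chart i).proj y ∈ U)
    (hU' : (O.chart i).proj y ∈ U') (h1 : (O.chart i).isotropy y ≠ ⊥)
    (h2 : ((O.chart i).isotropy y : Set (EucSpace 4 ≃ₗᵢ[ℝ] EucSpace 4)) ≠
      {1, LinearIsometryEquiv.neg ℝ})
    (hinv : σ₀.HasInvariantSpinor ((O.chart i).proj y))
    (hiso : ¬ σ.IsoNear σ₀ ((O.chart i).proj y)) : ψ.VanishesAt ((O.chart i).proj y) := by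
  obtain ⟨p, hp⟩ := σ.exists_over_frame ⟨y, hy⟩ hU
  obtain ⟨p', hp'⟩ := σ₀.exists_over_frame ⟨y, hy⟩ hU'
  obtain ⟨v, hv, hfix⟩ := hinv.exists_fixed hp'
  refine ψ.vanishesAt_of_eq_zero hp ?_
  by_contra h0
  have hS : ∀ γ ∈ (O.chart i).isotropy y, ∃ a ∈ {a | σ.act p a = p}, a.rotation.1 = γ := by
    intro γ hγ
    obtain ⟨a, ha, ha'⟩ := SpinStructure.exists_stabilizer_lift hp hγ
    exact ⟨a, ha', ha⟩
  have hT : ∀ γ ∈ (O.chart i).isotropy y, ∃ a ∈ {a | σ₀.act p' a = p'}, a.rotation.1 = γ := by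
    intro γ hγ
    obtain ⟨a, ha, ha'⟩ := SpinStructure.exists_stabilizer_lift hp' hγ
    exact ⟨a, ha', ha⟩
  have hST := Spin4.lift_subset hS hT (fun a ha => SpinStructure.rotation_mem_isotropy hp ha)
    h0 hv (fun a ha => ψ.toFun_fixed ha) (fun a ha => hfix a ha) h1 h2
  have hTS := Spin4.lift_subset hT hS (fun a ha => SpinStructure.rotation_mem_isotropy hp' ha)
    hv h0 (fun a ha => hfix a ha) (fun a ha => ψ.toFun_fixed ha) h1 h2
  exact hiso (σ.isoNear_of_stabilizer_eq hy hU hU' hp hp' fun c =>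
    ⟨fun h => hST h, fun h => hTS h⟩)

end

/-! ### Local spin structures with invariant spinors -/

/-- The elements `1` and `-1` of `Spin(4)`. -/
def Spin4.signs : Subgroup Spin4 where
  carrier := {a | a.rotation = 1}
  one_mem' := Spin4.rotation_one
  mul_mem' := by
    intro a b ha hb
    change (a * b).rotation = 1
    rw [Spin4.rotation_mul, ha, hb, one_mul]
  inv_mem' := by
    intro a ha
    change (a⁻¹).rotation = 1
    rw [Spin4.rotation_inv, ha, inv_one]

theorem Spin4.eq_one_or_of_mem_signs (s : Spin4.signs) : s.1 = 1 ∨ s.1 = Spin4.minusOne :=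
  Spin4.eq_one_or_of_rotation_eq_one s.2

theorem Spin4.signs_mul_comm (s : Spin4.signs) (a : Spin4) : s.1 * a = a * s.1 := by
  rcases Spin4.eq_one_or_of_mem_signs s with h | h
  · rw [h, one_mul, mul_one]
  · rw [h, Spin4.minusOne_mul_comm]

/-- A slice at `y`, together with a lift of the isotropy group of `y` to `Spin(4)`. -/
structure IsotropyLift {M : Type u} [TopologicalSpace M] (c : OrbifoldChart 4 M) (y : EucSpace 4)
    (B : Set (EucSpace 4)) where
  isSlice : c.IsSlice y B
  lift : Subgroup Spin4
  rotation_mem : ∀ a ∈ lift, a.rotation.1 ∈ c.isotropy y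
  exists_lift : ∀ γ ∈ c.isotropy y, ∃ a ∈ lift, a.rotation.1 = γ
  minusOne_notMem : Spin4.minusOne ∉ lift

namespace IsotropyLift

variable {M : Type u} [TopologicalSpace M] {c : OrbifoldChart 4 M} {y : EucSpace 4}
  {B : Set (EucSpace 4)} (D : IsotropyLift c y B)

theorem injOn_rotation : Set.InjOn (fun a : Spin4 => a.rotation.1) D.lift := by
  intro a ha b hb h
  refine (Spin4.eq_or_eq_of_rotation_eq (Subtype.ext h)).resolve_right fun h1 => ?_
  apply D.minusOne_notMem
  have h2 : Spin4.minusOne = a * b⁻¹ := by rw [h1, mul_inv_cancel_right]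
  rw [h2]
  exact D.lift.mul_mem ha (D.lift.inv_mem hb)

theorem finite_lift : (D.lift : Set Spin4).Finite := by
  have : Finite c.group := c.finite_group
  have h : (c.group : Set (EucSpace 4 ≃ₗᵢ[ℝ] EucSpace 4)).Finite := Set.toFinite _
  refine Set.Finite.of_finite_image (h.subset ?_) D.injOn_rotation
  rintro _ ⟨a, ha, rfl⟩
  exact (D.rotation_mem a ha).1

/-- The equivalence relation on `B × Spin(4)` given by the lift of the isotropy group. -/
def setoid : Setoid (ULift.{u} B × Spin4) where
  -- `ULift` only places the quotient in the universe of `M`, as `SpinStructure` requires.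
  r q r := ∃ a ∈ D.lift, a.rotation.1 q.1.down.1 = r.1.down.1 ∧ r.2 = a * q.2
  iseqv :=
    { refl := fun q => ⟨1, D.lift.one_mem, by rw [Spin4.rotation_one]; rfl, (one_mul _).symm⟩
      symm := by
        rintro q r ⟨a, ha, h1, h2⟩
        refine ⟨a⁻¹, D.lift.inv_mem ha, ?_, by rw [h2, inv_mul_cancel_left]⟩
        rw [← h1, Spin4.rotation_inv]
        exact a.rotation.1.symm_apply_apply _
      trans := by
        rintro q r s ⟨a, ha, h1, h2⟩ ⟨b, hb, h3, h4⟩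
        refine ⟨b * a, D.lift.mul_mem hb ha, ?_, by rw [h4, h2, mul_assoc]⟩
        rw [← h3, ← h1, Spin4.rotation_mul]
        rfl }

/-- The local spin bundle. -/
def Bundle : Type u := Quotient D.setoid

instance : TopologicalSpace D.Bundle := inferInstanceAs (TopologicalSpace (Quotient D.setoid))

/-- The projection from the product to the local spin bundle. -/
def proj (q : ULift.{u} B × Spin4) : D.Bundle := Quotient.mk D.setoid q

theorem proj_surjective : Function.Surjective D.proj := Quotient.mk_surjective

theorem proj_eq_iff {q r : ULift.{u} B × Spin4} : D.proj q = D.proj r ↔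
    ∃ a ∈ D.lift, a.rotation.1 q.1.down.1 = r.1.down.1 ∧ r.2 = a * q.2 :=
  Quotient.eq (r := D.setoid)

theorem continuous_proj : Continuous D.proj := continuous_quotient_mk'

theorem isOpenMap_proj : IsOpenMap D.proj := by
  intro W hW
  let T : D.lift → ULift.{u} B × Spin4 → ULift.{u} B × Spin4 := fun a q =>
    (⟨⟨a.1.rotation.1 q.1.down.1,
      D.isSlice.apply_mem _ (D.rotation_mem a.1 a.2) _ q.1.down.2⟩⟩, a.1 * q.2)
  have hT : ∀ a, Continuous (T a) := by
    intro a
    refine Continuous.prodMk (continuous_uliftUp.comp (Continuous.subtype_mk ?_ _))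
      (continuous_const.mul continuous_snd)
    exact a.1.rotation.1.continuous.comp
      (continuous_subtype_val.comp (continuous_uliftDown.comp continuous_fst))
  have h : D.proj ⁻¹' (D.proj '' W) = ⋃ a, T a ⁻¹' W := by
    ext q
    simp only [Set.mem_preimage, Set.mem_image, Set.mem_iUnion]
    constructor
    · rintro ⟨r, hr, hrq⟩
      obtain ⟨a, ha, h1, h2⟩ := D.proj_eq_iff.1 hrq.symm
      refine ⟨⟨a, ha⟩, ?_⟩
      have h3 : T ⟨a, ha⟩ q = r := Prod.ext (ULift.ext _ _ (Subtype.ext h1)) h2.symm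
      rwa [h3]
    · rintro ⟨a, ha⟩
      exact ⟨_, ha, (D.proj_eq_iff.2 ⟨a.1, a.2, rfl, rfl⟩).symm⟩
  exact isOpen_coinduced.2 (h.symm ▸ isOpen_iUnion fun a => hW.preimage (hT a))

theorem isOpenQuotientMap_proj : IsOpenQuotientMap D.proj :=
  ⟨D.proj_surjective, D.continuous_proj, D.isOpenMap_proj⟩

/-- The right action of `Spin(4)` on the local spin bundle. -/
noncomputable def act (p : D.Bundle) (a : Spin4) : D.Bundle :=
  Quotient.map (sa := D.setoid) (sb := D.setoid) (fun q => (q.1, q.2 * a)) (by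
    rintro q r ⟨b, hb, h1, h2⟩
    exact ⟨b, hb, h1, by
      change r.2 * a = b * (q.2 * a)
      rw [h2, mul_assoc]⟩) p

theorem act_proj (z : ULift.{u} B) (b a : Spin4) : D.act (D.proj (z, b)) a = D.proj (z, b * a) := rfl

theorem act_one (p : D.Bundle) : D.act p 1 = p := by
  obtain ⟨⟨z, b⟩, rfl⟩ := D.proj_surjective p
  rw [act_proj, mul_one]

theorem act_mul (p : D.Bundle) (a b : Spin4) : D.act p (a * b) = D.act (D.act p a) b := by
  obtain ⟨⟨z, d⟩, rfl⟩ := D.proj_surjective p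
  rw [act_proj, act_proj, act_proj, mul_assoc]

theorem continuous_act : Continuous fun q : D.Bundle × Spin4 => D.act q.1 q.2 := by
  have h := (D.isOpenQuotientMap_proj.prodMap (IsOpenQuotientMap.id (X := Spin4))).isQuotientMap
  rw [h.continuous_iff]
  exact D.continuous_proj.comp ((continuous_fst.comp continuous_fst).prodMk
    ((continuous_snd.comp continuous_fst).mul continuous_snd))

/-- The lift contains the ratio of the `Spin(4)` components of two representatives of a point. -/
theorem mul_inv_mem_of_act_eq {q r : ULift.{u} B × Spin4} {a : Spin4}
    (h : D.act (D.proj q) a = D.proj r) : r.2 * (q.2 * a)⁻¹ ∈ D.lift := by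
  obtain ⟨b, hb, -, h2⟩ := D.proj_eq_iff.1 (h : D.proj (q.1, q.2 * a) = D.proj r)
  have h3 : r.2 * (q.2 * a)⁻¹ = b := by
    rw [h2]
    exact mul_inv_cancel_right b (q.2 * a)
  rwa [h3]

theorem act_minusOne_ne (p : D.Bundle) : D.act p Spin4.minusOne ≠ p := by
  obtain ⟨q, rfl⟩ := D.proj_surjective p
  intro h
  have h1 := D.lift.inv_mem (D.mul_inv_mem_of_act_eq h)
  rw [← Spin4.minusOne_mul_comm, mul_inv_rev, inv_inv, mul_inv_cancel_right] at h1
  exact D.minusOne_notMem h1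

noncomputable instance : MulAction Spin4.signs D.Bundle where
  smul s p := D.act p s.1
  one_smul p := D.act_one p
  mul_smul s t p := by
    change D.act p (s.1 * t.1) = D.act (D.act p t.1) s.1
    rw [Spin4.signs_mul_comm, D.act_mul]

instance : ContinuousConstSMul Spin4.signs D.Bundle where
  continuous_const_smul _ :=
    D.continuous_act.comp (continuous_id.prodMk continuous_const)

/-- A point near `p` equals -1 times another one only if a quotient of their spin components close
to -1 lies in the lift. The lift is finite, hence closed, and does not contain -1. -/
theorem exists_nhds_disjoint (p : D.Bundle) :
    ∃ W ∈ 𝓝 p, ∀ s : Spin4.signs, ((s • ·) '' W ∩ W).Nonempty → s = 1 := by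
  obtain ⟨⟨z, b⟩, rfl⟩ := D.proj_surjective p
  have hopen : IsOpen ((D.lift : Set Spin4)ᶜ) := D.finite_lift.isClosed.isOpen_compl
  have hcont : Continuous fun q : Spin4 × Spin4 => q.2 * (q.1 * Spin4.minusOne)⁻¹ := by
    fun_prop
  have hmem : b * (b * Spin4.minusOne)⁻¹ ∈ (D.lift : Set Spin4)ᶜ := by
    intro h
    have h1 := D.lift.inv_mem h
    rw [← Spin4.minusOne_mul_comm, mul_inv_rev, inv_inv, mul_inv_cancel_right] at h1
    exact D.minusOne_notMem h1
  have hev := hcont.continuousAt.eventually_mem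
    (hopen.mem_nhds hmem : (D.lift : Set Spin4)ᶜ ∈ 𝓝 ((fun q : Spin4 × Spin4 =>
      q.2 * (q.1 * Spin4.minusOne)⁻¹) (b, b)))
  rw [nhds_prod_eq] at hev
  obtain ⟨N, hN, hNN⟩ := Filter.eventually_prod_self_iff'.1 hev
  have hN' : (Prod.snd ⁻¹' N : Set (ULift.{u} B × Spin4)) ∈ 𝓝 (z, b) :=
    continuous_snd.continuousAt hN
  refine ⟨D.proj '' (Prod.snd ⁻¹' N), D.isOpenMap_proj.image_mem_nhds hN', fun s hs => ?_⟩
  obtain ⟨_, ⟨_, ⟨q, hq, rfl⟩, rfl⟩, r, hr, hrq⟩ := hs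
  rcases Spin4.eq_one_or_of_mem_signs s with h | h
  · exact Subtype.ext h
  · exfalso
    change D.proj r = D.act (D.proj q) s.1 at hrq
    rw [h] at hrq
    exact hNN q.2 hq r.2 hr (D.mul_inv_mem_of_act_eq hrq.symm)

end IsotropyLift

/-! ### The local spin structure defined by a lift of the isotropy group -/

section

variable {M : Type u} [TopologicalSpace M] {O : OrientedOrbifold 4 M} (g : OrbifoldMetric O)
  {i : O.ι} {y : EucSpace 4} {B : Set (EucSpace 4)} (D : IsotropyLift (O.chart i) y B)

namespace IsotropyLift

/-- The image of the slice in the orbifold. -/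
def opens : Opens M :=
  ⟨(O.chart i).proj '' B, (O.chart i).isOpen_proj_image D.isSlice.isOpen D.isSlice.subset⟩

/-- The frame given by a point of the product. -/
noncomputable def frame (q : ULift.{u} B × Spin4) : g.FrameBundle :=
  g.spinFrame ((⟨q.1.down.1, D.isSlice.subset q.1.down.2⟩ : (O.chart i).dom), q.2)

theorem base_frame (q : ULift.{u} B × Spin4) : g.base (D.frame g q) ∈ D.opens := by
  rw [frame, OrbifoldMetric.base_spinFrame]
  exact ⟨_, q.1.down.2, rfl⟩

/-- Inside the slice only isotropy elements identify frames; each has a lift in `D`, and the spin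
components then agree up to sign. This is why the projection is two-to-one. -/
theorem frame_eq_iff {q r : ULift.{u} B × Spin4} : D.frame g q = D.frame g r ↔
    D.proj r = D.proj q ∨ D.proj r = D.act (D.proj q) Spin4.minusOne := by
  rw [frame, frame, OrbifoldMetric.spinFrame_eq_iff]
  constructor
  · rintro ⟨γ, hγ, h1, h2⟩
    have h1' : γ q.1.down.1 = r.1.down.1 := h1
    have hγy : γ y = y := D.isSlice.fixes γ hγ _ q.1.down.2 (h1' ▸ r.1.down.2)
    obtain ⟨a, ha, rfl⟩ := D.exists_lift γ ⟨hγ, hγy⟩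
    have h3 : r.2.rotation = (a * q.2).rotation := by
      rw [Spin4.rotation_mul]
      exact Subtype.ext h2.symm
    rcases Spin4.eq_or_eq_of_rotation_eq h3 with h4 | h4
    · exact Or.inl (D.proj_eq_iff.2 ⟨a, ha, h1', h4⟩).symm
    · refine Or.inr (D.proj_eq_iff.2 ⟨a, ha, h1', ?_⟩ : D.proj (q.1, q.2 * Spin4.minusOne) = _).symm
      rw [h4, Spin4.minusOne_mul_comm, mul_assoc]
  · intro h
    have key : ∀ b : Spin4, b.rotation = 1 → D.proj (q.1, q.2 * b) = D.proj r →
        ∃ γ ∈ (O.chart i).group, γ q.1.down.1 = r.1.down.1 ∧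
          γ * q.2.rotation.1 = r.2.rotation.1 := by
      intro b hb h1
      obtain ⟨a, ha, h2, h3⟩ := D.proj_eq_iff.1 h1
      refine ⟨_, (D.rotation_mem a ha).1, h2, ?_⟩
      rw [h3, Spin4.rotation_mul, Spin4.rotation_mul, hb, mul_one]
      rfl
    rcases h with h | h
    · exact key 1 Spin4.rotation_one (by rw [mul_one]; exact h.symm)
    · exact key _ Spin4.rotation_minusOne h.symm

/-- The projection of the local spin bundle to the frame bundle. -/
noncomputable def toFrame : D.Bundle → {f : g.FrameBundle // g.base f ∈ D.opens} :=
  Quotient.lift (fun q => ⟨D.frame g q, D.base_frame g q⟩) (fun _ _ h =>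
    Subtype.ext ((D.frame_eq_iff g).2 (Or.inl (Quotient.sound h).symm)))

theorem toFrame_proj (q : ULift.{u} B × Spin4) : (D.toFrame g (D.proj q)).1 = D.frame g q := rfl

theorem toFrame_eq_iff {p q : D.Bundle} : D.toFrame g p = D.toFrame g q ↔
    q = p ∨ q = D.act p Spin4.minusOne := by
  obtain ⟨p, rfl⟩ := D.proj_surjective p
  obtain ⟨q, rfl⟩ := D.proj_surjective q
  rw [Subtype.ext_iff, toFrame_proj, toFrame_proj, frame_eq_iff]

theorem continuous_toFrame : Continuous (D.toFrame g) := by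
  refine D.isOpenQuotientMap_proj.isQuotientMap.continuous_iff.2 (Continuous.subtype_mk ?_ _)
  exact g.continuous_spinFrame.comp (Continuous.prodMk (Continuous.subtype_mk
    (continuous_subtype_val.comp (continuous_uliftDown.comp continuous_fst)) _) continuous_snd)

theorem isOpenMap_toFrame : IsOpenMap (D.toFrame g) := by
  have h1 : IsOpenMap fun z : ULift.{u} B =>
      (⟨z.down.1, D.isSlice.subset z.down.2⟩ : (O.chart i).dom) :=
    (D.isSlice.isOpen.isOpenMap_subtype_val.comp Homeomorph.ulift.isOpenMap).subtype_mk
      fun z => D.isSlice.subset z.down.2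
  have h2 : IsOpenMap (D.toFrame g ∘ D.proj) :=
    (g.isOpenMap_spinFrame.comp (h1.prodMap (IsOpenMap.id (X := Spin4)))).subtype_mk
      (D.base_frame g)
  intro W hW
  have h3 : D.toFrame g '' W = (D.toFrame g ∘ D.proj) '' (D.proj ⁻¹' W) := by
    rw [Set.image_comp, Set.image_preimage_eq _ D.proj_surjective]
  rw [h3]
  exact h2 _ (hW.preimage D.continuous_proj)

theorem toFrame_surjective : Function.Surjective (D.toFrame g) := by
  rintro ⟨f, z, hz, hf⟩
  obtain ⟨a, rfl⟩ := g.exists_spinFrame_eq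
    (⟨z, D.isSlice.subset hz⟩ : (O.chart i).dom) hf.symm
  exact ⟨D.proj (⟨⟨z, hz⟩⟩, a), rfl⟩

/-- The projection is the quotient by the group {±1}, which acts freely and properly
discontinuously. -/
theorem isCoveringMap_toFrame : IsCoveringMap (D.toFrame g) := by
  refine IsQuotientCoveringMap.isCoveringMap (G := Spin4.signs) (f := D.toFrame g)
    { toIsQuotientMap := (D.isOpenMap_toFrame g).isQuotientMap (D.continuous_toFrame g)
        (D.toFrame_surjective g)
      toContinuousConstSMul := inferInstance
      apply_eq_iff_mem_orbit := ?_
      disjoint := D.exists_nhds_disjoint }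
  intro p q
  rw [eq_comm, toFrame_eq_iff]
  constructor
  · rintro (rfl | rfl)
    · exact MulAction.mem_orbit_self _
    · exact ⟨⟨Spin4.minusOne, Spin4.rotation_minusOne⟩, rfl⟩
  · rintro ⟨s, rfl⟩
    rcases Spin4.eq_one_or_of_mem_signs s with h | h
    · left
      change D.act q s.1 = q
      rw [h, D.act_one]
    · right
      change D.act q s.1 = _
      rw [h]

/-- The spin structure near a point given by a lift of its isotropy group. -/
noncomputable def spinStructure : SpinStructure g D.opens where
  P := D.Bundle
  π := D.toFrame g
  isCoveringMap := D.isCoveringMap_toFrame g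
  two_sheets f := by
    obtain ⟨p, rfl⟩ := D.toFrame_surjective g f
    have h : D.toFrame g ⁻¹' {D.toFrame g p} = {p, D.act p Spin4.minusOne} := by
      ext q
      rw [Set.mem_preimage, Set.mem_singleton_iff, eq_comm, toFrame_eq_iff]
      rfl
    rw [h, Set.ncard_pair (D.act_minusOne_ne p).symm]
  act := D.act
  act_one := D.act_one
  act_mul := D.act_mul
  continuous_act := D.continuous_act
  equivariant p a h ha := by
    obtain ⟨⟨z, b⟩, rfl⟩ := D.proj_surjective p
    rw [ha.eq_rotation, act_proj, toFrame_proj, toFrame_proj]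
    exact g.spinFrame_mul _ b a
  neg_one_free p a ha := by
    have h : a = Spin4.minusOne := Subtype.ext ha
    rw [h]
    exact D.act_minusOne_ne p

/-- The stabilizer of the class of `(y, 1)` is contained in the lift. -/
theorem hasInvariantSpinor {v : Spinor} (hv : v ≠ 0)
    (h : ∀ a ∈ D.lift, cliffordAct (a : Cl4) v = v) :
    (D.spinStructure g).HasInvariantSpinor ((O.chart i).proj y) := by
  refine ⟨D.proj (⟨⟨y, D.isSlice.mem⟩⟩, 1), g.base_spinFrame (i := i) (⟨y, D.isSlice.subset D.isSlice.mem⟩, 1), v, hv, fun a ha => ?_⟩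
  have h1 := D.lift.inv_mem (D.mul_inv_mem_of_act_eq ha)
  rw [one_mul, one_mul, inv_inv] at h1
  exact h a h1

end IsotropyLift

theorem exists_spinStructure_hasInvariantSpinor (hy : y ∈ (O.chart i).dom)
    (h : IsotropyInSU g i y) : ∃ (U : Opens M) (σ : SpinStructure g U),
      (O.chart i).proj y ∈ U ∧ σ.HasInvariantSpinor ((O.chart i).proj y) := by
  obtain ⟨v, hv, hfix⟩ := (isotropyInSU_iff hy).1 h
  obtain ⟨B, hB, -⟩ := (O.chart i).exists_isSlice hy isOpen_univ (Set.mem_univ _)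
  let D : IsotropyLift (O.chart i) y B :=
    { isSlice := hB
      -- All spin elements over the isotropy group which fix `v`. This is a group by construction,
      -- and -1 is excluded because `v` is non-zero.
      lift :=
        { carrier := {a | a.rotation.1 ∈ (O.chart i).isotropy y ∧ cliffordAct (a : Cl4) v = v}
          one_mem' := by
            refine ⟨?_, Spin4.cliffordAct_one v⟩
            rw [Spin4.rotation_one]
            exact one_mem _
          mul_mem' := by
            rintro a b ⟨ha, ha'⟩ ⟨hb, hb'⟩
            refine ⟨?_, by rw [Spin4.cliffordAct_mul, hb', ha']⟩
            rw [Spin4.rotation_mul]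
            exact mul_mem ha hb
          inv_mem' := by
            rintro a ⟨ha, ha'⟩
            refine ⟨?_, ?_⟩
            · rw [Spin4.rotation_inv]
              exact inv_mem ha
            · conv_lhs => rw [← ha']
              exact Spin4.cliffordAct_inv_self a v }
      rotation_mem := fun a ha => ha.1
      exists_lift := by
        intro γ hγ
        obtain ⟨a, rfl, ha⟩ := hfix γ hγ
        exact ⟨a, ⟨hγ, ha⟩, rfl⟩
      minusOne_notMem := by
        rintro ⟨-, h1⟩
        rcases Spinor.fstPart_ne_or_sndPart_ne hv with h2 | h2
        · exact Spin4.neg_one_ne_one_matrix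
            (Spin4.fst_minusOne.symm.trans (Spin4.fst_eq_one_of_fixed h2 h1))
        · exact Spin4.neg_one_ne_one_matrix
            (Spin4.snd_minusOne.symm.trans (Spin4.snd_eq_one_of_fixed h2 h1)) }
  exact ⟨D.opens, D.spinStructure g, ⟨y, hB.mem, rfl⟩,
    D.hasInvariantSpinor g hv fun a ha => ha.2⟩

end

/-! ### The main theorem -/

theorem proposition1 {M : Type u} [TopologicalSpace M] [T2Space M]
    (O : OrientedOrbifold 4 M) (g : OrbifoldMetric O) (σ : SpinStructure g (⊤ : Opens M))
    (i : O.ι) (y : EucSpace 4) (hy : y ∈ (O.chart i).dom) (x : M) (hx : (O.chart i).proj y = x)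
    (hsing : (O.chart i).isotropy y ≠ ⊥) :
    (∀ φp φn : SpinorField σ, φp.IsPositive → φn.IsNegative →
      (φp.VanishesAt x ∨ φn.VanishesAt x) ∧
      (¬ IsotropyInSU g i y → φp.VanishesAt x ∧ φn.VanishesAt x)) ∧
    (IsotropyInSU g i y →
      ((O.chart i).isotropy y : Set (EucSpace 4 ≃ₗᵢ[ℝ] EucSpace 4)) ≠
        {1, LinearIsometryEquiv.neg ℝ} →
      (∃ (U₀ : Opens M) (σ₀ : SpinStructure g U₀), x ∈ U₀ ∧ σ₀.HasInvariantSpinor x) ∧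
      ∀ (U₀ U : Opens M) (σ₀ : SpinStructure g U₀) (σ' : SpinStructure g U), x ∈ U₀ → x ∈ U →
        σ₀.HasInvariantSpinor x → ¬ σ'.IsoNear σ₀ x →
        ∀ ψ : SpinorField σ', ψ.VanishesAt x) := by
  subst hx
  refine ⟨fun φp φn hp hn => ⟨?_, fun h => ⟨?_, ?_⟩⟩, fun hSU hne => ⟨?_, ?_⟩⟩
  · exact φp.vanishesAt_or_vanishesAt φn hp hn hy trivial hsing
  · exact φp.vanishesAt_of_not_isotropyInSU hy trivial h
  · exact φn.vanishesAt_of_not_isotropyInSU hy trivial h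
  · exact exists_spinStructure_hasInvariantSpinor g hy hSU
  · intro U₀ U σ₀ σ' hU₀ hU hinv hiso ψ
    exact ψ.vanishesAt_of_not_isoNear hy hU hU₀ hsing hne hinv hiso
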